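/- Let $S_0=0$, $S_n=X_1+\dots+X_n$ be a random walk whose increments are independent with the symmetric Laplace density $\tfrac12 e^{-|x|}$. Let $\tau^-=\inf\{n: S_n<0\}$, $\nu=\tau^- -1$, let $M_0\le M_1\le\dots\le M_\nu$ be the order statistics of $S_0,S_1,\dots,S_\nu$, and put $M_k=\infty$ for $k>\nu$. Let $(Z(t),t\ge 0)$ be the critical binary birth and death process, that is, the right-continuous Markov jump process on $\{0,1,2,\dots\}$ with transitions $j\to j+1$ at rate $j$ and $j\to j-1$ at rate $j$, with $\mathbb P(Z(0)=0)=\mathbb P(Z(0)=1)=\tfrac12$. Let $N$ be a standard (rate $1$) Poisson process independent of $Z$, and let $$N_{\rm marks}(t)=N\Big(\int_0^t Z(v/2)\,dv\Big),\qquad t\ge 0,$$ the Cox process with intensity $Z(t/2)$. Let $T$ be the random set of times $t>0$ such that $$Z\big(\tfrac t2\big)-Z\big(\tfrac{t-}2\big)=\pm1\quad\text{or}\quad N_{\rm marks}(t)-N_{\rm marks}(t-)=1,$$ that is, the times of the births, deaths and marks. Let $M'_0=0$ and, for $k\ge1$, let $M'_k$ be the $k$-th smallest element of $T$, with $M'_k=\infty$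 if $T$ has fewer than $k$ elements. Then (without conditioning on $\{\nu\ge 1\}$) $$\big(\nu,(M_k)_{k\ge0}\big)\ \stackrel{d}{=}\ \big(\# T,(M'_k)_{k\ge0}\big).$$ Moreover, $\nu<\infty$ almost surely, and for every real $z$ with $0<|z|\le1$, $$\mathbb E z^{\nu}=z^{-1}\big(1-\sqrt{1-z}\big).$$ -/

import Mathlib

open MeasureTheory ProbabilityTheory Set
open scoped NNReal ENNReal

noncomputable section

namespace LaplaceWalk

/-! ### The symmetric Laplace walk up to its first descending ladder time -/

/-- The standard symmetric Laplace law, with density `exp (-|x|) / 2`. -/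
def laplaceMeasure : Measure ℝ :=
  volume.withDensity fun x => ENNReal.ofReal (Real.exp (-|x|) / 2)

/-- The partial sums `S_n = X_1 + ⋯ + X_n`; the increment `X_{i+1}` is stored as `X i`. -/
def walk {Ω : Type*} (X : ℕ → Ω → ℝ) (n : ℕ) (ω : Ω) : ℝ :=
  ∑ i ∈ Finset.range n, X i ω

/-- `τ⁻ = inf {n : s_n < 0}`, the first descending ladder time of a sequence `s`
(`⊤` if there is none). -/
def descLadderTime (s : ℕ → ℝ) : ℕ∞ :=
  sInf ((fun n : ℕ => (n : ℕ∞)) '' {n | s n < 0})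

/-- `ν = τ⁻ - 1`. -/
def nu (s : ℕ → ℝ) : ℕ∞ := descLadderTime s - 1

/-- The `k`-th order statistic `M_k`, `k = 0, 1, …`, of the nonnegative values `s_0, …, s_ν`,
counted with multiplicity: the least `t ≥ 0` such that at least `k + 1` of the indices
`0 ≤ i ≤ ν` satisfy `s_i ≤ t`. It is `∞` if `k > ν`. -/
def orderStat (s : ℕ → ℝ) (k : ℕ) : ℝ≥0∞ :=
  sInf ((fun t : ℝ≥0 => (t : ℝ≥0∞)) ''
    {t : ℝ≥0 | ((k + 1 : ℕ) : ℕ∞) ≤ {i : ℕ | (i : ℕ∞) ≤ nu s ∧ s i ≤ t}.encard})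

/-! ### Birth and death processes through their jump chain and holding times -/

/-- The successive jump times `J_0 = 0 < J_1 < J_2 < ⋯` of a path, with `J_n = ∞` if there are
fewer than `n` jumps. -/
def jumpTime (x : ℝ≥0 → ℕ) : ℕ → ℝ≥0∞
  | 0 => 0
  | n + 1 => sInf ((fun t : ℝ≥0 => (t : ℝ≥0∞)) ''
      {t : ℝ≥0 | jumpTime x n < t ∧ x t ≠ x (jumpTime x n).toNNReal})

/-- The time spent in the `n`-th visited state; it is `∞` from the last visited state on. -/
def holdTime (x : ℝ≥0 → ℕ) (n : ℕ) : ℝ≥0∞ :=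
  if jumpTime x n = ⊤ then ⊤ else jumpTime x (n + 1) - jumpTime x n

/-- The successive states visited by a path; the last visited state is repeated for ever. -/
def jumpChain (x : ℝ≥0 → ℕ) : ℕ → ℕ
  | 0 => x 0
  | n + 1 => if jumpTime x (n + 1) = ⊤ then jumpChain x n else x (jumpTime x (n + 1)).toNNReal

/-- The transition matrix of the jump chain of the birth and death process with birth rates `b`
and death rates `d` (where `d 0 = 0`). States with total rate `0` are absorbing. -/
def jumpProb (b d : ℕ → ℝ≥0) (i j : ℕ) : ℝ≥0 :=
  if b i + d i = 0 then (if j = i then 1 else 0)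
  else if j = i + 1 then b i / (b i + d i)
  else if j + 1 = i then d i / (b i + d i)
  else 0

/-- `Z` is a birth and death process on `ℕ` with transitions `i → i + 1` at rate `b i` and
`i → i - 1` at rate `d i` (where `d 0 = 0`), with initial law `μ₀`: its paths are right-continuous,
its jump chain is a Markov chain with initial law `μ₀` and transition matrix `jumpProb b d`, and
given the jump chain the holding times are independent, the one in state `i` being exponential
with rate `b i + d i` (infinite if this rate is `0`). -/
structure IsBirthDeathProcess {Ω : Type*} [MeasurableSpace Ω] (b d : ℕ → ℝ≥0) (μ₀ : Measure ℕ)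
    (Z : ℝ≥0 → Ω → ℕ) (P : Measure Ω) : Prop where
  measurable : ∀ t, Measurable (Z t)
  rightContinuous : ∀ᵐ ω ∂P, ∀ t, ContinuousWithinAt (fun s => Z s ω) (Ici t) t
  law : ∀ (n : ℕ) (i : ℕ → ℕ) (h : ℕ → ℝ≥0),
    P {ω | (∀ k ≤ n, jumpChain (fun t => Z t ω) k = i k) ∧
        ∀ k < n, (h k : ℝ≥0∞) < holdTime (fun t => Z t ω) k} =
      μ₀ {i 0} * ∏ k ∈ Finset.range n,
        ((jumpProb b d (i k) (i (k + 1)) : ℝ≥0∞) *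
          ENNReal.ofReal (Real.exp (-((b (i k) + d (i k) : ℝ≥0) * h k : ℝ))))

/-- The number of individuals alive in a critical binary branching process: from `j`, transitions
to `j + 1` at rate `j` and to `j - 1` at rate `j`. -/
def IsCriticalBirthDeath {Ω : Type*} [MeasurableSpace Ω] (μ₀ : Measure ℕ)
    (Z : ℝ≥0 → Ω → ℕ) (P : Measure Ω) : Prop :=
  IsBirthDeathProcess (fun j => (j : ℝ≥0)) (fun j => (j : ℝ≥0)) μ₀ Z P

/-- The standard Poisson process: it starts at `0`, jumps by `+1`, and its holding times are
independent standard exponential variables. -/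
def IsStandardPoisson {Ω : Type*} [MeasurableSpace Ω] (N : ℝ≥0 → Ω → ℕ) (P : Measure Ω) : Prop :=
  IsBirthDeathProcess (fun _ => 1) (fun _ => 0) (Measure.dirac 0) N P

/-- The Bernoulli(1/2) law on `{0, 1} ⊆ ℕ`. -/
def bernoulliHalf : Measure ℕ := bernoulliMeasure 1 0 ⟨1 / 2, by norm_num, by norm_num⟩

/-! ### Births, deaths and marks -/

/-- `N_marks(t) = N (∫₀ᵗ Z(v/2) dv)`, as a functional of the paths `z` of `Z` and `p` of `N`. -/
def marks (z p : ℝ≥0 → ℕ) (t : ℝ≥0) : ℕ :=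
  p (∫ v in (0 : ℝ)..t, (z (v.toNNReal / 2) : ℝ)).toNNReal

/-- The times `t > 0` of a birth or a death in `Z(t/2)`, or of a mark. -/
def eventTimes (z p : ℝ≥0 → ℕ) : Set ℝ≥0 :=
  {t | 0 < t ∧
    ((z (t / 2) : ℤ) - Function.leftLim (fun s => (z s : ℤ)) (t / 2) = 1 ∨
     (z (t / 2) : ℤ) - Function.leftLim (fun s => (z s : ℤ)) (t / 2) = -1 ∨
     (marks z p t : ℤ) - Function.leftLim (fun s => (marks z p s : ℤ)) t = 1)}

/-- The `k`-th smallest point of a locally finite subset of `(0, ∞)`, that is, the least `t` such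
that the set has at least `k` points in `[0, t]`; it is `0` for `k = 0`, and `∞` if the set has
fewer than `k` points. -/
def kthTime (T : Set ℝ≥0) (k : ℕ) : ℝ≥0∞ :=
  sInf ((fun t : ℝ≥0 => (t : ℝ≥0∞)) '' {t : ℝ≥0 | (k : ℕ∞) ≤ (T ∩ Iic t).encard})

end LaplaceWalk

end

noncomputable section

namespace LaplaceWalk

open Filter Topology Real

/-! ### The Laplace kernel and its integral equation -/

/-! Both configurations are compared through generating functionals, the expectation of the product
of g over the points, for step functions g with values in [0, c], c < 1.

For the walk started from x and stopped below 0, let w(x) be the expectation of g(S_1)⋯g(S_ν). One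
step gives w(x) = e^{-x}/2 + ∫_0^∞ (e^{-|x-y|}/2) g(y) w(y) dy. Splitting the kernel at y = x writes
w = A + B with A' = -A + gw/2 and B' = B - gw/2. Hence φ = B/A solves the Riccati equation φ' = 2φ -
g(1+φ)²/2, and A(0) = 1/2 gives w(0) = 1/2 + φ(0)/2 (`exists_isRiccatiSolution`).

On the time scale of Z(t/2) an individual is marked at rate 1 and splits or dies at rate 1/2 each.
The functional φ(t) of the events after t of one individual therefore satisfies φ' = 2φ - g(φ + φ²/2
+ 1/2), which is the same equation, and the Bernoulli(1/2) start again gives 1/2 + φ(0)/2.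

Neither equation needs a uniqueness theorem: a bounded solution is turned into a process with
constant expectation, whose limit is the functional sought. For the walk this is
`integral_walkProd`, where c < 1 disposes of ν = ∞. For the branching process it is
`IsChainLaw.lintegral_birthDeath`: given Z, the marks are integrated out by
`IsChainLaw.lintegral_poisson` after a change of clock, and extinction removes the terminal factor
φ^Z. Extinction itself comes from the constant functions g = z as z ↑ 1.

The functions g = `lev l` turn the functionals into expectations of monomials in 2^{-(C(∞)+C(o))},
with C(o) the number of points up to level o. These monomials span an algebra that separates the
points, so they determine the joint law of the counts at rational levels (`map_eq_of_integral_eq`),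
and the total number and the ordered points are functions of those counts.

For g = z the equation has the solution w(x) = e^{-kx}/(1+k) with k = √(1-z). Thus w(0) = 1/(1+k) =
(1-k)/z, and z ↑ 1 shows that ν is finite almost surely. -/

lemma measurable_laplaceDensity :
    Measurable fun x : ℝ => ENNReal.ofReal (Real.exp (-|x|) / 2) := by fun_prop

lemma integrable_exp_neg_abs : Integrable fun x : ℝ => Real.exp (-|x|) := by
  have h := integrableOn_exp_neg_Ioi 0
  refine integrable_of_intervalIntegral_norm_bounded (ι := ℕ) 2 (a := fun n => -(n : ℝ))
    (b := fun n => (n : ℝ)) (l := atTop) (fun n => ?_) ?_ tendsto_natCast_atTop_atTop ?_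
  · exact (Continuous.integrableOn_Icc (by fun_prop)).mono_set Ioc_subset_Icc_self
  · exact tendsto_neg_atTop_atBot.comp tendsto_natCast_atTop_atTop
  · refine Eventually.of_forall fun n => ?_
    have hn : (0 : ℝ) ≤ n := n.cast_nonneg
    have e2 : ∫ x in (0:ℝ)..n, ‖Real.exp (-|x|)‖ = 1 - Real.exp (-n) := by
      rw [intervalIntegral.integral_congr (g := fun x => Real.exp (-x))]
      · have := intervalIntegral.integral_comp_neg (a := 0) (b := (n:ℝ)) Real.exp
        rw [this]; simp
      · intro x hx
        rw [uIcc_of_le hn] at hx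
        simp [abs_of_nonneg hx.1]
    have e1 : ∫ x in (-(n:ℝ))..0, ‖Real.exp (-|x|)‖ = 1 - Real.exp (-n) := by
      have := intervalIntegral.integral_comp_neg (a := 0) (b := (n:ℝ))
        (fun x => ‖Real.exp (-|x|)‖)
      simp only [abs_neg, neg_zero] at this
      rw [← this, e2]
    rw [← intervalIntegral.integral_add_adjacent_intervals (b := 0), e1, e2]
    · linarith [Real.exp_pos (-(n:ℝ))]
    · exact Continuous.intervalIntegrable (by fun_prop) _ _
    · exact Continuous.intervalIntegrable (by fun_prop) _ _

lemma integral_exp_neg_abs : ∫ x : ℝ, Real.exp (-|x|) = 2 := by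
  rw [integral_comp_abs (f := fun x => Real.exp (-x)), integral_exp_neg_Ioi_zero, mul_one]

lemma lintegral_laplaceDensity (x : ℝ) :
    ∫⁻ y, ENNReal.ofReal (Real.exp (-|x - y|) / 2) = 1 := by
  rw [lintegral_sub_left_eq_self (fun y => ENNReal.ofReal (Real.exp (-|y|) / 2)) x,
    ← ofReal_integral_eq_lintegral_ofReal (integrable_exp_neg_abs.div_const 2)
      (Eventually.of_forall fun x => by positivity), integral_div, integral_exp_neg_abs]
  simp

/-- One step of the walk from `x`, killed below `0` and weighted by `g` at the new position. -/
def killedStep (g : ℝ → ℝ) (f : ℝ → ℝ≥0∞) (x : ℝ) : ℝ≥0∞ :=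
  ∫⁻ y in Ioi 0, ENNReal.ofReal (Real.exp (-|x - y|) / 2) * ENNReal.ofReal (g y) * f y

lemma measurable_killedStep {g : ℝ → ℝ} (hg : Measurable g) {f : ℝ → ℝ≥0∞} (hf : Measurable f) :
    Measurable (killedStep g f) := by
  unfold killedStep
  refine Measurable.lintegral_prod_right' (f := fun p : ℝ × ℝ =>
    ENNReal.ofReal (Real.exp (-|p.1 - p.2|) / 2) * ENNReal.ofReal (g p.2) * f p.2) ?_
  fun_prop

lemma killedStep_le {g : ℝ → ℝ} {c : ℝ} (hgc : ∀ x, g x ≤ c)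
    {f : ℝ → ℝ≥0∞} {K : ℝ≥0∞} (hf : ∀ x, f x ≤ K) (x : ℝ) :
    killedStep g f x ≤ ENNReal.ofReal c * K := by
  unfold killedStep
  calc _ ≤ ∫⁻ y in Ioi 0, ENNReal.ofReal (Real.exp (-|x - y|) / 2) * (ENNReal.ofReal c * K) := by
        refine lintegral_mono fun y => ?_
        rw [mul_assoc]
        gcongr
        exacts [hgc y, hf y]
    _ ≤ ∫⁻ y, ENNReal.ofReal (Real.exp (-|x - y|) / 2) * (ENNReal.ofReal c * K) :=
        setLIntegral_le_lintegral _ _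
    _ = _ := by
        rw [lintegral_mul_const _ (by fun_prop), lintegral_laplaceDensity, one_mul]

/-- The integral equation satisfied by the generating functional of the walk as a function of its
starting point. -/
def IsWalkSolution (g w : ℝ → ℝ) : Prop :=
  ∀ x, 0 ≤ x → w x = Real.exp (-x) / 2 + ∫ y in Ioi 0, Real.exp (-|x - y|) / 2 * (g y * w y)

/-- Neumann series of the killed kernel: the Laplace density has mass 1 and g ≤ c, so the n-th term
is at most c^n. In `ℝ≥0∞` the sum and the integral commute freely, and the geometric bound gives
finiteness. -/
lemma exists_isWalkSolution {g : ℝ → ℝ} (hg : Measurable g) (hg0 : ∀ x, 0 ≤ g x) {c : ℝ}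
    (hc : c < 1) (hgc : ∀ x, g x ≤ c) :
    ∃ w : ℝ → ℝ, Measurable w ∧ (∀ x, 0 ≤ w x) ∧ (∃ M, ∀ x, w x ≤ M) ∧ IsWalkSolution g w := by
  have hc0 : 0 ≤ c := (hg0 0).trans (hgc 0)
  -- The absolute value keeps this term bounded on all of ℝ; the equation is only required for x ≥
  -- 0.
  let h0 : ℝ → ℝ≥0∞ := fun x => ENNReal.ofReal (Real.exp (-|x|) / 2)
  let u : ℕ → ℝ → ℝ≥0∞ := fun n => (killedStep g)^[n] h0
  have hu_meas : ∀ n, Measurable (u n) := by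
    intro n
    induction n with
    | zero => exact measurable_laplaceDensity
    | succ n ih =>
      simp only [u, Function.iterate_succ', Function.comp]
      exact measurable_killedStep hg ih
  have hu_le : ∀ n x, u n x ≤ ENNReal.ofReal c ^ n := by
    intro n
    induction n with
    | zero =>
      intro x
      simp only [u, Function.iterate_zero, id, pow_zero, h0]
      rw [ENNReal.ofReal_le_one]
      have : Real.exp (-|x|) ≤ 1 := Real.exp_le_one_iff.2 (by simp)
      linarith
    | succ n ih =>
      intro x
      simp only [u, Function.iterate_succ', Function.comp]
      rw [pow_succ']
      exact killedStep_le hgc ih x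
  let W : ℝ → ℝ≥0∞ := fun x => ∑' n, u n x
  have hW_meas : Measurable W := Measurable.tsum hu_meas
  have hW_le : ∀ x, W x ≤ (1 - ENNReal.ofReal c)⁻¹ := fun x => by
    rw [← ENNReal.tsum_geometric]
    exact ENNReal.tsum_le_tsum fun n => hu_le n x
  have hK : (1 - ENNReal.ofReal c)⁻¹ ≠ ∞ := by
    simp [tsub_eq_zero_iff_le, hc]
  have hW_fin : ∀ x, W x ≠ ∞ := fun x => ne_top_of_le_ne_top hK (hW_le x)
  have hW_eq : ∀ x, W x = h0 x + killedStep g W x := by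
    intro x
    have : killedStep g W x = ∑' n, u (n + 1) x := by
      simp only [killedStep, W, ← ENNReal.tsum_mul_left]
      rw [lintegral_tsum fun n => by have := hu_meas n; fun_prop]
      refine tsum_congr fun n => ?_
      simp only [u, Function.iterate_succ', Function.comp]
      rfl
    rw [this]
    exact tsum_eq_zero_add' ENNReal.summable
  refine ⟨fun x => (W x).toReal, hW_meas.ennreal_toReal, fun x => ENNReal.toReal_nonneg,
    ⟨_, fun x => ENNReal.toReal_mono hK (hW_le x)⟩, fun x hx => ?_⟩
  have hks : killedStep g W x ≠ ∞ := by
    refine ne_top_of_le_ne_top (hW_fin x) ?_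
    rw [hW_eq x]; exact le_add_self
  simp only []
  rw [hW_eq x, ENNReal.toReal_add ENNReal.ofReal_ne_top hks,
    ENNReal.toReal_ofReal (by positivity), abs_of_nonneg hx]
  congr 1
  rw [integral_eq_lintegral_of_nonneg_ae]
  · congr 1
    refine lintegral_congr fun y => ?_
    rw [ENNReal.ofReal_mul (by positivity), ENNReal.ofReal_mul (hg0 y),
      ENNReal.ofReal_toReal (hW_fin y), mul_assoc]
  · exact Eventually.of_forall fun y =>
      mul_nonneg (by positivity) (mul_nonneg (hg0 y) ENNReal.toReal_nonneg)
  · exact Measurable.aestronglyMeasurable (by fun_prop)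

/-! ### The Riccati equation -/

/-- The Riccati equation for the generating functional of the events after time `t` of one
individual alive at time `t`. -/
structure IsRiccatiSolution (g φ : ℝ → ℝ) : Prop where
  continuous : Continuous φ
  nonneg : ∀ x, 0 ≤ x → 0 ≤ φ x
  le_one : ∀ x, 0 ≤ x → φ x ≤ 1
  hasDerivAt : ∀ x, 0 < x → ContinuousAt g x →
    HasDerivAt φ (2 * φ x - g x * (1 + φ x) ^ 2 / 2) x

/-- With f = g w, A collects the boundary term and the part y ≤ x of the kernel, B the part y > x.
They solve a linear system wherever g is continuous, and their ratio solves the Riccati equation.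
The boundedness of w yields φ ≤ 1. -/
lemma exists_isRiccatiSolution {g w : ℝ → ℝ} (hg : Measurable g) (hg0 : ∀ x, 0 ≤ g x)
    (hg1 : ∀ x, g x ≤ 1) (hcount : {x | ¬ ContinuousAt g x}.Countable)
    (hw : Measurable w) (hw0 : ∀ x, 0 ≤ w x) {M : ℝ} (hM : ∀ x, w x ≤ M)
    (hsol : IsWalkSolution g w) :
    ∃ φ, IsRiccatiSolution g φ ∧ w 0 = 1 / 2 + φ 0 / 2 := by
  have hM0 : 0 ≤ M := (hw0 0).trans (hM 0)
  let f : ℝ → ℝ := fun y => g y * w y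
  have hf : Measurable f := hg.mul hw
  have hf0 : ∀ y, 0 ≤ f y := fun y => mul_nonneg (hg0 y) (hw0 y)
  have hfM : ∀ y, f y ≤ M := fun y => by
    calc g y * w y ≤ 1 * M := mul_le_mul (hg1 y) (hM y) (hw0 y) zero_le_one
      _ = M := one_mul M
  have hI : ∀ (k : ℝ → ℝ), Continuous k → ∀ a b, IntervalIntegrable (fun y => k y * f y) volume a b := by
    intro k hk a b
    have h1 : IntervalIntegrable (fun y => k y * M) volume a b :=
      (hk.mul continuous_const).intervalIntegrable _ _
    refine h1.mono_fun ?_ (Eventually.of_forall fun y => ?_)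
    · exact (hk.measurable.mul hf).aestronglyMeasurable
    · simp only [norm_mul, Real.norm_eq_abs, abs_of_nonneg (hf0 y), abs_of_nonneg hM0]
      gcongr
      exact hfM y
  have hint : ∀ a, IntegrableOn (fun y => Real.exp (-y) * f y) (Ioi a) := by
    intro a
    refine Integrable.mono' ((integrableOn_exp_neg_Ioi a).mul_const M) ?_
      (Eventually.of_forall fun y => ?_)
    · exact Measurable.aestronglyMeasurable (by fun_prop)
    · rw [norm_mul, Real.norm_eq_abs, Real.norm_eq_abs, abs_of_nonneg (hf0 y), Real.abs_exp]
      gcongr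
      exact hfM y
  let a : ℝ → ℝ := fun x => ∫ y in (0:ℝ)..x, Real.exp y * f y
  let b : ℝ → ℝ := fun x => ∫ y in (0:ℝ)..x, Real.exp (-y) * f y
  let I : ℝ := ∫ y in Ioi 0, Real.exp (-y) * f y
  let A : ℝ → ℝ := fun x => Real.exp (-x) * (1 / 2 + a x / 2)
  let B : ℝ → ℝ := fun x => Real.exp x * ((I - b x) / 2)
  have ha_cont : Continuous a :=
    intervalIntegral.continuous_primitive (hI _ Real.continuous_exp) 0
  have hb_cont : Continuous b :=
    intervalIntegral.continuous_primitive (hI _ (by fun_prop)) 0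
  have hA_cont : Continuous A := by fun_prop
  have hB_cont : Continuous B := by fun_prop
  -- The primitive b from 0 is convenient for derivatives, the tail integral for the sign of B.
  have hIb : ∀ x, 0 ≤ x → I - b x = ∫ y in Ioi x, Real.exp (-y) * f y := by
    intro x hx
    have h : I = b x + ∫ y in Ioi x, Real.exp (-y) * f y := by
      simp only [I, b]
      rw [intervalIntegral.integral_of_le hx, ← setIntegral_union _ measurableSet_Ioi
        ((hint 0).mono_set Ioc_subset_Ioi_self) (hint x), Ioc_union_Ioi_eq_Ioi hx]
      exact Set.disjoint_left.2 fun y hy hy' => not_lt.2 hy.2 hy'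
    linarith
  have hwAB : ∀ x, 0 ≤ x → w x = A x + B x := by
    intro x hx
    have hint1 : IntegrableOn (fun y => Real.exp (-|x - y|) / 2 * (g y * w y)) (Ioc 0 x) := by
      rw [← intervalIntegrable_iff_integrableOn_Ioc_of_le hx]
      exact hI (fun y => Real.exp (-|x - y|) / 2) (by fun_prop) 0 x
    have e2 : ∀ y ∈ Ioi x, Real.exp (-|x - y|) / 2 * (g y * w y)
        = Real.exp x / 2 * (Real.exp (-y) * f y) := by
      intro y hy
      have hy' : x < y := hy
      rw [abs_of_neg (by linarith), show -(-(x - y)) = x + -y by ring, Real.exp_add]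
      simp only [f]; ring
    have e1 : ∀ y ∈ Ioc 0 x, Real.exp (-|x - y|) / 2 * (g y * w y)
        = Real.exp (-x) / 2 * (Real.exp y * f y) := by
      intro y hy
      rw [abs_of_nonneg (by linarith [hy.2]), show -(x - y) = -x + y by ring, Real.exp_add]
      simp only [f]; ring
    have hint2 : IntegrableOn (fun y => Real.exp (-|x - y|) / 2 * (g y * w y)) (Ioi x) :=
      IntegrableOn.congr_fun ((hint x).const_mul (Real.exp x / 2)) (fun y hy => (e2 y hy).symm)
        measurableSet_Ioi
    rw [hsol x hx, ← Ioc_union_Ioi_eq_Ioi hx, setIntegral_union _ measurableSet_Ioi hint1 hint2,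
      setIntegral_congr_fun measurableSet_Ioc e1, setIntegral_congr_fun measurableSet_Ioi e2,
      integral_const_mul, integral_const_mul, ← hIb x hx, ← intervalIntegral.integral_of_le hx]
    · simp only [A, B, a]; ring
    · exact Set.disjoint_left.2 fun y hy hy' => not_lt.2 hy.2 hy'
  have hB0 : ∀ x, 0 ≤ x → 0 ≤ B x := by
    intro x hx
    simp only [B]
    rw [hIb x hx]
    have : 0 ≤ ∫ y in Ioi x, Real.exp (-y) * f y :=
      integral_nonneg fun y => mul_nonneg (Real.exp_pos _).le (hf0 y)
    positivity
  have hA0 : ∀ x, 0 ≤ x → 0 < A x := by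
    intro x hx
    have : 0 ≤ a x := intervalIntegral.integral_nonneg hx fun y _ =>
      mul_nonneg (Real.exp_pos _).le (hf0 y)
    simp only [A]
    positivity
  have hw_cont : ∀ x, 0 < x → ContinuousAt w x := by
    intro x hx
    refine ((hA_cont.add hB_cont).continuousAt (x := x)).congr ?_
    filter_upwards [Ioi_mem_nhds hx] with y hy
    exact (hwAB y (le_of_lt hy)).symm
  have hmeas : ∀ (k : ℝ → ℝ), Continuous k → ∀ x : ℝ,
      StronglyMeasurableAtFilter (fun y => k y * f y) (𝓝 x) := fun k hk x =>
    (hk.measurable.mul hf).stronglyMeasurable.stronglyMeasurableAtFilter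
  have hA_deriv : ∀ x, 0 < x → ContinuousAt g x → HasDerivAt A (-A x + f x / 2) x := by
    intro x hx hgx
    have h1 : HasDerivAt a (Real.exp x * f x) x :=
      intervalIntegral.integral_hasDerivAt_right (hI _ Real.continuous_exp 0 x)
        (hmeas _ Real.continuous_exp x) (Real.continuous_exp.continuousAt.mul
          (hgx.mul (hw_cont x hx)))
    have h2 := ((hasDerivAt_id x).neg.exp).mul ((h1.div_const 2).const_add (1 / 2))
    refine h2.congr_deriv ?_
    have : Real.exp (-x) * Real.exp x = 1 := by rw [← Real.exp_add]; simp
    simp only [A, id, Pi.neg_apply]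
    linear_combination f x / 2 * this
  have hB_deriv : ∀ x, 0 < x → ContinuousAt g x → HasDerivAt B (B x - f x / 2) x := by
    intro x hx hgx
    have h1 : HasDerivAt b (Real.exp (-x) * f x) x :=
      intervalIntegral.integral_hasDerivAt_right (hI _ (by fun_prop) 0 x)
        (hmeas _ (by fun_prop) x) ((by fun_prop : Continuous fun x : ℝ => Real.exp (-x)).continuousAt.mul
          (hgx.mul (hw_cont x hx)))
    have h2 := (Real.hasDerivAt_exp x).mul ((h1.const_sub I).div_const 2)
    refine h2.congr_deriv ?_
    have : Real.exp (-x) * Real.exp x = 1 := by rw [← Real.exp_add]; simp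
    simp only [B]
    linear_combination (-f x / 2) * this
  -- If B > A at x0, then (A - B)' = -w + f ≤ 0 keeps B - A ≥ δ to the right of x0. Since w' = B -
  -- A, w then grows linearly and exceeds its bound M.
  have hBA : ∀ x, 0 ≤ x → B x ≤ A x := by
    intro x0 hx0
    by_contra! hlt
    have hanti : ∀ x, x0 ≤ x → A x - B x ≤ A x0 - B x0 := by
      intro x hx
      have h := integral_eq_of_hasDerivAt_off_countable_of_le (fun y => A y - B y)
        (fun y => (-A y + f y / 2) - (B y - f y / 2)) hx hcount
        (hA_cont.sub hB_cont).continuousOn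
        (fun y hy => (hA_deriv y (hx0.trans_lt hy.1.1) (not_not.1 hy.2)).sub
          (hB_deriv y (hx0.trans_lt hy.1.1) (not_not.1 hy.2)))
        (by
          have h1 := hI (fun _ => 1) continuous_const x0 x
          simp only [one_mul] at h1
          exact (((hA_cont.neg).intervalIntegrable _ _).add (h1.div_const 2)).sub
            ((hB_cont.intervalIntegrable _ _).sub (h1.div_const 2)))
      have h2 : ∫ y in x0..x, ((-A y + f y / 2) - (B y - f y / 2)) ≤ 0 := by
        rw [← neg_nonneg, ← intervalIntegral.integral_neg]
        refine intervalIntegral.integral_nonneg hx fun y hy => ?_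
        have hy0 : 0 ≤ y := hx0.trans hy.1
        have := hwAB y hy0
        have h3 : f y ≤ w y := by
          calc g y * w y ≤ 1 * w y := mul_le_mul_of_nonneg_right (hg1 y) (hw0 y)
            _ = w y := one_mul _
        linarith
      linarith
    set δ := B x0 - A x0 with hδ
    have hδ0 : 0 < δ := by linarith
    have hgrow : ∀ x, x0 ≤ x → δ * (x - x0) ≤ w x - w x0 := by
      intro x hx
      have h := integral_eq_of_hasDerivAt_off_countable_of_le (fun y => A y + B y)
        (fun y => B y - A y) hx hcount (hA_cont.add hB_cont).continuousOn
        (fun y hy => ((hA_deriv y (hx0.trans_lt hy.1.1) (not_not.1 hy.2)).add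
          (hB_deriv y (hx0.trans_lt hy.1.1) (not_not.1 hy.2))).congr_deriv (by ring))
        ((hB_cont.sub hA_cont).intervalIntegrable _ _)
      have h2 : ∫ y in x0..x, δ ≤ ∫ y in x0..x, (B y - A y) := by
        refine intervalIntegral.integral_mono_on hx (by simp)
          ((hB_cont.sub hA_cont).intervalIntegrable _ _) fun y hy => ?_
        linarith [hanti y hy.1]
      rw [intervalIntegral.integral_const, smul_eq_mul, h, ← hwAB x (hx0.trans hx),
        ← hwAB x0 hx0] at h2
      linarith
    -- Over this distance w would grow by M + 1, although it stays in [0, M].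
    have := hgrow (x0 + (M + 1) / δ) (by have : 0 ≤ (M + 1) / δ := by positivity
                                         linarith)
    rw [add_sub_cancel_left, mul_div_cancel₀ _ hδ0.ne'] at this
    linarith [hM (x0 + (M + 1) / δ), hw0 x0]
  -- Freezing the ratio at its value at 0 makes it continuous on all of ℝ, since A > 0 is only known
  -- on [0, ∞).
  refine ⟨fun x => B (max x 0) / A (max x 0), ⟨?_, ?_, ?_, ?_⟩, ?_⟩
  · exact (hB_cont.comp (by fun_prop)).div (hA_cont.comp (by fun_prop))
      fun x => (hA0 _ (le_max_right _ _)).ne'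
  · exact fun x _ => div_nonneg (hB0 _ (le_max_right _ _)) (hA0 _ (le_max_right _ _)).le
  · exact fun x _ => (div_le_one (hA0 _ (le_max_right _ _))).2 (hBA _ (le_max_right _ _))
  · intro x hx hgx
    have hA := (hA0 x hx.le).ne'
    have hd : HasDerivAt (fun x => B x / A x)
        (2 * (B x / A x) - g x * (1 + B x / A x) ^ 2 / 2) x := by
      refine ((hB_deriv x hx hgx).div (hA_deriv x hx hgx) hA).congr_deriv ?_
      have hfx : f x = g x * (A x + B x) := by rw [← hwAB x hx.le]
      rw [hfx]
      field_simp
      ring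
    simp only [max_eq_left hx.le]
    refine hd.congr_of_eventuallyEq ?_
    filter_upwards [Ioi_mem_nhds hx] with y hy
    rw [max_eq_left (le_of_lt (show 0 < y from hy))]
  · rw [hwAB 0 le_rfl]
    have : A 0 = 1 / 2 := by simp [A, a]
    simp only [max_self, this]; ring

/-! ### The walk up to its first descending ladder time -/

instance isProbabilityMeasure_laplaceMeasure : IsProbabilityMeasure laplaceMeasure := by
  refine ⟨?_⟩
  have := lintegral_laplaceDensity 0
  simp only [zero_sub, abs_neg] at this
  rw [laplaceMeasure, withDensity_apply _ MeasurableSet.univ, Measure.restrict_univ, this]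

lemma integral_laplaceMeasure (f : ℝ → ℝ) :
    ∫ y, f y ∂laplaceMeasure = ∫ y, Real.exp (-|y|) / 2 * f y := by
  rw [laplaceMeasure, integral_withDensity_eq_integral_toReal_smul (by fun_prop)
    (Eventually.of_forall fun _ => ENNReal.ofReal_lt_top)]
  refine integral_congr_ae (Eventually.of_forall fun y => ?_)
  simp only [smul_eq_mul]
  rw [ENNReal.toReal_ofReal (by positivity)]

/-- The value after a step of the walk to `y`: the walk stops below `0`. -/
def stepValue (g w : ℝ → ℝ) (y : ℝ) : ℝ := if 0 ≤ y then g y * w y else 1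

lemma measurable_stepValue {g w : ℝ → ℝ} (hg : Measurable g) (hw : Measurable w) :
    Measurable (stepValue g w) :=
  Measurable.ite measurableSet_Ici (hg.mul hw) measurable_const

lemma abs_stepValue_le {g w : ℝ → ℝ} (hg : ∀ x, |g x| ≤ 1) {M : ℝ} (hM : ∀ x, |w x| ≤ M) (y : ℝ) :
    |stepValue g w y| ≤ max 1 M := by
  unfold stepValue
  split_ifs
  · rw [abs_mul]
    calc |g y| * |w y| ≤ 1 * M := mul_le_mul (hg y) (hM y) (abs_nonneg _) zero_le_one
      _ ≤ _ := by simp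
  · simp

/-- The step falls below 0 with probability e^{-x}/2, which is the inhomogeneous term of the
integral equation; the rest of the step is its integral term. -/
lemma integral_stepValue {g w : ℝ → ℝ} (hg : Measurable g) (hg1 : ∀ x, |g x| ≤ 1)
    (hw : Measurable w) {M : ℝ} (hM : ∀ x, |w x| ≤ M) (hsol : IsWalkSolution g w)
    {x : ℝ} (hx : 0 ≤ x) : ∫ y, stepValue g w (x + y) ∂laplaceMeasure = w x := by
  have hsm := measurable_stepValue hg hw
  rw [integral_laplaceMeasure]
  have hsub := integral_sub_left_eq_self
    (fun y => Real.exp (-|y|) / 2 * stepValue g w (x + -y)) volume x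
  have hneg := integral_neg_eq_self (fun y => Real.exp (-|y|) / 2 * stepValue g w (x + y)) volume
  simp only [abs_neg] at hneg
  rw [← hneg, ← hsub]
  have hint : Integrable fun u => Real.exp (-|x - u|) / 2 * stepValue g w u := by
    have h1 : Integrable fun u => Real.exp (-|x - u|) / 2 * max 1 M :=
      ((integrable_exp_neg_abs.comp_sub_left x).div_const 2).mul_const _
    refine h1.mono' (Measurable.aestronglyMeasurable (by fun_prop)) (Eventually.of_forall fun u => ?_)
    rw [norm_mul, Real.norm_of_nonneg (by positivity)]
    gcongr
    exact abs_stepValue_le hg1 hM u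
  simp only [show ∀ u, x + -(x - u) = u from fun u => by ring]
  rw [← integral_add_compl (measurableSet_Iic (a := (0:ℝ))) hint, compl_Iic, hsol x hx]
  congr 1
  · rw [integral_Iic_eq_integral_Iio]
    have e : ∀ u ∈ Iio (0:ℝ), Real.exp (-|x - u|) / 2 * stepValue g w u
        = Real.exp (-x) / 2 * Real.exp u := by
      intro u hu
      have hu' : u < 0 := hu
      rw [stepValue, if_neg (not_le.2 hu'), abs_of_pos (by linarith), show -(x - u) = -x + u by ring,
        Real.exp_add]
      ring
    rw [setIntegral_congr_fun measurableSet_Iio e, integral_const_mul,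
      ← integral_Iic_eq_integral_Iio, integral_exp_Iic_zero, mul_one]
  · refine setIntegral_congr_fun measurableSet_Ioi fun u hu => ?_
    have hu' : 0 < u := hu
    simp only [stepValue, if_pos hu'.le]

/-- The sequence `s` has no negative value up to the index `n`. -/
def NonnegUpTo (s : ℕ → ℝ) (n : ℕ) : Prop := ∀ i ≤ n, 0 ≤ s i

lemma nonnegUpTo_succ {s : ℕ → ℝ} {n : ℕ} :
    NonnegUpTo s (n + 1) ↔ NonnegUpTo s n ∧ 0 ≤ s (n + 1) := by
  constructor
  · exact fun h => ⟨fun i hi => h i (by omega), h _ le_rfl⟩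
  · rintro ⟨h, h'⟩ i hi
    rcases Nat.le_succ_iff.1 hi with hi | rfl
    exacts [h i hi, h']

/-- Since s_0 = 0, the ladder time is at least 1, and the truncated subtraction in `nu` is a true
one. -/
lemma le_nu_iff {s : ℕ → ℝ} (h0 : s 0 = 0) (n : ℕ) : (n : ℕ∞) ≤ nu s ↔ NonnegUpTo s n := by
  have h : ∀ m : ℕ, (m : ℕ∞) ≤ descLadderTime s ↔ ∀ i, s i < 0 → m ≤ i := by
    intro m
    simp [descLadderTime, le_sInf_iff]
  have h1 : ((1 : ℕ) : ℕ∞) ≤ descLadderTime s := by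
    rw [h]
    intro i hi
    rcases i with - | i
    · simp [h0] at hi
    · omega
  have h2 : (n : ℕ∞) ≤ nu s ↔ ((n + 1 : ℕ) : ℕ∞) ≤ descLadderTime s := by
    rw [nu]
    generalize descLadderTime s = d at h1
    induction d using ENat.recTopCoe with
    | top => exact ⟨fun _ => le_top, fun _ => by rw [ENat.top_sub_one]; exact le_top⟩
    | coe d =>
      rw [← ENat.natCast_one, ← ENat.natCast_sub]
      norm_cast at *
      omega
  rw [h2, h]
  constructor
  · intro hn i hi
    by_contra! hneg
    have := hn i hneg
    omega
  · intro hn i hi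
    by_contra! hlt
    exact absurd (hn i (by omega)) (not_le.2 hi)

open Classical in
/-- The product of `g` over the values `s_1, …, s_{min n ν}`. -/
def walkWeight (g : ℝ → ℝ) (s : ℕ → ℝ) (n : ℕ) : ℝ :=
  ∏ i ∈ Finset.range n, if NonnegUpTo s (i + 1) then g (s (i + 1)) else 1

open Classical in
/-- The value of the stopped walk at time `n`. -/
def walkValue (g w : ℝ → ℝ) (s : ℕ → ℝ) (n : ℕ) : ℝ :=
  walkWeight g s n * if NonnegUpTo s n then w (s n) else 1

lemma walkWeight_congr {g : ℝ → ℝ} {s s' : ℕ → ℝ} {n : ℕ} (h : ∀ i ≤ n, s i = s' i) :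
    walkWeight g s n = walkWeight g s' n := by
  refine Finset.prod_congr rfl fun i hi => ?_
  have hi' : i + 1 ≤ n := Finset.mem_range.1 hi
  have : NonnegUpTo s (i + 1) ↔ NonnegUpTo s' (i + 1) :=
    forall₂_congr fun j hj => by rw [h j (hj.trans hi')]
  rw [h _ hi']
  split_ifs <;> tauto

open Classical in
lemma walkValue_succ (g w : ℝ → ℝ) (s : ℕ → ℝ) (n : ℕ) :
    walkValue g w s (n + 1) =
      walkWeight g s n * if NonnegUpTo s n then stepValue g w (s (n + 1)) else 1 := by
  rw [walkValue, walkWeight, Finset.prod_range_succ, ← walkWeight, mul_assoc]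
  congr 1
  simp only [stepValue, nonnegUpTo_succ]
  split_ifs <;> simp_all

lemma abs_walkWeight_le {g : ℝ → ℝ} (hg : ∀ x, |g x| ≤ 1) (s : ℕ → ℝ) (n : ℕ) :
    |walkWeight g s n| ≤ 1 := by
  rw [walkWeight, Finset.abs_prod]
  refine Finset.prod_le_one (fun i _ => abs_nonneg _) fun i _ => ?_
  split_ifs
  exacts [hg _, by simp]

lemma abs_walkValue_le {g w : ℝ → ℝ} (hg : ∀ x, |g x| ≤ 1) {M : ℝ} (hM : ∀ x, |w x| ≤ M)
    (s : ℕ → ℝ) (n : ℕ) : |walkValue g w s n| ≤ max 1 M := by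
  rw [walkValue, abs_mul]
  calc _ ≤ 1 * max 1 M := by
        refine mul_le_mul (abs_walkWeight_le hg s n) ?_ (abs_nonneg _) zero_le_one
        split_ifs
        · exact (hM _).trans (le_max_right _ _)
        · simp
    _ = _ := one_mul _

lemma measurableSet_nonnegUpTo (n : ℕ) : MeasurableSet {s : ℕ → ℝ | NonnegUpTo s n} := by
  simp only [NonnegUpTo, ofPred_forall]
  exact MeasurableSet.iInter fun i => MeasurableSet.iInter fun _ =>
    measurableSet_le measurable_const (measurable_pi_apply i)

lemma measurable_walkWeight {g : ℝ → ℝ} (hg : Measurable g) (n : ℕ) :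
    Measurable fun s => walkWeight g s n := by
  classical
  unfold walkWeight
  refine Finset.measurable_prod _ fun i _ => ?_
  exact Measurable.ite (measurableSet_nonnegUpTo _) (hg.comp (measurable_pi_apply _))
    measurable_const

lemma measurable_walkValue {g w : ℝ → ℝ} (hg : Measurable g) (hw : Measurable w) (n : ℕ) :
    Measurable fun s => walkValue g w s n := by
  classical
  unfold walkValue
  exact (measurable_walkWeight hg n).mul (Measurable.ite (measurableSet_nonnegUpTo _)
    (hw.comp (measurable_pi_apply _)) measurable_const)

/-- The product of `g` over `s_1, …, s_ν`, and `0` if `ν = ∞`. -/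
def walkProd (g : ℝ → ℝ) (s : ℕ → ℝ) : ℝ :=
  if nu s = ⊤ then 0 else ∏ i ∈ Finset.range (nu s).toNat, g (s (i + 1))

/-- If ν = ∞, the weight is at most c^n and annihilates the bounded factor w. If ν = m, the value is
constant from m + 1 on. -/
lemma tendsto_walkValue {g w : ℝ → ℝ} {c : ℝ} (hc : c < 1) (hg : ∀ x, |g x| ≤ c) {M : ℝ}
    (hM : ∀ x, |w x| ≤ M) {s : ℕ → ℝ} (h0 : s 0 = 0) :
    Tendsto (walkValue g w s) atTop (𝓝 (walkProd g s)) := by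
  classical
  have hc0 : 0 ≤ c := (abs_nonneg _).trans (hg 0)
  by_cases hnu : nu s = ⊤
  · have hal : ∀ n, NonnegUpTo s n := fun n => (le_nu_iff h0 n).1 (by simp [hnu])
    rw [walkProd, if_pos hnu]
    have hlim : Tendsto (fun n => c ^ n * M) atTop (𝓝 0) := by
      simpa using (tendsto_pow_atTop_nhds_zero_of_lt_one hc0 hc).mul_const M
    refine squeeze_zero_norm (fun n => ?_) hlim
    rw [walkValue, if_pos (hal n), norm_mul]
    refine mul_le_mul ?_ (hM _) (norm_nonneg _) (pow_nonneg hc0 n)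
    rw [walkWeight, norm_prod]
    calc _ ≤ ∏ i ∈ Finset.range n, c := by
          refine Finset.prod_le_prod (fun i _ => norm_nonneg _) fun i _ => ?_
          rw [if_pos (hal _)]
          exact hg _
      _ = c ^ n := by simp
  · obtain ⟨m, hm⟩ := ENat.ne_top_iff_exists.1 hnu
    rw [walkProd, if_neg hnu, ← hm, ENat.toNat_natCast]
    have hiff : ∀ n, NonnegUpTo s n ↔ n ≤ m := fun n => by rw [← le_nu_iff h0, ← hm, Nat.cast_le]
    refine tendsto_const_nhds.congr' ?_
    filter_upwards [eventually_gt_atTop m] with n hn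
    rw [walkValue, if_neg (by rw [hiff]; omega), mul_one, walkWeight]
    obtain ⟨k, rfl⟩ := Nat.exists_eq_add_of_le hn.le
    rw [Finset.prod_range_add]
    have h1 : ∏ i ∈ Finset.range m, (if NonnegUpTo s (i + 1) then g (s (i + 1)) else 1)
        = ∏ i ∈ Finset.range m, g (s (i + 1)) := by
      refine Finset.prod_congr rfl fun i hi => ?_
      rw [if_pos ((hiff _).2 (Finset.mem_range.1 hi))]
    have h2 : ∏ i ∈ Finset.range k,
        (if NonnegUpTo s (m + i + 1) then g (s (m + i + 1)) else 1) = 1 := by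
      refine Finset.prod_eq_one fun i _ => ?_
      rw [if_neg (by rw [hiff]; omega)]
    rw [h1, h2, mul_one]

section Walk

variable {Ω : Type*} [MeasurableSpace Ω] {P : Measure Ω} {X : ℕ → Ω → ℝ}

lemma aemeasurable_walk (hX : ∀ i, AEMeasurable (X i) P) :
    AEMeasurable (fun ω n => walk X n ω) P := by
  refine aemeasurable_pi_lambda _ fun n => ?_
  unfold walk
  exact Finset.aemeasurable_fun_sum _ fun i _ => hX i

/-- The martingale property in the mean: the increment `X n` is independent of the first n, and
`integral_stepValue` averages it out. -/
lemma integral_walkValue_succ [IsProbabilityMeasure P] (hlaw : ∀ i, HasLaw (X i) laplaceMeasure P) (hindep : iIndepFun X P)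
    {g w : ℝ → ℝ} (hg : Measurable g) (hg1 : ∀ x, |g x| ≤ 1)
    (hw : Measurable w) {M : ℝ} (hM : ∀ x, |w x| ≤ M) (hsol : IsWalkSolution g w) (n : ℕ) :
    ∫ ω, walkValue g w (fun k => walk X k ω) (n + 1) ∂P =
      ∫ ω, walkValue g w (fun k => walk X k ω) n ∂P := by
  classical
  have hX : ∀ i, AEMeasurable (X i) P := fun i => (hlaw i).aemeasurable
  -- The first n increments, padded by zeros to a full sequence; the partial sums up to n are
  -- unchanged.
  let ρ : Ω → ℕ → ℝ := fun ω k => if k < n then X k ω else 0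
  let S : (ℕ → ℝ) → ℕ → ℝ := fun x k => ∑ i ∈ Finset.range k, x i
  have hS : Measurable S := measurable_pi_lambda _ fun k =>
    Finset.measurable_fun_sum _ fun i _ => measurable_pi_apply i
  have hρ : AEMeasurable ρ P := aemeasurable_pi_lambda _ fun k => by
    by_cases hk : k < n
    · simpa only [ρ, if_pos hk] using hX k
    · simpa only [ρ, if_neg hk] using aemeasurable_const
  have hSρ : ∀ ω, ∀ k ≤ n, S (ρ ω) k = walk X k ω := fun ω k hk =>
    Finset.sum_congr rfl fun i hi => if_pos ((Finset.mem_range.1 hi).trans_le hk)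
  have hind : IndepFun ρ (X n) P := by
    have h := hindep.indepFun_finset₀ (Finset.range n) {n} (by simp) hX
    have h1 : Measurable fun (v : Finset.range n → ℝ) (k : ℕ) =>
        if hk : k ∈ Finset.range n then v ⟨k, hk⟩ else 0 := by
      refine measurable_pi_lambda _ fun k => ?_
      by_cases hk : k ∈ Finset.range n
      · simpa only [dif_pos hk] using measurable_pi_apply _
      · simpa only [dif_neg hk] using measurable_const
    have h2 := h.comp h1 (measurable_pi_apply (⟨n, Finset.mem_singleton_self n⟩ : ({n} : Finset ℕ)))
    convert h2 using 1
    · ext ω k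
      simp [ρ]
    · rfl
  have hmap : P.map (fun ω => (ρ ω, X n ω)) = (P.map ρ).prod laplaceMeasure := by
    rw [← (hlaw n).map_eq]
    exact (indepFun_iff_map_prod_eq_prod_map_map hρ (hX n)).1 hind
  have : IsProbabilityMeasure (P.map ρ) := Measure.isProbabilityMeasure_map hρ
  let G : (ℕ → ℝ) × ℝ → ℝ := fun p =>
    walkWeight g (S p.1) n * if NonnegUpTo (S p.1) n then stepValue g w (S p.1 n + p.2) else 1
  have hG : Measurable G := by
    refine ((measurable_walkWeight hg n).comp (hS.comp measurable_fst)).mul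
      (Measurable.ite ((measurableSet_nonnegUpTo n).preimage (hS.comp measurable_fst)) ?_
        measurable_const)
    refine (measurable_stepValue hg hw).comp (Measurable.add ?_ measurable_snd)
    exact (measurable_pi_apply n).comp (hS.comp measurable_fst)
  have hGb : ∀ p, ‖G p‖ ≤ max 1 M := fun p => by
    simp only [G]
    rw [norm_mul]
    calc _ ≤ 1 * max 1 M := by
          refine mul_le_mul (abs_walkWeight_le hg1 _ n) ?_ (norm_nonneg _) zero_le_one
          split_ifs
          · exact abs_stepValue_le hg1 hM _
          · simp
      _ = _ := one_mul _
  have e1 : ∀ ω, walkValue g w (fun k => walk X k ω) (n + 1) = G (ρ ω, X n ω) := by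
    intro ω
    rw [walkValue_succ]
    have e : NonnegUpTo (fun k => walk X k ω) n ↔ NonnegUpTo (S (ρ ω)) n :=
      forall₂_congr fun j hj => by rw [hSρ ω j hj]
    simp only [G, e, walkWeight_congr (hSρ ω), hSρ ω n le_rfl]
    rw [walk, walk, Finset.sum_range_succ]
  have e2 : ∀ ω, walkValue g w (fun k => walk X k ω) n = walkValue g w (S (ρ ω)) n := by
    intro ω
    have e : NonnegUpTo (fun k => walk X k ω) n ↔ NonnegUpTo (S (ρ ω)) n :=
      forall₂_congr fun j hj => by rw [hSρ ω j hj]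
    simp only [walkValue, e, walkWeight_congr (hSρ ω), hSρ ω n le_rfl]
  simp only [e1, e2]
  rw [← integral_map (f := G) (hρ.prodMk (hX n)) hG.aestronglyMeasurable, hmap,
    integral_prod _ (Integrable.of_bound hG.aestronglyMeasurable _ (Eventually.of_forall hGb)),
    ← integral_map (f := fun x => walkValue g w (S x) n) hρ
      ((measurable_walkValue hg hw n).comp hS).aestronglyMeasurable]
  refine integral_congr_ae (Eventually.of_forall fun x => ?_)
  simp only [G, walkValue]
  rw [integral_const_mul]
  congr 1
  split_ifs with h
  · exact integral_stepValue hg hg1 hw hM hsol (h n le_rfl)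
  · simp

/-- The generating functional of the walk up to its first descending ladder time. -/
theorem integral_walkProd [IsProbabilityMeasure P] (hlaw : ∀ i, HasLaw (X i) laplaceMeasure P) (hindep : iIndepFun X P)
    {g w : ℝ → ℝ} (hg : Measurable g) {c : ℝ} (hc : c < 1) (hgc : ∀ x, |g x| ≤ c)
    (hw : Measurable w) {M : ℝ} (hM : ∀ x, |w x| ≤ M) (hsol : IsWalkSolution g w) :
    ∫ ω, walkProd g (fun k => walk X k ω) ∂P = w 0 := by
  have hg1 : ∀ x, |g x| ≤ 1 := fun x => (hgc x).trans hc.le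
  have hconst : ∀ n, ∫ ω, walkValue g w (fun k => walk X k ω) n ∂P = w 0 := by
    intro n
    induction n with
    | zero => simp [walkValue, walkWeight, NonnegUpTo, walk]
    | succ n ih => rw [integral_walkValue_succ hlaw hindep hg hg1 hw hM hsol, ih]
  have hW := aemeasurable_walk fun i => (hlaw i).aemeasurable
  have hlim := tendsto_integral_of_dominated_convergence (μ := P)
    (F := fun n ω => walkValue g w (fun k => walk X k ω) n)
    (f := fun ω => walkProd g (fun k => walk X k ω)) (fun _ => max 1 M)
    (fun n => ((measurable_walkValue hg hw n).comp_aemeasurable hW).aestronglyMeasurable)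
    (integrable_const _)
    (fun n => Eventually.of_forall fun ω => abs_walkValue_le hg1 hM _ n)
    (Eventually.of_forall fun ω => tendsto_walkValue hc hgc hM (by simp [walk]))
  simp only [hconst] at hlim
  exact tendsto_nhds_unique hlim tendsto_const_nhds

end Walk

/-! ### The law of `ν` -/

lemma integral_exp_neg_mul_Ioi {k : ℝ} (hk : 0 < k) (x : ℝ) :
    ∫ y in Ioi x, Real.exp (-(k * y)) = Real.exp (-(k * x)) / k := by
  have h := integral_exp_mul_Ioi (neg_lt_zero.2 hk) x
  simp only [neg_mul] at h
  rw [h, neg_div_neg_eq]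

lemma integrableOn_exp_neg_mul_Ioi {k : ℝ} (hk : 0 < k) (x : ℝ) :
    IntegrableOn (fun y => Real.exp (-(k * y))) (Ioi x) := by
  have h := integrableOn_exp_mul_Ioi (neg_lt_zero.2 hk) x
  simpa only [neg_mul] using h

/-- For constant g = z the system for A and B gives w'' = (1 - z)w, so a bounded solution is a
multiple of e^{-kx} with k = √(1-z). The condition z ≠ 0 means k ≠ 1, needed to integrate
e^{(1-k)y}; |x| in place of x keeps the solution bounded on ℝ. -/
lemma isWalkSolution_const {z : ℝ} (hz0 : z ≠ 0) (hz1 : z < 1) :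
    IsWalkSolution (fun _ => z)
      (fun x => Real.exp (-(√(1 - z) * |x|)) / (1 + √(1 - z))) := by
  intro x hx
  set k := √(1 - z) with hk
  have hk0 : 0 < k := Real.sqrt_pos.2 (by linarith)
  have hkz : z = 1 - k ^ 2 := by rw [hk, Real.sq_sqrt (by linarith)]; ring
  have hk1 : 1 - k ≠ 0 := by
    intro h
    have : k = 1 := by linarith
    exact hz0 (by rw [hkz, this]; norm_num)
  have e1 : ∀ y ∈ Ioc 0 x, Real.exp (-|x - y|) / 2 * (z * (Real.exp (-(k * |y|)) / (1 + k)))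
      = z / (2 * (1 + k)) * Real.exp (-x) * Real.exp ((1 - k) * y) := by
    intro y hy
    rw [abs_of_nonneg (by linarith [hy.2]), abs_of_pos hy.1,
      show (1 - k) * y = y + -(k * y) by ring, Real.exp_add, show -(x - y) = -x + y by ring,
      Real.exp_add]
    field_simp
  have e2 : ∀ y ∈ Ioi x, Real.exp (-|x - y|) / 2 * (z * (Real.exp (-(k * |y|)) / (1 + k)))
      = z / (2 * (1 + k)) * Real.exp x * Real.exp (-((1 + k) * y)) := by
    intro y hy
    have hy' : x < y := hy
    rw [abs_of_neg (by linarith), abs_of_pos (by linarith),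
      show -((1 + k) * y) = -y + -(k * y) by ring, Real.exp_add, show -(-(x - y)) = x + -y by ring,
      Real.exp_add]
    field_simp
  have i1 : IntegrableOn (fun y => z / (2 * (1 + k)) * Real.exp (-x) * Real.exp ((1 - k) * y))
      (Ioc 0 x) :=
    (Continuous.integrableOn_Icc (by fun_prop)).mono_set Ioc_subset_Icc_self
  have i2 : IntegrableOn (fun y => z / (2 * (1 + k)) * Real.exp x * Real.exp (-((1 + k) * y)))
      (Ioi x) := (integrableOn_exp_neg_mul_Ioi (by linarith) x).const_mul _
  have v1 : ∫ y in Ioc 0 x, Real.exp ((1 - k) * y) = (Real.exp ((1 - k) * x) - 1) / (1 - k) := by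
    rw [← intervalIntegral.integral_of_le hx,
      intervalIntegral.integral_comp_mul_left (fun y => Real.exp y) hk1, integral_exp]
    simp [div_eq_inv_mul]
  beta_reduce
  rw [← Ioc_union_Ioi_eq_Ioi hx, setIntegral_union
      (Ioc_disjoint_Ioi le_rfl) measurableSet_Ioi
      (i1.congr_fun (fun y hy => (e1 y hy).symm) measurableSet_Ioc)
      (i2.congr_fun (fun y hy => (e2 y hy).symm) measurableSet_Ioi),
    setIntegral_congr_fun measurableSet_Ioc e1, setIntegral_congr_fun measurableSet_Ioi e2,
    integral_const_mul, integral_const_mul, v1, integral_exp_neg_mul_Ioi (by linarith),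
    abs_of_nonneg hx, show (1 - k) * x = x + -(k * x) by ring,
    show -((1 + k) * x) = -x + -(k * x) by ring, Real.exp_add, Real.exp_add]
  have hexp : Real.exp (-x) * Real.exp x = 1 := by rw [← Real.exp_add]; simp
  have h1k : 1 + k ≠ 0 := by linarith
  have hE : Real.exp x = (Real.exp (-x))⁻¹ := eq_inv_of_mul_eq_one_right hexp
  rw [hkz, hE]
  have := (Real.exp_pos (-x)).ne'
  field_simp
  ring

lemma measurable_enat_of_le {α : Type*} [MeasurableSpace α] {f : α → ℕ∞}
    (h : ∀ n : ℕ, MeasurableSet {a | (n : ℕ∞) ≤ f a}) : Measurable f := by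
  have hfin : ∀ n : ℕ, MeasurableSet (f ⁻¹' {(n : ℕ∞)}) := by
    intro n
    have : f ⁻¹' {(n : ℕ∞)} = {a | (n : ℕ∞) ≤ f a} \ {a | ((n + 1 : ℕ) : ℕ∞) ≤ f a} := by
      ext a
      simp only [mem_preimage, mem_singleton_iff, Set.mem_sdiff, mem_ofPred_eq, not_le]
      generalize f a = b
      induction b using ENat.recTopCoe with
      | top => simp
      | coe b => norm_cast; omega
    rw [this]
    exact (h n).diff (h (n + 1))
  refine measurable_to_countable' fun b => ?_
  induction b using ENat.recTopCoe with
  | coe n => exact hfin n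
  | top =>
    have : f ⁻¹' {⊤} = (⋃ n : ℕ, f ⁻¹' {(n : ℕ∞)})ᶜ := by
      ext a
      simp only [mem_preimage, mem_singleton_iff, mem_compl_iff, mem_iUnion, not_exists]
      generalize f a = b
      induction b using ENat.recTopCoe with
      | top => simp
      | coe b => simp
    rw [this]
    exact (MeasurableSet.iUnion hfin).compl

lemma measurable_nu : Measurable nu := by
  have hd : Measurable descLadderTime := by
    refine measurable_enat_of_le fun n => ?_
    have : {s : ℕ → ℝ | (n : ℕ∞) ≤ descLadderTime s} = ⋂ i ∈ Iio n, {s | 0 ≤ s i} := by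
      ext s
      simp only [descLadderTime, le_sInf_iff, mem_image, forall_exists_index, mem_ofPred_eq, mem_iInter,
        mem_Iio]
      constructor
      · intro h i hi
        by_contra! hneg
        exact absurd (h _ i ⟨hneg, rfl⟩) (by simpa using hi)
      · rintro h _ i ⟨hi, rfl⟩
        by_contra! hlt
        exact absurd (h i (by simpa using hlt)) (not_le.2 hi)
    rw [this]
    exact MeasurableSet.biInter (to_countable _) fun i _ =>
      measurableSet_le measurable_const (measurable_pi_apply i)
  exact (measurable_of_countable (fun d : ℕ∞ => d - 1)).comp hd

lemma walkProd_const (z : ℝ) (s : ℕ → ℝ) :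
    walkProd (fun _ => z) s = if nu s = ⊤ then 0 else z ^ (nu s).toNat := by
  simp [walkProd]

section Walk

variable {Ω : Type*} [MeasurableSpace Ω] {P : Measure Ω} [IsProbabilityMeasure P] {X : ℕ → Ω → ℝ}

lemma integral_walkProd_const (hlaw : ∀ i, HasLaw (X i) laplaceMeasure P) (hindep : iIndepFun X P)
    {z : ℝ} (hz0 : z ≠ 0) (hz1 : |z| < 1) :
    ∫ ω, walkProd (fun _ => z) (fun k => walk X k ω) ∂P = (1 + √(1 - z))⁻¹ := by
  have h := integral_walkProd hlaw hindep (g := fun _ => z) measurable_const hz1 (fun _ => le_rfl)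
    (Measurable.div_const (by fun_prop) _) (M := 1) (fun x => ?_)
    (isWalkSolution_const hz0 (lt_of_abs_lt hz1))
  · rw [h]; simp
  · have hk := Real.sqrt_nonneg (1 - z)
    rw [abs_of_nonneg (by positivity)]
    refine div_le_one_of_le₀ ?_ (by positivity)
    have : Real.exp (-(√(1 - z) * |x|)) ≤ 1 := Real.exp_le_one_iff.2 (by
      have := mul_nonneg hk (abs_nonneg x); linarith)
    linarith

lemma tendsto_inv_one_add_sqrt :
    Tendsto (fun z : ℝ => (1 + √(1 - z))⁻¹) (𝓝[<] 1) (𝓝 1) := by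
  have : ContinuousAt (fun z : ℝ => (1 + √(1 - z))⁻¹) 1 := by
    refine ContinuousAt.inv₀ (by fun_prop) ?_
    simp
  have h := this.tendsto
  simp only [sub_self, Real.sqrt_zero, add_zero, inv_one] at h
  exact h.mono_left nhdsWithin_le_nhds

/-- The expectation of z^ν on {ν < ∞} is 1/(1+√(1-z)); it is at most P(ν < ∞) and tends to 1 as z ↑
1. -/
lemma ae_nu_ne_top (hlaw : ∀ i, HasLaw (X i) laplaceMeasure P) (hindep : iIndepFun X P) :
    ∀ᵐ ω ∂P, nu (fun n => walk X n ω) ≠ ⊤ := by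
  have hW := aemeasurable_walk fun i => (hlaw i).aemeasurable
  have hnu : AEMeasurable (fun ω => nu (fun n => walk X n ω)) P := measurable_nu.comp_aemeasurable hW
  have hset : NullMeasurableSet {ω | nu (fun n => walk X n ω) ≠ ⊤} P :=
    hnu.nullMeasurable (MeasurableSet.of_discrete (s := {d : ℕ∞ | d ≠ ⊤}))
  have hle : ∀ z : ℝ, 0 < z → z < 1 →
      (1 + √(1 - z))⁻¹ ≤ P.real {ω | nu (fun n => walk X n ω) ≠ ⊤} := by
    intro z hz0 hz1
    rw [← integral_walkProd_const hlaw hindep hz0.ne' (by rwa [abs_of_pos hz0]),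
      show P.real {ω | nu (fun n => walk X n ω) ≠ ⊤} =
        ∫ ω, {ω | nu (fun n => walk X n ω) ≠ ⊤}.indicator (fun _ => (1 : ℝ)) ω ∂P by
          rw [integral_indicator₀ hset]; simp]
    refine integral_mono_of_nonneg (Eventually.of_forall fun ω => ?_)
      ((integrable_const (1:ℝ)).indicator₀ hset) (Eventually.of_forall fun ω => ?_)
    · simp only [walkProd_const]
      split_ifs <;> simp [hz0.le]
    · simp only [walkProd_const, indicator, mem_ofPred_eq]
      by_cases h : nu (fun k => walk X k ω) = ⊤
      · simp [h]
      · simpa [h] using pow_le_one₀ hz0.le hz1.le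
  have h1 : 1 ≤ P.real {ω | nu (fun n => walk X n ω) ≠ ⊤} := by
    refine le_of_tendsto tendsto_inv_one_add_sqrt ?_
    filter_upwards [Ioo_mem_nhdsLT (zero_lt_one (α := ℝ))] with z hz
    exact hle z hz.1 hz.2
  have h2 : P.real {ω | nu (fun n => walk X n ω) ≠ ⊤} = 1 := le_antisymm measureReal_le_one h1
  rw [measureReal_def, ENNReal.toReal_eq_one_iff] at h2
  exact (prob_compl_eq_zero_iff₀ hset).2 h2

theorem integral_pow_nu (hlaw : ∀ i, HasLaw (X i) laplaceMeasure P) (hindep : iIndepFun X P)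
    {z : ℝ} (hz0 : z ≠ 0) (hz1 : |z| ≤ 1) :
    Integrable (fun ω => z ^ (nu (fun n => walk X n ω)).toNat) P ∧
      ∫ ω, z ^ (nu (fun n => walk X n ω)).toNat ∂P = z⁻¹ * (1 - √(1 - z)) := by
  have hW := aemeasurable_walk fun i => (hlaw i).aemeasurable
  have hnu : AEMeasurable (fun ω => nu (fun n => walk X n ω)) P := measurable_nu.comp_aemeasurable hW
  have hmeas : ∀ y : ℝ, AEStronglyMeasurable (fun ω => y ^ (nu (fun n => walk X n ω)).toNat) P :=
    fun y => ((measurable_of_countable fun d : ℕ∞ => y ^ d.toNat).comp_aemeasurable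
      hnu).aestronglyMeasurable
  have hb : ∀ y : ℝ, |y| ≤ 1 → ∀ n : ℕ, ‖y ^ n‖ ≤ 1 := fun y hy n => by
    rw [norm_pow]; exact pow_le_one₀ (norm_nonneg _) hy
  refine ⟨Integrable.of_bound (hmeas z) 1 (Eventually.of_forall fun ω => hb z hz1 _), ?_⟩
  have hfin := ae_nu_ne_top hlaw hindep
  -- The factors r k lie in (0, 1) and tend to 1, which moves z with |z| = 1 into the range where
  -- the formula is known.
  let r : ℕ → ℝ := fun k => 1 - 1 / ((k : ℝ) + 2)
  have hr01 : ∀ k, 0 < r k ∧ r k < 1 := fun k => by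
    have hk : (0:ℝ) ≤ k := k.cast_nonneg
    have h1 : 0 < 1 / ((k : ℝ) + 2) := by positivity
    have h2 : 1 / ((k : ℝ) + 2) < 1 := by rw [div_lt_one (by linarith)]; linarith
    constructor <;> simp only [r] <;> linarith
  have hr : Tendsto r atTop (𝓝 1) := by
    have h : Tendsto (fun k : ℕ => 1 / ((k : ℝ) + 2)) atTop (𝓝 0) :=
      tendsto_const_nhds.div_atTop
        (tendsto_atTop_add_const_right _ _ tendsto_natCast_atTop_atTop)
    simpa only [sub_zero] using h.const_sub 1
  have hzr : Tendsto (fun k => z * r k) atTop (𝓝 z) := by simpa using hr.const_mul z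
  have hzr1 : ∀ k, |z * r k| < 1 := fun k => by
    rw [abs_mul, abs_of_pos (hr01 k).1]
    calc |z| * r k ≤ 1 * r k := mul_le_mul_of_nonneg_right hz1 (hr01 k).1.le
      _ < 1 := by linarith [(hr01 k).2]
  have hval : ∀ k, ∫ ω, (z * r k) ^ (nu (fun n => walk X n ω)).toNat ∂P
      = (1 + √(1 - z * r k))⁻¹ := by
    intro k
    rw [← integral_walkProd_const hlaw hindep (mul_ne_zero hz0 (hr01 k).1.ne') (hzr1 k)]
    refine integral_congr_ae ?_
    filter_upwards [hfin] with ω hω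
    rw [walkProd_const, if_neg hω]
  have hlim := tendsto_integral_of_dominated_convergence (μ := P)
    (F := fun k ω => (z * r k) ^ (nu (fun n => walk X n ω)).toNat)
    (f := fun ω => z ^ (nu (fun n => walk X n ω)).toNat) (fun _ => 1)
    (fun k => hmeas _) (integrable_const _)
    (fun k => Eventually.of_forall fun ω => hb _ (hzr1 k).le _)
    (Eventually.of_forall fun ω => hzr.pow _)
  simp only [hval] at hlim
  have hs0 := Real.sqrt_nonneg (1 - z)
  have hlim2 : Tendsto (fun k => (1 + √(1 - z * r k))⁻¹) atTop (𝓝 (1 + √(1 - z))⁻¹) :=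
    Tendsto.inv₀ ((((hzr.const_sub 1).sqrt)).const_add 1) (by positivity)
  rw [tendsto_nhds_unique hlim hlim2]
  have hsq : √(1 - z) ^ 2 = 1 - z := Real.sq_sqrt (by linarith [(abs_le.1 hz1).2])
  have : 1 + √(1 - z) ≠ 0 := by positivity
  field_simp
  nlinarith

end Walk

/-! ### Right-continuous step paths -/

/-- Right continuity of an integer valued path. -/
def IsRightCont (x : ℝ≥0 → ℕ) : Prop := ∀ t, ContinuousWithinAt x (Ici t) t

lemma IsRightCont.exists_eq {x : ℝ≥0 → ℕ} (hx : IsRightCont x) (t : ℝ≥0) :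
    ∃ u, t < u ∧ ∀ s, t ≤ s → s < u → x s = x t := by
  have h : ∀ᶠ s in 𝓝[≥] t, x s = x t := by
    have := (hx t).eventually (p := fun y => y = x t) (by
      rw [nhds_discrete]; simp)
    exact this
  obtain ⟨u, hu, hsub⟩ := (mem_nhdsGE_iff_exists_Ico_subset' (show t < t + 1 by simp)).1 h
  exact ⟨u, hu, fun s h1 h2 => hsub ⟨h1, h2⟩⟩

lemma jumpTime_succ_le {x : ℝ≥0 → ℕ} {n : ℕ} {t : ℝ≥0} (h : jumpTime x n < t)
    (hne : x t ≠ x (jumpTime x n).toNNReal) : jumpTime x (n + 1) ≤ t :=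
  sInf_le ⟨t, ⟨h, hne⟩, rfl⟩

lemma jumpTime_le_succ (x : ℝ≥0 → ℕ) (n : ℕ) : jumpTime x n ≤ jumpTime x (n + 1) := by
  refine le_sInf ?_
  rintro _ ⟨t, ⟨h, -⟩, rfl⟩
  exact h.le

lemma eq_of_lt_jumpTime_succ {x : ℝ≥0 → ℕ} {n : ℕ} {t : ℝ≥0} (h : jumpTime x n ≤ t)
    (h' : (t : ℝ≥0∞) < jumpTime x (n + 1)) : x t = x (jumpTime x n).toNNReal := by
  rcases h.eq_or_lt with h | h
  · simp [h]
  · by_contra hne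
    exact absurd (jumpTime_succ_le h hne) (not_le.2 h')

lemma jumpTime_lt_succ {x : ℝ≥0 → ℕ} (hx : IsRightCont x) {n : ℕ} (hn : jumpTime x n ≠ ⊤) :
    jumpTime x n < jumpTime x (n + 1) := by
  obtain ⟨u, hu, heq⟩ := hx.exists_eq (jumpTime x n).toNNReal
  have hu' : jumpTime x n < u := by
    rw [← ENNReal.coe_toNNReal hn]; exact_mod_cast hu
  refine hu'.trans_le (le_sInf ?_)
  rintro _ ⟨t, ⟨h, hne⟩, rfl⟩
  by_contra! hlt
  refine hne (heq t ?_ (by exact_mod_cast hlt))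
  rw [← ENNReal.coe_le_coe, ENNReal.coe_toNNReal hn]
  exact h.le

lemma jumpChain_eq {x : ℝ≥0 → ℕ} {n : ℕ} (hn : jumpTime x n ≠ ⊤) :
    jumpChain x n = x (jumpTime x n).toNNReal := by
  cases n with
  | zero => simp [jumpChain, jumpTime]
  | succ n => simp [jumpChain, hn]

lemma path_eq_jumpChain {x : ℝ≥0 → ℕ} {n : ℕ} {t : ℝ≥0} (h : jumpTime x n ≤ t)
    (h' : (t : ℝ≥0∞) < jumpTime x (n + 1)) : x t = jumpChain x n := by
  rw [eq_of_lt_jumpTime_succ h h', jumpChain_eq (ne_top_of_le_ne_top ENNReal.coe_ne_top h)]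

lemma jumpTime_eq_sum_holdTime (x : ℝ≥0 → ℕ) (n : ℕ) :
    jumpTime x n = ∑ k ∈ Finset.range n, holdTime x k := by
  induction n with
  | zero => simp [jumpTime]
  | succ n ih =>
    rw [Finset.sum_range_succ, ← ih, holdTime]
    split_ifs with h
    · rw [add_top]
      exact top_le_iff.1 (h ▸ jumpTime_le_succ x n)
    · rw [add_tsub_cancel_of_le (jumpTime_le_succ x n)]

lemma holdTime_pos {x : ℝ≥0 → ℕ} (hx : IsRightCont x) (n : ℕ) : 0 < holdTime x n := by
  rw [holdTime]
  split_ifs with h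
  · simp
  · exact tsub_pos_of_lt (jumpTime_lt_succ hx h)

/-- The value of a right-continuous path at the random time `t`, as a limit along countably many
fixed times. -/
def evalRight (x : ℝ≥0 → ℕ) (t : ℝ≥0∞) : ℕ :=
  ⌊(limsup (fun m : ℕ => (x ((⌊t.toReal * (m + 1)⌋₊ + 1 : ℕ) / (m + 1)) : ℝ≥0∞)) atTop).toReal⌋₊

lemma measurable_evalRight {α : Type*} [MeasurableSpace α] {f : α → ℝ≥0 → ℕ} (hf : Measurable f)
    {τ : α → ℝ≥0∞} (hτ : Measurable τ) : Measurable fun a => evalRight (f a) (τ a) := by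
  unfold evalRight
  refine Nat.measurable_floor.comp (Measurable.ennreal_toReal (Measurable.limsup fun m => ?_))
  have h1 : Measurable fun p : (ℝ≥0 → ℕ) × ℕ => p.1 ((p.2 + 1 : ℕ) / (m + 1) : ℝ≥0) :=
    measurable_from_prod_countable_left fun k =>
      measurable_pi_apply ((k + 1 : ℕ) / (m + 1) : ℝ≥0)
  have h2 : Measurable fun a => ⌊(τ a).toReal * (m + 1)⌋₊ :=
    Nat.measurable_floor.comp (hτ.ennreal_toReal.mul_const _)
  exact (measurable_of_countable (fun n : ℕ => (n : ℝ≥0∞))).comp (h1.comp (hf.prodMk h2))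

/-- The sampling times (⌊t(m+1)⌋ + 1)/(m+1) lie to the right of t and tend to t, so the sampled
values are eventually constant. -/
lemma evalRight_eq {x : ℝ≥0 → ℕ} (hx : IsRightCont x) (t : ℝ≥0∞) :
    evalRight x t = x t.toNNReal := by
  obtain ⟨u, hu, heq⟩ := hx.exists_eq t.toNNReal
  have h1 : ∀ m : ℕ, t.toNNReal ≤ ((⌊t.toReal * (m + 1)⌋₊ + 1 : ℕ) / (m + 1) : ℝ≥0) := fun m => by
    rw [le_div_iff₀ (by positivity), ← NNReal.coe_le_coe]
    have := (Nat.lt_floor_add_one (t.toReal * (m + 1))).le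
    push_cast
    exact this
  have h2 : ∀ m : ℕ, ((⌊t.toReal * (m + 1)⌋₊ + 1 : ℕ) / (m + 1) : ℝ≥0)
      ≤ t.toNNReal + 1 / ((m : ℝ≥0) + 1) := fun m => by
    rw [div_le_iff₀ (by positivity), add_mul, div_mul_cancel₀ _ (by positivity),
      ← NNReal.coe_le_coe]
    have := Nat.floor_le (a := t.toReal * (m + 1)) (by positivity)
    push_cast
    have e : (t.toNNReal : ℝ) = t.toReal := rfl
    linarith
  have hlim : Tendsto (fun m : ℕ => t.toNNReal + 1 / ((m : ℝ≥0) + 1)) atTop (𝓝 t.toNNReal) := by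
    have := (tendsto_one_div_add_atTop_nhds_zero_nat (𝕜 := ℝ≥0)).const_add t.toNNReal
    simpa using this
  have hev : ∀ᶠ m : ℕ in atTop,
      (x ((⌊t.toReal * (m + 1)⌋₊ + 1 : ℕ) / (m + 1)) : ℝ≥0∞) = x t.toNNReal := by
    filter_upwards [hlim.eventually (gt_mem_nhds hu)] with m hm
    rw [heq _ (h1 m) ((h2 m).trans_lt hm)]
  have : limsup (fun m : ℕ => (x ((⌊t.toReal * (m + 1)⌋₊ + 1 : ℕ) / (m + 1)) : ℝ≥0∞)) atTop
      = x t.toNNReal := by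
    rw [limsup_congr hev, limsup_const]
  rw [evalRight, this]
  simp

/-- The jump times and the jump chain of a right-continuous path, computed from the values at
countably many times. -/
def jumpData (x : ℝ≥0 → ℕ) : ℕ → ℝ≥0∞ × ℕ
  | 0 => (0, x 0)
  | n + 1 =>
    let τ : ℝ≥0∞ := ⨅ q : ℚ≥0, if (jumpData x n).1 < ((q : ℝ≥0) : ℝ≥0∞) ∧ x (q : ℝ≥0) ≠ (jumpData x n).2
      then ((q : ℝ≥0) : ℝ≥0∞) else ⊤
    (τ, if τ = ⊤ then (jumpData x n).2 else evalRight x τ)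

lemma measurable_jumpData (n : ℕ) : Measurable fun x => jumpData x n := by
  induction n with
  | zero => exact measurable_const.prodMk (measurable_pi_apply 0)
  | succ n ih =>
    have hτ : Measurable fun x => (jumpData x (n + 1)).1 := by
      simp only [jumpData]
      refine Measurable.iInf fun q => Measurable.ite ?_ measurable_const measurable_const
      refine (measurableSet_lt ih.fst measurable_const).inter ?_
      exact (measurableSet_eq_fun (measurable_pi_apply _) ih.snd).compl
    refine hτ.prodMk ?_
    exact Measurable.ite (hτ (measurableSet_singleton ⊤)) ih.snd
      (measurable_evalRight measurable_id hτ)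

/-- A right-continuous path keeps its value for a while after every time, so the infimum defining a
jump time may be taken over rational times. This makes the jump times measurable functions of the
path. -/
lemma jumpData_eq {x : ℝ≥0 → ℕ} (hx : IsRightCont x) (n : ℕ) :
    jumpData x n = (jumpTime x n, jumpChain x n) := by
  induction n with
  | zero => rfl
  | succ n ih =>
    have hτ : (⨅ q : ℚ≥0, if (jumpData x n).1 < ((q : ℝ≥0) : ℝ≥0∞) ∧ x (q : ℝ≥0) ≠ (jumpData x n).2
      then ((q : ℝ≥0) : ℝ≥0∞) else ⊤) = jumpTime x (n + 1) := by
      rw [ih]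
      refine le_antisymm (le_sInf ?_) (le_iInf fun q => ?_)
      · rintro _ ⟨t, ⟨h, hne⟩, rfl⟩
        refine le_of_forall_gt fun b hb => ?_
        obtain ⟨u, hu, heq⟩ := hx.exists_eq t
        obtain ⟨r, hr1, hr2⟩ := ENNReal.lt_iff_exists_nnreal_btwn.1 hb
        obtain ⟨q, hq1, hq2⟩ := exists_rat_btwn (NNReal.coe_lt_coe.2
          (lt_min hu (ENNReal.coe_lt_coe.1 hr1)))
        have hq0 : 0 ≤ q := by
          have : (0:ℝ) ≤ q := t.coe_nonneg.trans hq1.le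
          exact_mod_cast this
        lift q to ℚ≥0 using hq0
        have e : ((q : ℚ) : ℝ) = ((q : ℝ≥0) : ℝ) := by push_cast; rfl
        rw [e, NNReal.coe_lt_coe] at hq1 hq2
        refine (iInf_le _ q).trans_lt ?_
        have hcond : jumpTime x n < ((q : ℝ≥0) : ℝ≥0∞) ∧ x (q : ℝ≥0) ≠ jumpChain x n := by
          refine ⟨h.trans (ENNReal.coe_lt_coe.2 hq1), ?_⟩
          rw [heq _ hq1.le (hq2.trans_le (min_le_left _ _)),
            jumpChain_eq (ne_top_of_lt h)]
          exact hne
        rw [if_pos hcond]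
        exact (ENNReal.coe_lt_coe.2 (hq2.trans_le (min_le_right _ _))).trans hr2
      · split_ifs with h
        · refine jumpTime_succ_le h.1 ?_
          rw [← jumpChain_eq (ne_top_of_lt h.1)]
          exact h.2
        · exact le_top
    rw [jumpData]
    simp only [hτ]
    rw [jumpChain, ih]
    congr 1
    split_ifs with h
    · rfl
    · exact evalRight_eq hx _

/-- The jump chain and holding times, as a measurable function of the path. -/
def pathData (x : ℝ≥0 → ℕ) : (ℕ → ℕ) × (ℕ → ℝ≥0∞) :=
  (fun n => (jumpData x n).2, fun n => if (jumpData x n).1 = ⊤ then ⊤ else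
    (jumpData x (n + 1)).1 - (jumpData x n).1)

lemma measurable_pathData : Measurable pathData := by
  refine (measurable_pi_lambda _ fun n => (measurable_jumpData n).snd).prodMk
    (measurable_pi_lambda _ fun n => ?_)
  exact Measurable.ite ((measurable_jumpData n).fst (measurableSet_singleton ⊤)) measurable_const
    ((measurable_jumpData _).fst.sub (measurable_jumpData n).fst)

lemma pathData_eq {x : ℝ≥0 → ℕ} (hx : IsRightCont x) :
    pathData x = (jumpChain x, holdTime x) := by
  simp only [pathData, jumpData_eq hx]
  rfl

/-! ### One step of the jump chain with its holding time -/

/-- The exponential law with rate `q` on `[0, ∞]`; for `q = 0` it is the point mass at `∞`. -/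
def expLaw (q : ℝ≥0) : Measure ℝ≥0∞ :=
  if q = 0 then Measure.dirac ⊤ else (expMeasure q).map ENNReal.ofReal

instance isProbabilityMeasure_expLaw (q : ℝ≥0) : IsProbabilityMeasure (expLaw q) := by
  unfold expLaw
  split_ifs with h
  · infer_instance
  · have := isProbabilityMeasure_expMeasure (r := q) (by positivity)
    exact Measure.isProbabilityMeasure_map (by fun_prop)

lemma lintegral_expLaw {q : ℝ≥0} (hq : q ≠ 0) {F : ℝ≥0∞ → ℝ≥0∞} (hF : Measurable F) :
    ∫⁻ x, F x ∂expLaw q =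
      ∫⁻ x in Ioi 0, ENNReal.ofReal (q * Real.exp (-(q * x))) * F (ENNReal.ofReal x) := by
  have hpdf : Measurable (gammaPDF 1 q) := (measurable_gammaPDFReal 1 q).ennreal_ofReal
  rw [expLaw, if_neg hq, lintegral_map hF (by fun_prop), expMeasure, gammaMeasure,
    lintegral_withDensity_eq_lintegral_mul _ hpdf (g := fun a => F (ENNReal.ofReal a))
      (hF.comp ENNReal.measurable_ofReal), ← lintegral_indicator measurableSet_Ioi]
  have h0 : ∀ᵐ x : ℝ, x ≠ 0 := by simp [ae_iff]
  refine lintegral_congr_ae ?_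
  filter_upwards [h0] with x hx
  rw [Pi.mul_apply, show gammaPDF 1 q x = exponentialPDF q x from rfl, exponentialPDF_eq]
  by_cases h : 0 < x
  · rw [indicator_of_mem (show x ∈ Ioi 0 from h), if_pos h.le]
  · rw [indicator_of_notMem (by simpa using h), if_neg (fun h' => h (lt_of_le_of_ne h' hx.symm))]
    simp

lemma expLaw_Ioi (q x : ℝ≥0) : expLaw q (Ioi x) = ENNReal.ofReal (Real.exp (-(q * x : ℝ))) := by
  by_cases hq : q = 0
  · simp [expLaw, hq]
  · have hq' : 0 < (q : ℝ) := by positivity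
    rw [← lintegral_indicator_one measurableSet_Ioi, lintegral_expLaw hq
      (measurable_one.indicator measurableSet_Ioi)]
    have e : ∀ y ∈ Ioi (0:ℝ), ENNReal.ofReal (q * Real.exp (-(q * y))) *
        (Ioi (x : ℝ≥0∞)).indicator 1 (ENNReal.ofReal y)
        = (Ioi (x : ℝ)).indicator (fun y => ENNReal.ofReal (q * Real.exp (-(q * y)))) y := by
      intro y hy
      have hy' : 0 < y := hy
      have hiff : ENNReal.ofReal y ∈ Ioi (x : ℝ≥0∞) ↔ y ∈ Ioi (x : ℝ) := by
        rw [mem_Ioi, mem_Ioi, ← ENNReal.ofReal_coe_nnreal, ENNReal.ofReal_lt_ofReal_iff hy']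
      by_cases h : y ∈ Ioi (x : ℝ)
      · rw [indicator_of_mem h, indicator_of_mem (hiff.2 h)]; simp
      · rw [indicator_of_notMem h, indicator_of_notMem (fun h' => h (hiff.1 h'))]; simp
    rw [setLIntegral_congr_fun measurableSet_Ioi e, setLIntegral_indicator measurableSet_Ioi,
      inter_eq_left.2 (Ioi_subset_Ioi x.coe_nonneg),
      ← ofReal_integral_eq_lintegral_ofReal
        ((integrableOn_exp_neg_mul_Ioi hq' _).const_mul _)
        (Eventually.of_forall fun y => by positivity), integral_const_mul,
      integral_exp_neg_mul_Ioi hq', mul_div_cancel₀ _ hq'.ne']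

/-- Sequences of states and holding times. -/
abbrev ChainData := (ℕ → ℕ) × (ℕ → ℝ≥0∞)

/-- `μ` is the law of the jump chain and the holding times of a birth and death process. -/
structure IsChainLaw (b d : ℕ → ℝ≥0) (μ₀ : Measure ℕ) (μ : Measure ChainData) : Prop where
  pos : ∀ᵐ ζ ∂μ, ∀ k, 0 < ζ.2 k
  law : ∀ (n : ℕ) (i : ℕ → ℕ) (h : ℕ → ℝ≥0),
    μ {ζ | (∀ k ≤ n, ζ.1 k = i k) ∧ ∀ k < n, (h k : ℝ≥0∞) < ζ.2 k} =
      μ₀ {i 0} * ∏ k ∈ Finset.range n,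
        ((jumpProb b d (i k) (i (k + 1)) : ℝ≥0∞) *
          ENNReal.ofReal (Real.exp (-((b (i k) + d (i k) : ℝ≥0) * h k : ℝ))))

/-- The half-lines `(x, ∞]`, and the whole space. -/
def tailSets : Set (Set ℝ≥0∞) := insert univ (Ioi '' range ((↑) : ℝ≥0 → ℝ≥0∞))

lemma isPiSystem_tailSets : IsPiSystem tailSets := (isPiSystem_image_Ioi _).insert_univ

lemma isCountablySpanning_tailSets : IsCountablySpanning tailSets :=
  ⟨fun _ => univ, fun _ => mem_insert _ _, iUnion_const _⟩

lemma generateFrom_tailSets : MeasurableSpace.generateFrom tailSets = ENNReal.measurableSpace := by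
  rw [tailSets, MeasurableSpace.generateFrom_insert_univ, BorelSpace.measurable_eq (α := ℝ≥0∞),
    borel_eq_generateFrom_Ioi]
  refine le_antisymm (MeasurableSpace.generateFrom_mono ?_) (MeasurableSpace.generateFrom_le ?_)
  · rintro _ ⟨x, -, rfl⟩
    exact mem_range_self _
  · rintro _ ⟨x, rfl⟩
    induction x with
    | top => simp
    | coe x => exact MeasurableSpace.measurableSet_generateFrom ⟨x, mem_range_self x, rfl⟩

/-- Among positive values the whole space is the tail (0, ∞]. Since holding times are positive,
`univ` can join the half-lines, which then contain a spanning set. -/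
lemma exists_of_mem_tailSets {s : Set ℝ≥0∞} (hs : s ∈ tailSets) :
    ∃ x : ℝ≥0, ∀ y, 0 < y → (y ∈ s ↔ (x : ℝ≥0∞) < y) := by
  rcases hs with rfl | ⟨_, ⟨x, rfl⟩, rfl⟩
  · exact ⟨0, fun y hy => by simpa using hy⟩
  · exact ⟨x, fun y _ => Iff.rfl⟩

lemma measurableSet_of_mem_tailSets {s : Set ℝ≥0∞} (hs : s ∈ tailSets) : MeasurableSet s := by
  rcases hs with rfl | ⟨x, -, rfl⟩
  exacts [MeasurableSet.univ, measurableSet_Ioi]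

/-- The event that the first states are `i 0, …, i n`. -/
def statesEq (i : ℕ → ℕ) (n : ℕ) : Set ChainData := {ζ | ∀ k ≤ n, ζ.1 k = i k}

lemma measurable_state (k : ℕ) : Measurable fun ζ : ChainData => ζ.1 k :=
  (measurable_pi_apply k).comp measurable_fst

lemma measurable_hold (k : ℕ) : Measurable fun ζ : ChainData => ζ.2 k :=
  (measurable_pi_apply k).comp measurable_snd

lemma measurableSet_statesEq (i : ℕ → ℕ) (n : ℕ) : MeasurableSet (statesEq i n) := by
  simp only [statesEq, Set.ofPred_forall]
  exact MeasurableSet.iInter fun k => MeasurableSet.iInter fun _ =>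
    (measurable_state k) (measurableSet_singleton (i k))

/-- The first `n` holding times. -/
def holdPrefix (n : ℕ) (ζ : ChainData) : Fin n → ℝ≥0∞ := fun k => ζ.2 k

lemma measurable_holdPrefix (n : ℕ) : Measurable (holdPrefix n) :=
  measurable_pi_lambda _ fun k => measurable_hold k

section ChainLaw

variable {b d : ℕ → ℝ≥0} {μ₀ : Measure ℕ} {μ : Measure ChainData} [IsProbabilityMeasure μ]

/-- The Markov property: with the states up to n and the next state fixed, the n-th holding time is
exponential and independent of the earlier ones. `IsChainLaw.law` gives the identity on boxes of
tails, a generating π-system. -/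
lemma IsChainLaw.map_step (hμ : IsChainLaw b d μ₀ μ) (n : ℕ) (i : ℕ → ℕ) (j : ℕ) :
    (μ.restrict (statesEq i n ∩ {ζ | ζ.1 (n + 1) = j})).map (fun ζ => (holdPrefix n ζ, ζ.2 n)) =
      (jumpProb b d (i n) j : ℝ≥0∞) •
        ((μ.restrict (statesEq i n)).map (holdPrefix n)).prod (expLaw (b (i n) + d (i n))) := by
  have hm := (measurable_holdPrefix n).prodMk (measurable_hold n)
  have hB := measurableSet_statesEq i n
  have hj : MeasurableSet {ζ : ChainData | ζ.1 (n + 1) = j} :=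
    (measurable_state (n + 1)) (measurableSet_singleton j)
  have hbox : ∀ t ∈ image2 (· ×ˢ ·) (pi univ '' pi univ fun _ : Fin n => tailSets) tailSets,
      (μ.restrict (statesEq i n ∩ {ζ | ζ.1 (n + 1) = j})).map
        (fun ζ => (holdPrefix n ζ, ζ.2 n)) t =
      ((jumpProb b d (i n) j : ℝ≥0∞) •
        ((μ.restrict (statesEq i n)).map (holdPrefix n)).prod (expLaw (b (i n) + d (i n)))) t := by
    rintro _ ⟨_, ⟨s, hs, rfl⟩, u, hu, rfl⟩
    have hsm : MeasurableSet (pi univ s) :=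
      MeasurableSet.univ_pi fun k => measurableSet_of_mem_tailSets (hs k (mem_univ k))
    have hum := measurableSet_of_mem_tailSets hu
    rw [Measure.map_apply hm (hsm.prod hum), Measure.restrict_apply (hm (hsm.prod hum)),
      Measure.smul_apply, Measure.prod_prod, Measure.map_apply (measurable_holdPrefix n) hsm,
      Measure.restrict_apply (measurable_holdPrefix n hsm)]
    choose x hx using fun k : Fin n => exists_of_mem_tailSets (hs k (mem_univ k))
    obtain ⟨y, hy⟩ := exists_of_mem_tailSets hu
    -- Extending the states by j and the thresholds by y turns the event for n + 1 steps into one to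
    -- which `IsChainLaw.law` applies.
    let i' : ℕ → ℕ := fun k => if k ≤ n then i k else j
    let x' : ℕ → ℝ≥0 := fun k => if h : k < n then x ⟨k, h⟩ else y
    have e1 : μ (((fun ζ => (holdPrefix n ζ, ζ.2 n)) ⁻¹' (pi univ s ×ˢ u)) ∩
        (statesEq i n ∩ {ζ | ζ.1 (n + 1) = j})) =
        μ {ζ | (∀ k ≤ n + 1, ζ.1 k = i' k) ∧ ∀ k < n + 1, (x' k : ℝ≥0∞) < ζ.2 k} := by
      refine measure_congr ?_
      filter_upwards [hμ.pos] with ζ hζ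
      refine propext ?_
      simp only [statesEq]
      constructor
      · rintro ⟨⟨h1, h2⟩, h3, h4⟩
        refine ⟨fun k hk => ?_, fun k hk => ?_⟩
        · by_cases h : k ≤ n
          · simp only [i', if_pos h]; exact h3 k h
          · obtain rfl : k = n + 1 := by omega
            simp only [i', if_neg h]; exact h4
        · by_cases h : k < n
          · simp only [x', dif_pos h]; exact (hx ⟨k, h⟩ _ (hζ k)).1 (h1 ⟨k, h⟩ (mem_univ _))
          · obtain rfl : k = n := by omega
            simp only [x', dif_neg h]; exact (hy _ (hζ k)).1 h2
      · rintro ⟨h1, h2⟩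
        refine ⟨⟨fun k _ => (hx k _ (hζ k)).2 ?_, (hy _ (hζ n)).2 ?_⟩, fun k hk => ?_, ?_⟩
        · simpa [x'] using h2 k (by omega)
        · simpa [x'] using h2 n (by omega)
        · simpa [i', hk] using h1 k (by omega)
        · simpa [i'] using h1 (n + 1) le_rfl
    have e2 : μ ((holdPrefix n ⁻¹' pi univ s) ∩ statesEq i n) =
        μ {ζ | (∀ k ≤ n, ζ.1 k = i' k) ∧ ∀ k < n, (x' k : ℝ≥0∞) < ζ.2 k} := by
      refine measure_congr ?_
      filter_upwards [hμ.pos] with ζ hζ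
      refine propext ?_
      simp only [statesEq]
      constructor
      · rintro ⟨h1, h2⟩
        refine ⟨fun k hk => ?_, fun k hk => ?_⟩
        · simp only [i', if_pos hk]; exact h2 k hk
        · simp only [x', dif_pos hk]; exact (hx ⟨k, hk⟩ _ (hζ k)).1 (h1 ⟨k, hk⟩ (mem_univ _))
      · rintro ⟨h1, h2⟩
        refine ⟨fun k _ => (hx k _ (hζ k)).2 ?_, fun k hk => ?_⟩
        · simpa [x'] using h2 k k.2
        · simpa [i', hk] using h1 k hk
    have e3 : expLaw (b (i n) + d (i n)) u = expLaw (b (i n) + d (i n)) (Ioi y) := by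
      have h0 : ∀ᵐ z ∂expLaw (b (i n) + d (i n)), 0 < z := by
        have h := expLaw_Ioi (b (i n) + d (i n)) 0
        simp only [ENNReal.coe_zero, NNReal.coe_zero, mul_zero, neg_zero, Real.exp_zero,
          ENNReal.ofReal_one] at h
        exact (prob_compl_eq_zero_iff measurableSet_Ioi).2 h
      refine measure_congr ?_
      filter_upwards [h0] with z hz
      exact propext (hy z hz)
    rw [e1, e2, e3, hμ.law, hμ.law, Finset.prod_range_succ, expLaw_Ioi]
    have hi1 : i' n = i n := by simp [i']
    have hi2 : i' (n + 1) = j := by simp [i']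
    have hx1 : x' n = y := by simp [x']
    rw [hi1, hi2, hx1, smul_eq_mul]
    ring
  refine ext_of_generate_finite _ ?_
    ((IsPiSystem.pi fun _ => isPiSystem_tailSets).prod isPiSystem_tailSets) hbox ?_
  · refine (generateFrom_eq_prod ?_ generateFrom_tailSets ?_ isCountablySpanning_tailSets).symm
    · exact generateFrom_eq_pi (fun _ => generateFrom_tailSets)
        fun _ => isCountablySpanning_tailSets
    · exact IsCountablySpanning.pi fun _ => isCountablySpanning_tailSets
  · refine hbox univ ⟨univ, ⟨fun _ => univ, fun _ _ => mem_insert _ _, by simp⟩, univ,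
      mem_insert _ _, by simp⟩

lemma lintegral_eq_tsum_fiber {α ι : Type*} [MeasurableSpace α] [MeasurableSpace ι] [Countable ι]
    [MeasurableSingletonClass ι] {T : α → ι} (hT : Measurable T) (ν : Measure α) (f : α → ℝ≥0∞) :
    ∫⁻ a, f a ∂ν = ∑' i, ∫⁻ a in T ⁻¹' {i}, f a ∂ν := by
  rw [← lintegral_iUnion (fun i => hT (measurableSet_singleton i))]
  · rw [← preimage_iUnion, iUnion_of_singleton, preimage_univ, Measure.restrict_univ]
  · intro i j hij
    exact Disjoint.preimage T (by simpa using hij)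

/-- Conditioning on the past. By `hpre`, f depends on ζ only through the states up to n and the
holding times before n; on each event fixing those states it is a function of `holdPrefix`, and
`IsChainLaw.map_step` applies. -/
theorem IsChainLaw.lintegral_step (hμ : IsChainLaw b d μ₀ μ) (n : ℕ)
    {f : ChainData → ℝ≥0∞ → ℕ → ℝ≥0∞}
    (hf : ∀ j, Measurable fun p : ChainData × ℝ≥0∞ => f p.1 p.2 j)
    (hpre : ∀ ζ ζ' : ChainData, (∀ k ≤ n, ζ.1 k = ζ'.1 k) → (∀ k < n, ζ.2 k = ζ'.2 k) →
      f ζ = f ζ') :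
    ∫⁻ ζ, f ζ (ζ.2 n) (ζ.1 (n + 1)) ∂μ =
      ∫⁻ ζ, ∑' j, (jumpProb b d (ζ.1 n) j : ℝ≥0∞) *
        ∫⁻ x, f ζ x j ∂expLaw (b (ζ.1 n) + d (ζ.1 n)) ∂μ := by
  have hT : Measurable fun (ζ : ChainData) (k : Fin (n + 1)) => ζ.1 k :=
    measurable_pi_lambda _ fun k => measurable_state k
  rw [lintegral_eq_tsum_fiber hT, lintegral_eq_tsum_fiber hT μ]
  refine tsum_congr fun v => ?_
  let i : ℕ → ℕ := fun k => if h : k < n + 1 then v ⟨k, h⟩ else 0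
  have hset : (fun (ζ : ChainData) (k : Fin (n + 1)) => ζ.1 k) ⁻¹' {v} = statesEq i n := by
    ext ζ
    simp only [mem_preimage, mem_singleton_iff, funext_iff, statesEq, mem_ofPred_eq]
    constructor
    · intro h k hk
      simp only [i, dif_pos (Nat.lt_succ_iff.2 hk)]
      exact h ⟨k, Nat.lt_succ_iff.2 hk⟩
    · intro h k
      have h1 := h k (Nat.lt_succ_iff.1 k.2)
      simp only [i, dif_pos k.2] at h1
      exact h1
  rw [hset]
  have hB := measurableSet_statesEq i n
  let R : (Fin n → ℝ≥0∞) → ChainData := fun v => (i, fun k => if h : k < n then v ⟨k, h⟩ else 0)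
  have hR : Measurable R := measurable_const.prodMk (measurable_pi_lambda _ fun k => by
    by_cases h : k < n
    · simpa only [dif_pos h] using measurable_pi_apply _
    · simpa only [dif_neg h] using measurable_const)
  have hfR : ∀ ζ ∈ statesEq i n, f ζ = f (R (holdPrefix n ζ)) := fun ζ hζ =>
    hpre _ _ hζ fun k hk => by simp [R, holdPrefix, hk]
  rw [lintegral_eq_tsum_fiber (measurable_state (n + 1))]
  have e : ∀ j, ∫⁻ ζ in (fun ζ : ChainData => ζ.1 (n + 1)) ⁻¹' {j}, f ζ (ζ.2 n) (ζ.1 (n + 1))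
      ∂(μ.restrict (statesEq i n)) = ∫⁻ ζ in statesEq i n, (jumpProb b d (ζ.1 n) j : ℝ≥0∞) *
        ∫⁻ x, f ζ x j ∂expLaw (b (ζ.1 n) + d (ζ.1 n)) ∂μ := by
    intro j
    have hj : MeasurableSet ((fun ζ : ChainData => ζ.1 (n + 1)) ⁻¹' {j}) :=
      (measurable_state (n + 1)) (measurableSet_singleton j)
    have hm := (measurable_holdPrefix n).prodMk (measurable_hold n)
    have hfm : Measurable fun p : (Fin n → ℝ≥0∞) × ℝ≥0∞ => f (R p.1) p.2 j :=
      (hf j).comp ((hR.comp measurable_fst).prodMk measurable_snd)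
    have hcm : Measurable fun ζ : ChainData =>
        ∫⁻ y, f (R (holdPrefix n ζ)) y j ∂expLaw (b (i n) + d (i n)) :=
      hfm.lintegral_prod_right'.comp (measurable_holdPrefix n)
    rw [Measure.restrict_restrict hj, inter_comm]
    calc _ = ∫⁻ ζ in statesEq i n ∩ {ζ | ζ.1 (n + 1) = j}, f (R (holdPrefix n ζ)) (ζ.2 n) j ∂μ := by
          refine setLIntegral_congr_fun (hB.inter hj) fun ζ hζ => ?_
          have h2 : ζ.1 (n + 1) = j := hζ.2
          simp only [hfR ζ hζ.1, h2]
      _ = ∫⁻ p, f (R p.1) p.2 j ∂((μ.restrict (statesEq i n ∩ {ζ | ζ.1 (n + 1) = j})).map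
            (fun ζ => (holdPrefix n ζ, ζ.2 n))) := by
          rw [lintegral_map hfm hm]
      _ = _ := by
          rw [hμ.map_step, lintegral_smul_measure, lintegral_prod _ hfm.aemeasurable,
            lintegral_map hfm.lintegral_prod_right' (measurable_holdPrefix n), smul_eq_mul,
            ← lintegral_const_mul _ hcm]
          refine setLIntegral_congr_fun hB fun ζ hζ => ?_
          simp only [hfR ζ hζ, show ζ.1 n = i n from hζ n le_rfl]
  simp only [e]
  rw [← lintegral_tsum]
  intro j
  have hfm : Measurable fun p : (Fin n → ℝ≥0∞) × ℝ≥0∞ => f (R p.1) p.2 j :=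
      (hf j).comp ((hR.comp measurable_fst).prodMk measurable_snd)
  refine AEMeasurable.congr (f := fun ζ => (jumpProb b d (i n) j : ℝ≥0∞) *
    ∫⁻ x, f (R (holdPrefix n ζ)) x j ∂expLaw (b (i n) + d (i n))) ?_ ?_
  · exact ((hfm.lintegral_prod_right'.comp (measurable_holdPrefix n)).const_mul _).aemeasurable
  · filter_upwards [ae_restrict_mem hB] with ζ hζ
    simp only [hfR ζ hζ, show ζ.1 n = i n from hζ n le_rfl]

lemma isChainLaw_map {Ω : Type*} [MeasurableSpace Ω] {P : Measure Ω} {Z : ℝ≥0 → Ω → ℕ}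
    (hZ : IsBirthDeathProcess b d μ₀ Z P) :
    IsChainLaw b d μ₀ (P.map fun ω => pathData fun t => Z t ω) := by
  have hm : Measurable fun ω => pathData fun t => Z t ω :=
    measurable_pathData.comp (measurable_pi_lambda _ hZ.measurable)
  have heq : ∀ᵐ ω ∂P, pathData (fun t => Z t ω) =
      (jumpChain fun t => Z t ω, holdTime fun t => Z t ω) := by
    filter_upwards [hZ.rightContinuous] with ω hω
    exact pathData_eq hω
  constructor
  · have hset : MeasurableSet {ζ : ChainData | ∀ k, 0 < ζ.2 k} := by
      simp only [Set.ofPred_forall]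
      exact MeasurableSet.iInter fun k => measurableSet_lt measurable_const (measurable_hold k)
    rw [ae_map_iff hm.aemeasurable hset]
    filter_upwards [hZ.rightContinuous] with ω hω k
    rw [pathData_eq hω]
    exact holdTime_pos hω k
  · intro n i h
    rw [← hZ.law n i h, Measure.map_apply hm]
    · refine measure_congr ?_
      filter_upwards [heq] with ω hω
      refine propext ?_
      change ((∀ k ≤ n, (pathData fun t => Z t ω).1 k = i k) ∧
        ∀ k < n, (h k : ℝ≥0∞) < (pathData fun t => Z t ω).2 k) ↔ _
      rw [hω]
      rfl
    · have hset : MeasurableSet {ζ : ChainData | ∀ k < n, (h k : ℝ≥0∞) < ζ.2 k} := ?_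
      · exact (measurableSet_statesEq i n).inter hset
      simp only [Set.ofPred_forall]
      exact MeasurableSet.iInter fun k => MeasurableSet.iInter fun _ =>
        measurableSet_lt measurable_const (measurable_hold k)

end ChainLaw

/-! ### Integral identities for the Poisson process and for the birth and death process -/

/-- The countable exceptional set accommodates the discontinuities of step functions g. -/
lemma integral_Ioi_of_hasDerivAt_off_countable {f f' : ℝ → ℝ} {a : ℝ} {s : Set ℝ}
    (hs : s.Countable) (hc : ContinuousOn f (Ici a))
    (hd : ∀ x ∈ Ioi a \ s, HasDerivAt f (-f' x) x) (hi : IntegrableOn f' (Ioi a))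
    (hlim : Tendsto f atTop (𝓝 0)) : ∫ x in Ioi a, f' x = f a := by
  have h1 := intervalIntegral_tendsto_integral_Ioi a hi tendsto_id
  have h2 : Tendsto (fun b => ∫ x in a..b, f' x) atTop (𝓝 (f a - 0)) := by
    refine (tendsto_const_nhds.sub hlim).congr' ?_
    filter_upwards [eventually_ge_atTop a] with b hb
    have h := integral_eq_of_hasDerivAt_off_countable_of_le f (fun x => -f' x) hb hs
      (hc.mono Icc_subset_Ici_self) (fun x hx => hd x ⟨hx.1.1, hx.2⟩)
      (((intervalIntegrable_iff_integrableOn_Ioc_of_le hb).2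
        (hi.mono_set Ioc_subset_Ioi_self)).neg)
    rw [intervalIntegral.integral_neg] at h
    linarith
  rw [sub_zero] at h2
  exact tendsto_nhds_unique h1 h2

/-- `∫₀ᵗ (1 - g)`. -/
def missRate (g : ℝ → ℝ) (t : ℝ) : ℝ := ∫ u in (0 : ℝ)..t, (1 - g u)

lemma intervalIntegrable_one_sub {g : ℝ → ℝ} (hg : Measurable g) (hg0 : ∀ x, 0 ≤ g x)
    (hg1 : ∀ x, g x ≤ 1) (a b : ℝ) : IntervalIntegrable (fun u => 1 - g u) volume a b := by
  refine (intervalIntegrable_const (c := (1:ℝ))).mono_fun (by fun_prop)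
    (Eventually.of_forall fun u => ?_)
  simp only [norm_one]
  rw [Real.norm_of_nonneg (by linarith [hg1 u])]
  linarith [hg0 u]

lemma continuous_missRate {g : ℝ → ℝ} (hg : Measurable g) (hg0 : ∀ x, 0 ≤ g x)
    (hg1 : ∀ x, g x ≤ 1) : Continuous (missRate g) :=
  intervalIntegral.continuous_primitive (intervalIntegrable_one_sub hg hg0 hg1) 0

lemma missRate_sub {g : ℝ → ℝ} (hg : Measurable g) (hg0 : ∀ x, 0 ≤ g x)
    (hg1 : ∀ x, g x ≤ 1) (a b : ℝ) : missRate g b - missRate g a = ∫ u in a..b, (1 - g u) :=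
  intervalIntegral.integral_interval_sub_left (intervalIntegrable_one_sub hg hg0 hg1 _ _)
    (intervalIntegrable_one_sub hg hg0 hg1 _ _)

lemma monotone_missRate {g : ℝ → ℝ} (hg : Measurable g) (hg0 : ∀ x, 0 ≤ g x)
    (hg1 : ∀ x, g x ≤ 1) : Monotone (missRate g) := fun a b hab => by
  have := missRate_sub hg hg0 hg1 a b
  have h2 : 0 ≤ ∫ u in a..b, (1 - g u) :=
    intervalIntegral.integral_nonneg hab fun u _ => by linarith [hg1 u]
  linarith

lemma hasDerivAt_missRate {g : ℝ → ℝ} (hg : Measurable g) (hg0 : ∀ x, 0 ≤ g x)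
    (hg1 : ∀ x, g x ≤ 1) {t : ℝ} (ht : ContinuousAt g t) :
    HasDerivAt (missRate g) (1 - g t) t :=
  intervalIntegral.integral_hasDerivAt_right (intervalIntegrable_one_sub hg hg0 hg1 _ _)
    (Measurable.stronglyMeasurable (by fun_prop)).stronglyMeasurableAtFilter
    (continuousAt_const.sub ht)

/-- The integrand is minus the derivative of e^{-x} U(u+x), where U(u) = exp(-∫_u^L (1-g)) is the
functional of a Poisson process restarted at u. -/
lemma integral_poissonStep {g : ℝ → ℝ} (hg : Measurable g) (hg0 : ∀ x, 0 ≤ g x)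
    (hg1 : ∀ x, g x ≤ 1) (hcount : {x | ¬ ContinuousAt g x}.Countable) {L : ℝ}
    (hL : ∀ x, L ≤ x → g x = 1) (u : ℝ) :
    ∫ x in Ioi 0, Real.exp (-x) * (g (u + x) * Real.exp (missRate g (u + x) - missRate g L)) =
      Real.exp (missRate g u - missRate g L) := by
  have hG := continuous_missRate hg hg0 hg1
  have hmono := monotone_missRate hg hg0 hg1
  have hle : ∀ y, missRate g y ≤ missRate g L := by
    intro y
    rcases le_total y L with h | h
    · exact hmono h
    · have := missRate_sub hg hg0 hg1 L y
      rw [intervalIntegral.integral_congr (g := fun _ => 0)] at this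
      · simp at this; linarith
      · intro x hx
        rw [uIcc_of_le h] at hx
        simp [hL x hx.1]
  have hb : ∀ y, Real.exp (missRate g y - missRate g L) ≤ 1 := fun y =>
    Real.exp_le_one_iff.2 (by linarith [hle y])
  have h := integral_Ioi_of_hasDerivAt_off_countable (a := 0)
    (s := (fun x => u + x) ⁻¹' {x | ¬ ContinuousAt g x})
    (f := fun x => Real.exp (-x) * Real.exp (missRate g (u + x) - missRate g L))
    (f' := fun x => Real.exp (-x) * (g (u + x) * Real.exp (missRate g (u + x) - missRate g L)))
    (hcount.preimage (add_right_injective u)) (by fun_prop) ?_ ?_ ?_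
  · simpa using h
  · rintro x ⟨-, hx⟩
    have hx' : ContinuousAt g (u + x) := not_not.1 hx
    have h1 : HasDerivAt (fun x => missRate g (u + x)) (1 - g (u + x)) x :=
      (hasDerivAt_missRate hg hg0 hg1 hx').comp_const_add u x
    have h2 := ((hasDerivAt_id x).neg.exp).mul ((h1.sub_const (missRate g L)).exp)
    refine h2.congr_deriv ?_
    simp only [id, Pi.neg_apply]
    ring
  · refine (integrableOn_exp_neg_Ioi 0).mono' (Measurable.aestronglyMeasurable ?_)
      (Eventually.of_forall fun x => ?_)
    · have := hG.measurable
      fun_prop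
    · rw [Real.norm_of_nonneg (mul_nonneg (Real.exp_pos _).le
        (mul_nonneg (hg0 _) (Real.exp_pos _).le))]
      have : g (u + x) * Real.exp (missRate g (u + x) - missRate g L) ≤ 1 * 1 :=
        mul_le_mul (hg1 _) (hb _) (Real.exp_pos _).le zero_le_one
      calc _ ≤ Real.exp (-x) * (1 * 1) := by gcongr
        _ = _ := by ring
  · refine squeeze_zero (fun x => by positivity) (fun x => ?_)
      (Real.tendsto_exp_neg_atTop_nhds_zero)
    exact mul_le_of_le_one_right (Real.exp_pos _).le (hb _)

lemma integrableOn_birthDeathStep {g φ : ℝ → ℝ} (hg : Measurable g) (hg0 : ∀ x, 0 ≤ g x)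
    (hg1 : ∀ x, g x ≤ 1) (hφ : IsRiccatiSolution g φ) {i : ℕ} {t : ℝ} (ht : 0 ≤ t) :
    IntegrableOn (fun x => (2 * i) * Real.exp (-((2 * i) * x)) *
      (g (t + 2 * x) * Real.exp (-(i * (missRate g (t + 2 * x) - missRate g t))) *
        (φ (t + 2 * x) ^ (i + 1) / 2 + φ (t + 2 * x) ^ (i - 1) / 2))) (Ioi 0) := by
  have hG := (continuous_missRate hg hg0 hg1).measurable
  have hφm := hφ.continuous.measurable
  have hint : IntegrableOn (fun x : ℝ => (2 * i) * Real.exp (-((2 * i) * x))) (Ioi 0) := by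
    rcases Nat.eq_zero_or_pos i with rfl | hi
    · simp
    · have hi0 : (0:ℝ) < i := by positivity
      exact (integrableOn_exp_neg_mul_Ioi (by linarith) 0).const_mul _
  refine hint.mono' (Measurable.aestronglyMeasurable (by fun_prop)) ?_
  filter_upwards [ae_restrict_mem measurableSet_Ioi] with x hx
  have hx' : (0:ℝ) < x := hx
  have hφ01 : ∀ n, 0 ≤ φ (t + 2 * x) ^ n ∧ φ (t + 2 * x) ^ n ≤ 1 := fun n =>
    ⟨pow_nonneg (hφ.nonneg _ (by linarith)) n,
      pow_le_one₀ (hφ.nonneg _ (by linarith)) (hφ.le_one _ (by linarith))⟩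
  have h1 := hφ01 (i + 1)
  have h2 := hφ01 (i - 1)
  have h3 : Real.exp (-(i * (missRate g (t + 2 * x) - missRate g t))) ≤ 1 := by
    have h1 := monotone_missRate hg hg0 hg1 (show t ≤ t + 2 * x by linarith)
    have := mul_nonneg (Nat.cast_nonneg (α := ℝ) i) (sub_nonneg.2 h1)
    exact Real.exp_le_one_iff.2 (by linarith)
  have h4 := Real.exp_pos (-(i * (missRate g (t + 2 * x) - missRate g t)))
  rw [norm_mul, Real.norm_of_nonneg (by positivity), Real.norm_of_nonneg
    (mul_nonneg (mul_nonneg (hg0 _) h4.le) (by linarith [h1.1, h2.1]))]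
  refine mul_le_of_le_one_right (by positivity) ?_
  calc _ ≤ (1 * 1 : ℝ) * 1 := mul_le_mul (mul_le_mul (hg1 _) h3 h4.le zero_le_one)
        (by linarith [h1.2, h2.2]) (by linarith [h1.1, h2.1]) (by norm_num)
    _ = 1 := by ring

/-- With G = `missRate g`, the integrand is minus the derivative of e^{-2ix} e^{-i(G(t+2x)-G(t))}
φ(t+2x)^i; the Riccati equation cancels the terms in φ^i and leaves the powers i + 1 and i - 1. The
argument t + 2x appears because a holding time x of Z lasts 2x for Z(t/2). -/
lemma integral_birthDeathStep {g φ : ℝ → ℝ} (hg : Measurable g) (hg0 : ∀ x, 0 ≤ g x)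
    (hg1 : ∀ x, g x ≤ 1) (hcount : {x | ¬ ContinuousAt g x}.Countable)
    (hφ : IsRiccatiSolution g φ) {i : ℕ} (hi : i ≠ 0) {t : ℝ} (ht : 0 ≤ t) :
    ∫ x in Ioi 0, (2 * i) * Real.exp (-((2 * i) * x)) *
      (g (t + 2 * x) * Real.exp (-(i * (missRate g (t + 2 * x) - missRate g t))) *
        (φ (t + 2 * x) ^ (i + 1) / 2 + φ (t + 2 * x) ^ (i - 1) / 2)) = φ t ^ i := by
  have hG := continuous_missRate hg hg0 hg1
  have hmono := monotone_missRate hg hg0 hg1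
  have hi0 : (0:ℝ) < i := by positivity
  have hmaps : MapsTo (fun x : ℝ => t + 2 * x) (Ici 0) (Ici 0) := fun x hx => by
    have : (0:ℝ) ≤ x := hx
    simp only [mem_Ici]; linarith
  have hφc : ContinuousOn (fun x => φ (t + 2 * x)) (Ici 0) :=
    (hφ.continuous.comp (by fun_prop)).continuousOn
  have hb : ∀ x ∈ Ici (0:ℝ), Real.exp (-(i * (missRate g (t + 2 * x) - missRate g t))) ≤ 1 := by
    intro x hx
    have hx' : (0:ℝ) ≤ x := hx
    have h1 := hmono (show t ≤ t + 2 * x by linarith)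
    exact Real.exp_le_one_iff.2 (by nlinarith)
  have hφ01 : ∀ x ∈ Ici (0:ℝ), ∀ n, 0 ≤ φ (t + 2 * x) ^ n ∧ φ (t + 2 * x) ^ n ≤ 1 := fun x hx n =>
    ⟨pow_nonneg (hφ.nonneg _ (hmaps hx)) n,
      pow_le_one₀ (hφ.nonneg _ (hmaps hx)) (hφ.le_one _ (hmaps hx))⟩
  have h := integral_Ioi_of_hasDerivAt_off_countable (a := 0)
    (s := (fun x => t + 2 * x) ⁻¹' {x | ¬ ContinuousAt g x})
    (f := fun x => Real.exp (-((2 * i) * x)) *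
      (Real.exp (-(i * (missRate g (t + 2 * x) - missRate g t))) * φ (t + 2 * x) ^ i))
    (f' := fun x => (2 * i) * Real.exp (-((2 * i) * x)) *
      (g (t + 2 * x) * Real.exp (-(i * (missRate g (t + 2 * x) - missRate g t))) *
        (φ (t + 2 * x) ^ (i + 1) / 2 + φ (t + 2 * x) ^ (i - 1) / 2)))
    (hcount.preimage fun x y hxy => by simpa using hxy) ?_ ?_ ?_ ?_
  · simpa using h
  · refine ContinuousOn.mul (by fun_prop) (ContinuousOn.mul ?_ (hφc.pow i))
    exact Continuous.continuousOn (by fun_prop)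
  · rintro x ⟨hx0, hx⟩
    have hx0' : (0:ℝ) < x := hx0
    have hx' : ContinuousAt g (t + 2 * x) := not_not.1 hx
    have hlin : HasDerivAt (fun x : ℝ => t + 2 * x) 2 x := by
      simpa using ((hasDerivAt_id x).const_mul 2).const_add t
    have h1 := (hasDerivAt_missRate hg hg0 hg1 hx').comp x hlin
    have h2 := (hφ.hasDerivAt (t + 2 * x) (by linarith) hx').comp x hlin
    have h3 := (((hasDerivAt_id x).const_mul (2 * (i:ℝ))).neg.exp).mul
      ((((h1.sub_const (missRate g t)).const_mul (i:ℝ)).neg.exp).mul (h2.pow i))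
    refine h3.congr_deriv ?_
    obtain ⟨k, rfl⟩ := Nat.exists_eq_succ_of_ne_zero hi
    simp only [id, Pi.neg_apply, Function.comp, Nat.succ_eq_add_one, Nat.add_sub_cancel,
      Pi.mul_apply, Pi.pow_apply]
    push_cast
    ring
  · exact integrableOn_birthDeathStep hg hg0 hg1 hφ ht
  · have hlim : Tendsto (fun x : ℝ => Real.exp (-((2 * i) * x))) atTop (𝓝 0) :=
      Real.tendsto_exp_neg_atTop_nhds_zero.comp
        (tendsto_id.const_mul_atTop (by linarith : (0:ℝ) < 2 * i))
    refine squeeze_zero' ?_ ?_ hlim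
    · filter_upwards [eventually_ge_atTop 0] with x hx
      have := (hφ01 x hx i).1
      positivity
    · filter_upwards [eventually_ge_atTop 0] with x hx
      refine mul_le_of_le_one_right (Real.exp_pos _).le ?_
      exact mul_le_one₀ (hb x hx) (hφ01 x hx i).1 (hφ01 x hx i).2

/-! ### Almost sure properties of the jump chain -/

/-- `IsChainLaw.lintegral_step` for the indicator of failure: a property that almost surely holds
for each possible transition holds along the chain. -/
theorem IsChainLaw.ae_step {b d : ℕ → ℝ≥0} {μ₀ : Measure ℕ} {μ : Measure ChainData}
    [IsProbabilityMeasure μ] (hμ : IsChainLaw b d μ₀ μ) (n : ℕ)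
    {p : ChainData → ℝ≥0∞ → ℕ → Prop}
    (hp : ∀ j, MeasurableSet {q : ChainData × ℝ≥0∞ | p q.1 q.2 j})
    (hpre : ∀ ζ ζ' : ChainData, (∀ k ≤ n, ζ.1 k = ζ'.1 k) → (∀ k < n, ζ.2 k = ζ'.2 k) →
      p ζ = p ζ')
    (h : ∀ ζ j, jumpProb b d (ζ.1 n) j ≠ 0 →
      ∀ᵐ x ∂expLaw (b (ζ.1 n) + d (ζ.1 n)), p ζ x j) :
    ∀ᵐ ζ ∂μ, p ζ (ζ.2 n) (ζ.1 (n + 1)) := by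
  classical
  have hstep := hμ.lintegral_step n (f := fun ζ x j => if p ζ x j then 0 else 1)
    (fun j => Measurable.ite (hp j) measurable_const measurable_const)
    (fun ζ ζ' h1 h2 => by rw [hpre ζ ζ' h1 h2])
  have hzero : ∀ ζ : ChainData, ∑' j, (jumpProb b d (ζ.1 n) j : ℝ≥0∞) *
      ∫⁻ x, (if p ζ x j then 0 else 1) ∂expLaw (b (ζ.1 n) + d (ζ.1 n)) = 0 := by
    intro ζ
    refine ENNReal.tsum_eq_zero.2 fun j => ?_
    by_cases hj : jumpProb b d (ζ.1 n) j = 0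
    · simp [hj]
    · have : ∫⁻ x, (if p ζ x j then (0 : ℝ≥0∞) else 1) ∂expLaw (b (ζ.1 n) + d (ζ.1 n)) = 0 := by
        refine lintegral_eq_zero_of_ae_eq_zero ?_
        filter_upwards [h ζ j hj] with x hx
        simp [hx]
      rw [this, mul_zero]
  simp only [hzero, lintegral_zero] at hstep
  have hset : MeasurableSet {ζ : ChainData | p ζ (ζ.2 n) (ζ.1 (n + 1))} := by
    have : {ζ : ChainData | p ζ (ζ.2 n) (ζ.1 (n + 1))} =
        ⋃ j, {ζ : ChainData | ζ.1 (n + 1) = j} ∩ {ζ | p ζ (ζ.2 n) j} := by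
      ext ζ
      simp
    rw [this]
    refine MeasurableSet.iUnion fun j => MeasurableSet.inter ?_ ?_
    · exact measurable_state (n + 1) (measurableSet_singleton j)
    · exact (hp j).preimage (measurable_id.prodMk (measurable_hold n))
  rw [lintegral_eq_zero_iff (Measurable.ite hset measurable_const measurable_const)] at hstep
  filter_upwards [hstep] with ζ hζ
  by_contra hne
  simp [hne] at hζ

/-! ### The generating functional of the Poisson process -/

lemma ae_expLaw_ne_top {q : ℝ≥0} (hq : q ≠ 0) : ∀ᵐ x ∂expLaw q, x ≠ ⊤ := by
  rw [expLaw, if_neg hq, ae_map_iff (by fun_prop)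
    (show MeasurableSet {x : ℝ≥0∞ | x ≠ ⊤} from (measurableSet_singleton ⊤).compl)]
  exact Eventually.of_forall fun x => ENNReal.ofReal_ne_top

lemma ae_expLaw_toReal_ne {q : ℝ≥0} (hq : q ≠ 0) (s : ℝ) : ∀ᵐ x ∂expLaw q, x.toReal ≠ s := by
  have hm : MeasurableSet {x : ℝ≥0∞ | x.toReal = s} :=
    ENNReal.measurable_toReal (measurableSet_singleton s)
  have h : expLaw q {x : ℝ≥0∞ | x.toReal = s} = 0 := by
    rw [← lintegral_indicator_one hm, lintegral_expLaw hq (measurable_one.indicator hm)]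
    refine lintegral_eq_zero_of_ae_eq_zero ?_
    have h0 : ∀ᵐ x ∂(volume.restrict (Ioi (0:ℝ))), x ≠ s :=
      ae_restrict_of_ae (by simp [ae_iff])
    filter_upwards [h0, ae_restrict_mem measurableSet_Ioi] with x hx hx0
    have hx0' : 0 < x := hx0
    rw [indicator_of_notMem]
    · simp
    · simpa [ENNReal.toReal_ofReal hx0'.le] using hx
  rw [ae_iff]
  simpa only [not_not] using h

/-- The law of the jump chain and the holding times of a standard Poisson process. -/
abbrev IsPoissonChainLaw (ν : Measure ChainData) : Prop :=
  IsChainLaw (fun _ => 1) (fun _ => 0) (Measure.dirac 0) ν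

/-- The time of the `n`-th jump. -/
def arrival (η : ChainData) (n : ℕ) : ℝ := ∑ k ∈ Finset.range n, (η.2 k).toReal

lemma measurable_arrival (n : ℕ) : Measurable fun η => arrival η n :=
  Finset.measurable_fun_sum _ fun k _ => (measurable_hold k).ennreal_toReal

lemma measurable_arrival_fst (n : ℕ) :
    Measurable fun p : ChainData × ℝ≥0∞ => arrival p.1 n :=
  (measurable_arrival n).comp measurable_fst

lemma arrival_congr {η η' : ChainData} {n : ℕ} (h : ∀ k < n, η.2 k = η'.2 k) :
    arrival η n = arrival η' n :=
  Finset.sum_congr rfl fun k hk => by rw [h k (Finset.mem_range.1 hk)]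

lemma arrival_succ (η : ChainData) (n : ℕ) : arrival η (n + 1) = arrival η n + (η.2 n).toReal :=
  Finset.sum_range_succ _ _

lemma monotone_arrival (η : ChainData) : Monotone (arrival η) :=
  monotone_nat_of_le_succ fun n => by
    rw [arrival_succ]; linarith [ENNReal.toReal_nonneg (a := η.2 n)]

lemma arrival_nonneg (η : ChainData) (n : ℕ) : 0 ≤ arrival η n :=
  Finset.sum_nonneg fun _ _ => ENNReal.toReal_nonneg

lemma jumpProb_poisson (i j : ℕ) :
    jumpProb (fun _ => 1) (fun _ => 0) i j = if j = i + 1 then 1 else 0 := by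
  simp [jumpProb]

section Poisson

variable {ν : Measure ChainData} [IsProbabilityMeasure ν]

lemma IsChainLaw.lintegral_poissonStep (hν : IsPoissonChainLaw ν) (n : ℕ)
    {f : ChainData → ℝ≥0∞ → ℝ≥0∞} (hf : Measurable fun p : ChainData × ℝ≥0∞ => f p.1 p.2)
    (hpre : ∀ ζ ζ' : ChainData, (∀ k < n, ζ.2 k = ζ'.2 k) → f ζ = f ζ') :
    ∫⁻ η, f η (η.2 n) ∂ν =
      ∫⁻ η, (∫⁻ x in Ioi (0 : ℝ), ENNReal.ofReal (Real.exp (-x)) * f η (ENNReal.ofReal x)) ∂ν := by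
  have h := IsChainLaw.lintegral_step hν n (f := fun ζ x _ => f ζ x) (fun _ => hf)
    (fun ζ ζ' _ h2 => by rw [hpre ζ ζ' h2])
  rw [h]
  refine lintegral_congr fun η => ?_
  rw [tsum_eq_single (η.1 n + 1) (fun j hj => by rw [jumpProb_poisson, if_neg hj]; simp),
    jumpProb_poisson, if_pos rfl, ENNReal.coe_one, one_mul]
  simp only [add_zero]
  rw [lintegral_expLaw one_ne_zero (F := f η) (hf.comp (measurable_const.prodMk measurable_id))]
  simp

lemma IsChainLaw.ae_poisson_hold_ne_top (hν : IsPoissonChainLaw ν) :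
    ∀ᵐ η ∂ν, ∀ n, η.2 n ≠ ⊤ := by
  refine ae_all_iff.2 fun n => IsChainLaw.ae_step hν n (p := fun _ x _ => x ≠ ⊤) (fun j => ?_)
    (fun _ _ _ _ => rfl) fun ζ j _ => ae_expLaw_ne_top (by simp)
  exact measurable_snd (measurableSet_singleton (⊤ : ℝ≥0∞)).compl

lemma IsChainLaw.ae_poisson_state (hν : IsPoissonChainLaw ν) :
    ∀ᵐ η ∂ν, ∀ n, η.1 n = n := by
  have h0 : ∀ᵐ η ∂ν, η.1 0 = 0 := by
    have h := hν.law 0 (fun _ => 0) (fun _ => 0)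
    simp only [Nat.le_zero_eq, forall_eq, Nat.not_lt_zero, false_implies, implies_true, and_true,
      Finset.range_zero, Finset.prod_empty, mul_one, Measure.dirac_apply, mem_singleton_iff,
      indicator_of_mem, Pi.one_apply] at h
    exact (prob_compl_eq_zero_iff (measurable_state 0 (measurableSet_singleton 0))).2 h
  have hs : ∀ᵐ η ∂ν, ∀ n, η.1 (n + 1) = η.1 n + 1 := by
    refine ae_all_iff.2 fun n => IsChainLaw.ae_step hν n (p := fun ζ _ j => j = ζ.1 n + 1)
      (fun j => ?_) (fun ζ ζ' h1 _ => by rw [h1 n le_rfl]) fun ζ j hj => ?_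
    · exact (((measurable_state n).add_const 1).comp measurable_fst)
        (MeasurableSet.of_discrete (s := {m : ℕ | j = m}))
    · refine Eventually.of_forall fun _ => ?_
      by_contra hne
      exact hj (by rw [jumpProb_poisson, if_neg hne])
  filter_upwards [h0, hs] with η h0 hs n
  induction n with
  | zero => exact h0
  | succ n ih => rw [hs, ih]

lemma IsChainLaw.ae_arrival_ne (hν : IsPoissonChainLaw ν) (s : ℝ) :
    ∀ᵐ η ∂ν, ∀ n, arrival η (n + 1) ≠ s := by
  refine ae_all_iff.2 fun n => ?_
  simp only [arrival_succ]
  refine IsChainLaw.ae_step hν n (p := fun ζ x _ => arrival ζ n + x.toReal ≠ s)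
    (fun j => ?_) (fun ζ ζ' _ h2 => by rw [arrival_congr h2]) fun ζ j hj => ?_
  · have hm : Measurable fun q : ChainData × ℝ≥0∞ => arrival q.1 n + q.2.toReal :=
      ((measurable_arrival n).comp measurable_fst).add measurable_snd.ennreal_toReal
    exact hm (measurableSet_singleton s).compl
  · filter_upwards [ae_expLaw_toReal_ne (q := 1 + 0) (by simp) (s - arrival ζ n)] with x hx h
    exact hx (by linarith)

/-- The expectation of e^{-T_n}, with T_n the n-th arrival, is 2^{-n}. So inf_n e^{-T_n} has
expectation 0, and the monotone sequence T_n is unbounded. -/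
lemma IsChainLaw.ae_tendsto_arrival (hν : IsPoissonChainLaw ν) :
    ∀ᵐ η ∂ν, Tendsto (arrival η) atTop atTop := by
  have hval : ∀ n, ∫⁻ η, ENNReal.ofReal (Real.exp (-arrival η n)) ∂ν = (1 / 2) ^ n := by
    intro n
    induction n with
    | zero => simp [arrival]
    | succ n ih =>
      simp only [arrival_succ]
      rw [IsChainLaw.lintegral_poissonStep hν n
        (f := fun ζ x => ENNReal.ofReal (Real.exp (-(arrival ζ n + x.toReal))))
        (by have := measurable_arrival_fst n; fun_prop) (fun ζ ζ' h => by rw [arrival_congr h]), pow_succ, ← ih,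
        ← lintegral_mul_const _ (by have := measurable_arrival n; fun_prop)]
      refine lintegral_congr fun η => ?_
      have e : ∀ x ∈ Ioi (0:ℝ), ENNReal.ofReal (Real.exp (-x)) *
          ENNReal.ofReal (Real.exp (-(arrival η n + (ENNReal.ofReal x).toReal))) =
          ENNReal.ofReal (Real.exp (-arrival η n)) * ENNReal.ofReal (Real.exp (-(2 * x))) := by
        intro x hx
        have hx' : 0 < x := hx
        rw [ENNReal.toReal_ofReal hx'.le, ← ENNReal.ofReal_mul (Real.exp_pos _).le,
          ← ENNReal.ofReal_mul (Real.exp_pos _).le, ← Real.exp_add, ← Real.exp_add]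
        ring_nf
      rw [setLIntegral_congr_fun measurableSet_Ioi e, lintegral_const_mul _ (by fun_prop),
        ← ofReal_integral_eq_lintegral_ofReal (integrableOn_exp_neg_mul_Ioi two_pos 0)
          (Eventually.of_forall fun _ => (Real.exp_pos _).le),
        integral_exp_neg_mul_Ioi two_pos]
      congr 1
      rw [mul_zero, neg_zero, Real.exp_zero, ENNReal.ofReal_div_of_pos two_pos]
      simp
  have hm : Measurable fun η => ⨅ n, ENNReal.ofReal (Real.exp (-arrival η n)) :=
    Measurable.iInf fun n => by have := measurable_arrival n; fun_prop
  have h0 : ∫⁻ η, ⨅ n, ENNReal.ofReal (Real.exp (-arrival η n)) ∂ν = 0 := by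
    have hle : ∀ n : ℕ, ∫⁻ η, ⨅ n, ENNReal.ofReal (Real.exp (-arrival η n)) ∂ν ≤ (1 / 2) ^ n :=
      fun n => (lintegral_mono fun η => iInf_le _ n).trans (hval n).le
    have hlim : Tendsto (fun n : ℕ => (1 / 2 : ℝ≥0∞) ^ n) atTop (𝓝 0) :=
      ENNReal.tendsto_pow_atTop_nhds_zero_of_lt_one (by
        rw [one_div]; exact ENNReal.inv_lt_one.2 ENNReal.one_lt_two)
    exact le_antisymm (ge_of_tendsto' hlim hle) zero_le
  rw [lintegral_eq_zero_iff hm] at h0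
  filter_upwards [h0] with η hη
  refine tendsto_atTop_atTop_of_monotone (monotone_arrival η) fun B => ?_
  have : ⨅ n, ENNReal.ofReal (Real.exp (-arrival η n)) < ENNReal.ofReal (Real.exp (-B)) := by
    rw [show (⨅ n, ENNReal.ofReal (Real.exp (-arrival η n))) = 0 from hη]
    exact ENNReal.ofReal_pos.2 (Real.exp_pos _)
  obtain ⟨n, hn⟩ := iInf_lt_iff.1 this
  rw [ENNReal.ofReal_lt_ofReal_iff (Real.exp_pos _), Real.exp_lt_exp] at hn
  exact ⟨n, by linarith⟩

/-- The generating functional of the Poisson process. -/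
theorem IsChainLaw.lintegral_poisson (hν : IsPoissonChainLaw ν) {g : ℝ → ℝ} (hg : Measurable g)
    (hg0 : ∀ x, 0 ≤ g x) (hg1 : ∀ x, g x ≤ 1) (hcount : {x | ¬ ContinuousAt g x}.Countable) {L : ℝ}
    (hL : ∀ x, L ≤ x → g x = 1) {Φ : ChainData → ℝ}
    (hΦ : ∀ᵐ η ∂ν, ∀ᶠ n in atTop, ∏ k ∈ Finset.range n, g (arrival η (k + 1)) = Φ η) :
    ∫⁻ η, ENNReal.ofReal (Φ η) ∂ν = ENNReal.ofReal (Real.exp (-missRate g L)) := by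
  have hG := (continuous_missRate hg hg0 hg1).measurable
  have hmono := monotone_missRate hg hg0 hg1
  let D : ChainData → ℕ → ℝ := fun η n => ∏ k ∈ Finset.range n, g (arrival η (k + 1))
  -- U u is the expected product of g over the arrivals after u, so `D η n * U (arrival η n)` has
  -- constant expectation. Beyond L there is no loss and U = 1.
  let U : ℝ → ℝ := fun u => Real.exp (missRate g u - missRate g L)
  have hU : Measurable U := by fun_prop
  have hD : ∀ n, Measurable fun η => D η n := fun n =>
    Finset.measurable_fun_prod _ fun k _ => hg.comp (measurable_arrival _)
  have hD0 : ∀ η n, 0 ≤ D η n := fun η n => Finset.prod_nonneg fun k _ => hg0 _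
  have hD1 : ∀ η n, D η n ≤ 1 := fun η n => Finset.prod_le_one (fun k _ => hg0 _) fun k _ => hg1 _
  have hU_L : ∀ y, L ≤ y → U y = 1 := by
    intro y h
    have := missRate_sub hg hg0 hg1 L y
    rw [intervalIntegral.integral_congr (g := fun _ => 0)] at this
    · simp only [intervalIntegral.integral_zero] at this
      simp [U, this]
    · intro x hx
      rw [uIcc_of_le h] at hx
      simp [hL x hx.1]
  have hU1 : ∀ y, U y ≤ 1 := by
    intro y
    rcases le_total y L with h | h
    · exact Real.exp_le_one_iff.2 (by linarith [hmono h])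
    · exact (hU_L y h).le
  have hstep : ∀ n, ∫⁻ η, ENNReal.ofReal (D η (n + 1) * U (arrival η (n + 1))) ∂ν =
      ∫⁻ η, ENNReal.ofReal (D η n * U (arrival η n)) ∂ν := by
    intro n
    have e : ∀ η, D η (n + 1) * U (arrival η (n + 1)) = D η n *
        (g (arrival η n + (η.2 n).toReal) * U (arrival η n + (η.2 n).toReal)) := fun η => by
      simp only [D, Finset.prod_range_succ, arrival_succ]; ring
    simp only [e]
    have hA := measurable_arrival_fst n
    have hDm : Measurable fun p : ChainData × ℝ≥0∞ => D p.1 n := (hD n).comp measurable_fst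
    rw [IsChainLaw.lintegral_poissonStep hν n (f := fun η x => ENNReal.ofReal (D η n *
        (g (arrival η n + x.toReal) * U (arrival η n + x.toReal)))) (by fun_prop) ?_]
    · refine lintegral_congr fun η => ?_
      have e2 : ∀ x ∈ Ioi (0:ℝ), ENNReal.ofReal (Real.exp (-x)) * ENNReal.ofReal (D η n *
          (g (arrival η n + (ENNReal.ofReal x).toReal) *
            U (arrival η n + (ENNReal.ofReal x).toReal))) =
          ENNReal.ofReal (D η n) * ENNReal.ofReal (Real.exp (-x) *
            (g (arrival η n + x) * U (arrival η n + x))) := by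
        intro x hx
        have hx' : 0 < x := hx
        rw [ENNReal.toReal_ofReal hx'.le, ← ENNReal.ofReal_mul (Real.exp_pos _).le,
          ← ENNReal.ofReal_mul (hD0 _ _)]
        ring_nf
      rw [setLIntegral_congr_fun measurableSet_Ioi e2, lintegral_const_mul _ (by fun_prop),
        ← ofReal_integral_eq_lintegral_ofReal, integral_poissonStep hg hg0 hg1 hcount hL,
        ← ENNReal.ofReal_mul (hD0 _ _)]
      · refine (integrableOn_exp_neg_Ioi 0).mono' (Measurable.aestronglyMeasurable (by fun_prop))
          (Eventually.of_forall fun x => ?_)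
        have h1 := mul_nonneg (hg0 (arrival η n + x)) (Real.exp_pos
          (missRate g (arrival η n + x) - missRate g L)).le
        rw [Real.norm_of_nonneg (mul_nonneg (Real.exp_pos _).le h1)]
        exact mul_le_of_le_one_right (Real.exp_pos _).le
          (mul_le_one₀ (hg1 _) (Real.exp_pos _).le (hU1 _))
      · exact Eventually.of_forall fun x =>
          mul_nonneg (Real.exp_pos _).le (mul_nonneg (hg0 _) (Real.exp_pos _).le)
    · intro ζ ζ' h
      have hDc : D ζ n = D ζ' n := Finset.prod_congr rfl fun k hk => by
        rw [arrival_congr fun m hm => h m (hm.trans_le (Finset.mem_range.1 hk))]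
      rw [hDc, arrival_congr h]
  have hconst : ∀ n, ∫⁻ η, ENNReal.ofReal (D η n * U (arrival η n)) ∂ν =
      ENNReal.ofReal (Real.exp (-missRate g L)) := by
    intro n
    induction n with
    | zero => simp [D, U, arrival, missRate]
    | succ n ih => rw [hstep, ih]
  have hlim := tendsto_lintegral_of_dominated_convergence (μ := ν) (fun _ => 1)
    (F := fun n η => ENNReal.ofReal (D η n * U (arrival η n)))
    (f := fun η => ENNReal.ofReal (Φ η))
    (fun n => by have := hD n; have := measurable_arrival n; fun_prop)
    (fun n => Eventually.of_forall fun η => ENNReal.ofReal_le_one.2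
      (mul_le_one₀ (hD1 _ _) (Real.exp_pos _).le (hU1 _)))
    (by simp) (by
      filter_upwards [hΦ, IsChainLaw.ae_tendsto_arrival hν] with η h1 h2
      refine tendsto_const_nhds.congr' ?_
      filter_upwards [h1, h2.eventually_ge_atTop L] with n hn1 hn2
      rw [hU_L _ hn2, mul_one]
      exact congrArg _ hn1.symm)
  simp only [hconst] at hlim
  exact tendsto_nhds_unique hlim tendsto_const_nhds

end Poisson

/-! ### The generating functional of the births and deaths -/

/-- The law of the jump chain and the holding times of the critical binary birth and death process
started from the Bernoulli(1/2) law. -/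
abbrev IsCriticalChainLaw (μ : Measure ChainData) : Prop :=
  IsChainLaw (fun j => (j : ℝ≥0)) (fun j => (j : ℝ≥0)) bernoulliHalf μ

lemma jumpProb_critical (i j : ℕ) :
    jumpProb (fun j => (j : ℝ≥0)) (fun j => (j : ℝ≥0)) i j =
      if i = 0 then (if j = 0 then 1 else 0) else if j = i + 1 ∨ j + 1 = i then 1 / 2 else 0 := by
  by_cases hi : i = 0
  · simp [jumpProb, hi]
  · have hi' : (i : ℝ≥0) ≠ 0 := by simpa using hi
    have h2 : (i : ℝ≥0) + i ≠ 0 := by simp [hi]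
    have h3 : (i : ℝ≥0) / (i + i) = 1 / 2 := by field_simp; norm_num
    simp only [jumpProb, if_neg hi, if_neg h2, h3]
    split_ifs <;> first | rfl | omega

lemma lintegral_bernoulliHalf (F : ℕ → ℝ≥0∞) :
    ∫⁻ i, F i ∂bernoulliHalf = F 1 / 2 + F 0 / 2 := by
  have h1 : unitInterval.toNNReal ⟨1 / 2, by norm_num, by norm_num⟩ = 1 / 2 := by
    ext; simp
  have h2 : unitInterval.toNNReal (unitInterval.symm ⟨1 / 2, by norm_num, by norm_num⟩) = 1 / 2 := by
    ext; simp; norm_num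
  rw [bernoulliHalf, bernoulliMeasure_def, lintegral_add_measure, lintegral_smul_measure,
    lintegral_smul_measure, lintegral_dirac, lintegral_dirac, h1, h2]
  simp [ENNReal.smul_def, ENNReal.div_eq_inv_mul]

/-- The product, over the first `n` jumps of the birth and death process, of `g` at the time of
the jump and of the probability that no mark is rejected in the preceding holding time, when a
mark at time `t` is rejected with probability `1 - g t`. -/
def birthDeathWeight (g : ℝ → ℝ) (ζ : ChainData) (n : ℕ) : ℝ :=
  ∏ k ∈ Finset.range n, if ζ.1 k = 0 then 1 else
    g (2 * arrival ζ (k + 1)) * Real.exp (-(ζ.1 k *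
      (missRate g (2 * arrival ζ (k + 1)) - missRate g (2 * arrival ζ k))))

lemma IsChainLaw.lintegral_initial {μ : Measure ChainData} {b d : ℕ → ℝ≥0} {μ₀ : Measure ℕ} (hμ : IsChainLaw b d μ₀ μ)
    (F : ℕ → ℝ≥0∞) : ∫⁻ ζ, F (ζ.1 0) ∂μ = ∫⁻ i, F i ∂μ₀ := by
  have hmap : μ.map (fun ζ => ζ.1 0) = μ₀ := by
    refine Measure.ext_of_singleton fun i => ?_
    rw [Measure.map_apply (measurable_state 0) (measurableSet_singleton i)]
    have h := hμ.law 0 (fun _ => i) (fun _ => 0)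
    simp only [Nat.le_zero_eq, forall_eq, Nat.not_lt_zero, false_implies, implies_true, and_true,
      Finset.range_zero, Finset.prod_empty, mul_one] at h
    exact h
  rw [← hmap, lintegral_map (measurable_of_countable F) (measurable_state 0)]

section Critical

variable {μ : Measure ChainData} [IsProbabilityMeasure μ]

lemma IsChainLaw.ae_critical (hμ : IsCriticalChainLaw μ) :
    ∀ᵐ ζ ∂μ, ∀ n, (ζ.1 n = 0 ∧ ζ.2 n = ⊤ ∧ ζ.1 (n + 1) = 0) ∨
      (ζ.1 n ≠ 0 ∧ ζ.2 n ≠ ⊤ ∧ (ζ.1 (n + 1) = ζ.1 n + 1 ∨ ζ.1 (n + 1) + 1 = ζ.1 n)) := by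
  refine ae_all_iff.2 fun n => IsChainLaw.ae_step hμ n
    (p := fun ζ x j => (ζ.1 n = 0 ∧ x = ⊤ ∧ j = 0) ∨
      (ζ.1 n ≠ 0 ∧ x ≠ ⊤ ∧ (j = ζ.1 n + 1 ∨ j + 1 = ζ.1 n)))
    (fun j => ?_) (fun ζ ζ' h1 _ => by rw [h1 n le_rfl]) fun ζ j hj => ?_
  · have hc : Measurable fun q : ChainData × ℝ≥0∞ => q.1.1 n := (measurable_state n).comp measurable_fst
    have hx : MeasurableSet {q : ChainData × ℝ≥0∞ | q.2 = ⊤} :=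
      measurable_snd (measurableSet_singleton (⊤ : ℝ≥0∞))
    refine MeasurableSet.union ?_ ?_
    · refine MeasurableSet.inter (hc (measurableSet_singleton 0)) (hx.inter (MeasurableSet.const _))
    · refine MeasurableSet.inter (hc (measurableSet_singleton 0)).compl (hx.compl.inter ?_)
      exact hc (MeasurableSet.of_discrete (s := {m : ℕ | j = m + 1 ∨ j + 1 = m}))
  · rw [jumpProb_critical] at hj
    by_cases hi : ζ.1 n = 0
    · simp only [hi, if_true, ite_ne_right_iff] at hj
      have : expLaw ((ζ.1 n : ℝ≥0) + (ζ.1 n : ℝ≥0)) = Measure.dirac ⊤ := by simp [expLaw, hi]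
      rw [this, ae_dirac_eq]
      exact Or.inl ⟨hi, rfl, hj.1⟩
    · simp only [hi, if_false, ite_ne_right_iff] at hj
      filter_upwards [ae_expLaw_ne_top (q := (ζ.1 n : ℝ≥0) + (ζ.1 n : ℝ≥0)) (by simp [hi])] with x hx
      exact Or.inr ⟨hi, hx, hj.1⟩

variable {g φ : ℝ → ℝ}

lemma birthDeathWeight_mem_Icc (hg : Measurable g) (hg0 : ∀ x, 0 ≤ g x) (hg1 : ∀ x, g x ≤ 1)
    (ζ : ChainData) (n : ℕ) : birthDeathWeight g ζ n ∈ Icc 0 1 := by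
  have hmono := monotone_missRate hg hg0 hg1
  have h : ∀ k, 0 ≤ (ζ.1 k : ℝ) *
      (missRate g (2 * arrival ζ (k + 1)) - missRate g (2 * arrival ζ k)) := fun k =>
    mul_nonneg (Nat.cast_nonneg _) (sub_nonneg.2 (hmono (by
      linarith [monotone_arrival ζ (Nat.le_succ k)])))
  refine ⟨Finset.prod_nonneg fun k _ => ?_, Finset.prod_le_one (fun k _ => ?_) fun k _ => ?_⟩
  · split_ifs
    exacts [zero_le_one, mul_nonneg (hg0 _) (Real.exp_pos _).le]
  · split_ifs
    exacts [zero_le_one, mul_nonneg (hg0 _) (Real.exp_pos _).le]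
  · split_ifs
    · exact le_rfl
    · exact mul_le_one₀ (hg1 _) (Real.exp_pos _).le
        (Real.exp_le_one_iff.2 (by linarith [h k]))

lemma birthDeathWeight_le_pow (hg : Measurable g) (hg0 : ∀ x, 0 ≤ g x) (hg1 : ∀ x, g x ≤ 1)
    {c : ℝ} (hgc : ∀ x, g x ≤ c) {ζ : ChainData} {n : ℕ} (hζ : ∀ k < n, ζ.1 k ≠ 0) :
    birthDeathWeight g ζ n ≤ c ^ n := by
  have hmono := monotone_missRate hg hg0 hg1
  rw [← Finset.card_range n, ← Finset.prod_const, Finset.card_range]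
  refine Finset.prod_le_prod (fun k hk => ?_) fun k hk => ?_
  · rw [if_neg (hζ k (Finset.mem_range.1 hk))]
    exact mul_nonneg (hg0 _) (Real.exp_pos _).le
  · rw [if_neg (hζ k (Finset.mem_range.1 hk))]
    refine (mul_le_of_le_one_right (hg0 _) ?_).trans (hgc _)
    refine Real.exp_le_one_iff.2 (neg_nonpos.2 ?_)
    exact mul_nonneg (Nat.cast_nonneg _) (sub_nonneg.2 (hmono (by
      linarith [monotone_arrival ζ (Nat.le_succ k)])))

lemma measurable_birthDeathWeight (hg : Measurable g) (hg0 : ∀ x, 0 ≤ g x) (hg1 : ∀ x, g x ≤ 1)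
    (n : ℕ) : Measurable fun ζ => birthDeathWeight g ζ n := by
  have hG := (continuous_missRate hg hg0 hg1).measurable
  refine Finset.measurable_fun_prod _ fun k _ => ?_
  have h1 := measurable_arrival k
  have h2 := measurable_arrival (k + 1)
  have h3 : Measurable fun ζ : ChainData => (ζ.1 k : ℝ) :=
    (measurable_of_countable (fun m : ℕ => (m : ℝ))).comp (measurable_state k)
  refine Measurable.ite (measurable_state k (measurableSet_singleton 0)) measurable_const ?_
  fun_prop

lemma birthDeathWeight_congr {ζ ζ' : ChainData} {n : ℕ} (h1 : ∀ k < n, ζ.1 k = ζ'.1 k)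
    (h2 : ∀ k < n, ζ.2 k = ζ'.2 k) : birthDeathWeight g ζ n = birthDeathWeight g ζ' n := by
  refine Finset.prod_congr rfl fun k hk => ?_
  have hk' := Finset.mem_range.1 hk
  rw [h1 k hk', arrival_congr (η' := ζ') fun m hm => h2 m (by omega),
    arrival_congr (η' := ζ') fun m hm => h2 m (by omega)]

/-- The power φ^i stands for the future of i independent individuals; `integral_birthDeathStep`
averages the next holding time and jump back to it. -/
lemma IsChainLaw.lintegral_birthDeath_succ (hμ : IsCriticalChainLaw μ) (hg : Measurable g)
    (hg0 : ∀ x, 0 ≤ g x) (hg1 : ∀ x, g x ≤ 1) (hcount : {x | ¬ ContinuousAt g x}.Countable)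
    (hφ : IsRiccatiSolution g φ) (n : ℕ) :
    ∫⁻ ζ, ENNReal.ofReal (birthDeathWeight g ζ (n + 1) *
        φ (2 * arrival ζ (n + 1)) ^ ζ.1 (n + 1)) ∂μ =
      ∫⁻ ζ, ENNReal.ofReal (birthDeathWeight g ζ n * φ (2 * arrival ζ n) ^ ζ.1 n) ∂μ := by
  have hG := (continuous_missRate hg hg0 hg1).measurable
  have hφm := hφ.continuous.measurable
  -- The weight of the first n + 1 jumps as a function of the n-th holding time s; the next state
  -- enters only as the exponent of φ.
  let H : ChainData → ℝ → ℝ := fun ζ s => birthDeathWeight g ζ n * (if ζ.1 n = 0 then 1 else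
    g (2 * arrival ζ n + 2 * s) * Real.exp (-(ζ.1 n *
      (missRate g (2 * arrival ζ n + 2 * s) - missRate g (2 * arrival ζ n)))))
  have hH : Measurable fun p : ChainData × ℝ => H p.1 p.2 := by
    have h1 : Measurable fun p : ChainData × ℝ => birthDeathWeight g p.1 n :=
      (measurable_birthDeathWeight hg hg0 hg1 n).comp measurable_fst
    have h2 : Measurable fun p : ChainData × ℝ => arrival p.1 n :=
      (measurable_arrival n).comp measurable_fst
    have h3 : Measurable fun p : ChainData × ℝ => (p.1.1 n : ℝ) :=
      (measurable_of_countable (fun m : ℕ => (m : ℝ))).comp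
        ((measurable_state n).comp measurable_fst)
    refine h1.mul (Measurable.ite (((measurable_state n).comp measurable_fst)
      (measurableSet_singleton 0)) measurable_const ?_)
    fun_prop
  have e : ∀ ζ : ChainData, birthDeathWeight g ζ (n + 1) *
      φ (2 * arrival ζ (n + 1)) ^ ζ.1 (n + 1) = H ζ (ζ.2 n).toReal *
        φ (2 * arrival ζ n + 2 * (ζ.2 n).toReal) ^ ζ.1 (n + 1) := by
    intro ζ
    simp only [H, birthDeathWeight, Finset.prod_range_succ, arrival_succ, mul_add]
  simp only [e]
  rw [IsChainLaw.lintegral_step hμ n (f := fun ζ x j => ENNReal.ofReal (H ζ x.toReal *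
    φ (2 * arrival ζ n + 2 * x.toReal) ^ j))]
  · refine lintegral_congr fun ζ => ?_
    have hb := birthDeathWeight_mem_Icc hg hg0 hg1 ζ n
    have ht : 0 ≤ 2 * arrival ζ n := by linarith [arrival_nonneg ζ n]
    by_cases hi : ζ.1 n = 0
    -- The chain stays in 0 and the exponent of φ is 0, so the infinite holding time, which `toReal`
    -- reads as 0, has no effect.
    · have h0 : expLaw ((ζ.1 n : ℝ≥0) + (ζ.1 n : ℝ≥0)) = Measure.dirac ⊤ := by simp [expLaw, hi]
      rw [tsum_eq_single 0 (fun j hj => by simp [jumpProb_critical, hi, hj]), h0, lintegral_dirac,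
        jumpProb_critical, if_pos hi, if_pos rfl]
      simp [H, hi]
    · set i := ζ.1 n with hi_def
      have hq : (i : ℝ≥0) + i ≠ 0 := by simp [hi]
      obtain ⟨m, hm⟩ := Nat.exists_eq_succ_of_ne_zero hi
      have hne : m ≠ i + 1 := by omega
      rw [tsum_eq_sum (s := {i + 1, m}) (fun j hj => by
        simp only [Finset.mem_insert, Finset.mem_singleton, not_or] at hj
        rw [jumpProb_critical, if_neg hi, if_neg (by omega)]; simp),
        Finset.sum_pair hne.symm, jumpProb_critical, jumpProb_critical, if_neg hi, if_neg hi,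
        if_pos (Or.inl rfl), if_pos (Or.inr (by omega)), ← mul_add]
      have hHm : ∀ j : ℕ, Measurable fun x : ℝ≥0∞ => ENNReal.ofReal (H ζ x.toReal *
          φ (2 * arrival ζ n + 2 * x.toReal) ^ j) := fun j => by
        have : Measurable fun s => H ζ s := hH.comp (measurable_const.prodMk measurable_id)
        fun_prop
      have hsum : Measurable fun x : ℝ≥0∞ => ENNReal.ofReal (H ζ x.toReal *
          φ (2 * arrival ζ n + 2 * x.toReal) ^ (i + 1)) + ENNReal.ofReal (H ζ x.toReal *
          φ (2 * arrival ζ n + 2 * x.toReal) ^ m) := (hHm _).add (hHm _)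
      rw [← lintegral_add_left (hHm _), ← lintegral_const_mul _ hsum,
        lintegral_expLaw hq (hsum.const_mul _)]
      have e2 : ∀ x ∈ Ioi (0:ℝ), ENNReal.ofReal (((i : ℝ≥0) + i : ℝ≥0) *
          Real.exp (-(((i : ℝ≥0) + i : ℝ≥0) * x))) * (((1 / 2 : ℝ≥0) : ℝ≥0∞) *
          (ENNReal.ofReal (H ζ (ENNReal.ofReal x).toReal *
            φ (2 * arrival ζ n + 2 * (ENNReal.ofReal x).toReal) ^ (i + 1)) +
          ENNReal.ofReal (H ζ (ENNReal.ofReal x).toReal *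
            φ (2 * arrival ζ n + 2 * (ENNReal.ofReal x).toReal) ^ m))) =
          ENNReal.ofReal (birthDeathWeight g ζ n) *
          ENNReal.ofReal ((2 * i) * Real.exp (-((2 * i) * x)) *
          (g (2 * arrival ζ n + 2 * x) * Real.exp (-(i * (missRate g (2 * arrival ζ n + 2 * x) -
            missRate g (2 * arrival ζ n)))) *
          (φ (2 * arrival ζ n + 2 * x) ^ (i + 1) / 2 +
            φ (2 * arrival ζ n + 2 * x) ^ (i - 1) / 2))) := by
        intro x hx
        have hx' : 0 < x := hx
        have hφ0 := hφ.nonneg (2 * arrival ζ n + 2 * x) (by linarith)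
        have hH0 : 0 ≤ H ζ x := by
          simp only [H]
          rw [if_neg (by rwa [← hi_def])]
          exact mul_nonneg hb.1 (mul_nonneg (hg0 _) (Real.exp_pos _).le)
        have h12 : ((1 / 2 : ℝ≥0) : ℝ≥0∞) = ENNReal.ofReal (1 / 2) := by
          rw [← ENNReal.ofReal_coe_nnreal]; norm_num
        rw [ENNReal.toReal_ofReal hx'.le, h12, ← ENNReal.ofReal_add (by positivity) (by positivity),
          ← ENNReal.ofReal_mul (by norm_num), ← ENNReal.ofReal_mul (by positivity),
          ← ENNReal.ofReal_mul hb.1]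
        congr 1
        simp only [H]
        rw [if_neg (by rwa [← hi_def]), ← hi_def, show i - 1 = m by omega]
        push_cast
        rw [← two_mul]
        ring
      refine (setLIntegral_congr_fun measurableSet_Ioi e2).trans ?_
      have hval := integral_birthDeathStep hg hg0 hg1 hcount hφ hi ht
      have hnn : ∀ x ∈ Ioi (0:ℝ), 0 ≤ (2 * i) * Real.exp (-((2 * i) * x)) *
          (g (2 * arrival ζ n + 2 * x) * Real.exp (-(i * (missRate g (2 * arrival ζ n + 2 * x) -
            missRate g (2 * arrival ζ n)))) *
          (φ (2 * arrival ζ n + 2 * x) ^ (i + 1) / 2 +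
            φ (2 * arrival ζ n + 2 * x) ^ (i - 1) / 2)) := by
        intro x hx
        have hx' : 0 < x := hx
        have hφ0 := hφ.nonneg (2 * arrival ζ n + 2 * x) (by linarith)
        have := hg0 (2 * arrival ζ n + 2 * x)
        positivity
      rw [lintegral_const_mul _ (by fun_prop), ← ofReal_integral_eq_lintegral_ofReal
        (integrableOn_birthDeathStep hg hg0 hg1 hφ ht)
        ((ae_restrict_mem measurableSet_Ioi).mono hnn), hval, ← ENNReal.ofReal_mul hb.1]
  · intro j
    have h2 := measurable_arrival_fst n
    have h3 : Measurable fun p : ChainData × ℝ≥0∞ => H p.1 p.2.toReal :=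
      hH.comp (measurable_fst.prodMk measurable_snd.ennreal_toReal)
    fun_prop
  · intro ζ ζ' h1 h2
    simp only [H, birthDeathWeight_congr (fun k hk => h1 k hk.le) h2, arrival_congr h2,
      h1 n le_rfl]

lemma IsChainLaw.lintegral_birthDeath_eq (hμ : IsCriticalChainLaw μ) (hg : Measurable g)
    (hg0 : ∀ x, 0 ≤ g x) (hg1 : ∀ x, g x ≤ 1) (hcount : {x | ¬ ContinuousAt g x}.Countable)
    (hφ : IsRiccatiSolution g φ) (n : ℕ) :
    ∫⁻ ζ, ENNReal.ofReal (birthDeathWeight g ζ n * φ (2 * arrival ζ n) ^ ζ.1 n) ∂μ =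
      ENNReal.ofReal (1 / 2 + φ 0 / 2) := by
  induction n with
  | zero =>
    simp only [birthDeathWeight, Finset.range_zero, Finset.prod_empty, one_mul, arrival,
      Finset.sum_empty, mul_zero]
    rw [hμ.lintegral_initial fun i => ENNReal.ofReal (φ 0 ^ i), lintegral_bernoulliHalf,
      pow_one, pow_zero, add_comm, ENNReal.ofReal_add (by norm_num)
      (div_nonneg (hφ.nonneg 0 le_rfl) (by norm_num)), ENNReal.ofReal_div_of_pos two_pos,
      ENNReal.ofReal_div_of_pos two_pos]
    simp
  | succ n ih => rw [hμ.lintegral_birthDeath_succ hg hg0 hg1 hcount hφ, ih]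

/-- For g = z the weight after n jumps is at most z^n unless the chain has hit 0. The constant
expectation 1/(1+√(1-z)) is thus at most P(extinction) + z^n; let n → ∞, then z ↑ 1. The Riccati
solution used is the one built from the explicit walk solution. -/
lemma IsChainLaw.ae_extinct (hμ : IsCriticalChainLaw μ) : ∀ᵐ ζ ∂μ, ∃ n, ζ.1 n = 0 := by
  have hset : MeasurableSet {ζ : ChainData | ∃ n, ζ.1 n = 0} := by
    simp only [Set.ofPred_exists]
    exact MeasurableSet.iUnion fun n => measurable_state n (measurableSet_singleton 0)
  have hle : ∀ z : ℝ, 0 < z → z < 1 →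
      ENNReal.ofReal (1 + √(1 - z))⁻¹ ≤ μ {ζ : ChainData | ∃ n, ζ.1 n = 0} := by
    intro z hz0 hz1
    have hs := Real.sqrt_nonneg (1 - z)
    have hcount : {x : ℝ | ¬ ContinuousAt (fun _ : ℝ => z) x}.Countable := by
      simp [continuousAt_const]
    have hM : ∀ x : ℝ, Real.exp (-(√(1 - z) * |x|)) / (1 + √(1 - z)) ≤ 1 := fun x => by
      refine div_le_one_of_le₀ ?_ (by positivity)
      have : Real.exp (-(√(1 - z) * |x|)) ≤ 1 := Real.exp_le_one_iff.2 (by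
        have := mul_nonneg hs (abs_nonneg x); linarith)
      linarith
    obtain ⟨φ, hφ, hw⟩ := exists_isRiccatiSolution (g := fun _ => z) measurable_const
      (fun _ => hz0.le) (fun _ => hz1.le) hcount
      (w := fun x => Real.exp (-(√(1 - z) * |x|)) / (1 + √(1 - z))) (by fun_prop)
      (fun x => by positivity) hM (isWalkSolution_const hz0.ne' hz1)
    simp only [abs_zero, mul_zero, neg_zero, Real.exp_zero, one_div] at hw
    have hbound : ∀ n : ℕ, ENNReal.ofReal (1 + √(1 - z))⁻¹ ≤
        μ {ζ : ChainData | ∃ n, ζ.1 n = 0} + ENNReal.ofReal (z ^ n) := by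
      intro n
      rw [hw, ← one_div, ← hμ.lintegral_birthDeath_eq measurable_const (fun _ => hz0.le)
        (fun _ => hz1.le) hcount hφ n]
      calc _ ≤ ∫⁻ ζ, ({ζ : ChainData | ∃ n, ζ.1 n = 0}.indicator 1 ζ + ENNReal.ofReal (z ^ n)) ∂μ := by
            refine lintegral_mono fun ζ => ?_
            have hb := birthDeathWeight_mem_Icc (g := fun _ => z) measurable_const
              (fun _ => hz0.le) (fun _ => hz1.le) ζ n
            have ht : 0 ≤ 2 * arrival ζ n := by linarith [arrival_nonneg ζ n]
            have h1 : φ (2 * arrival ζ n) ^ ζ.1 n ≤ 1 :=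
              pow_le_one₀ (hφ.nonneg _ ht) (hφ.le_one _ ht)
            have h2 := mul_le_of_le_one_right hb.1 h1
            by_cases h : ∃ n, ζ.1 n = 0
            · rw [indicator_of_mem (show ζ ∈ {ζ : ChainData | ∃ n, ζ.1 n = 0} from h)]
              exact le_add_right (ENNReal.ofReal_le_one.2 (h2.trans hb.2))
            · refine le_add_left (ENNReal.ofReal_le_ofReal (h2.trans ?_))
              push Not at h
              exact birthDeathWeight_le_pow measurable_const (fun _ => hz0.le)
                (fun _ => hz1.le) (fun _ => le_rfl) fun k _ => h k
        _ = _ := by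
            rw [lintegral_add_right _ measurable_const, lintegral_indicator_one hset,
              lintegral_const, measure_univ, mul_one]
    have hlim : Tendsto (fun n : ℕ => μ {ζ : ChainData | ∃ n, ζ.1 n = 0} + ENNReal.ofReal (z ^ n))
        atTop (𝓝 (μ {ζ : ChainData | ∃ n, ζ.1 n = 0} + ENNReal.ofReal 0)) :=
      tendsto_const_nhds.add ((ENNReal.continuous_ofReal.tendsto 0).comp
        (tendsto_pow_atTop_nhds_zero_of_lt_one hz0.le hz1))
    simpa using ge_of_tendsto' hlim hbound
  have h1 : 1 ≤ μ {ζ : ChainData | ∃ n, ζ.1 n = 0} := by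
    have hlim : Tendsto (fun z : ℝ => ENNReal.ofReal (1 + √(1 - z))⁻¹) (𝓝[<] 1)
        (𝓝 (ENNReal.ofReal 1)) :=
      (ENNReal.continuous_ofReal.tendsto 1).comp tendsto_inv_one_add_sqrt
    rw [ENNReal.ofReal_one] at hlim
    refine le_of_tendsto hlim ?_
    filter_upwards [Ioo_mem_nhdsLT (zero_lt_one (α := ℝ))] with z hz
    exact hle z hz.1 hz.2
  exact (prob_compl_eq_zero_iff hset).2 (le_antisymm prob_le_one h1)

/-- The generating functional of the births, deaths and marks, given that of the marks. -/
theorem IsChainLaw.lintegral_birthDeath (hμ : IsCriticalChainLaw μ) (hg : Measurable g)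
    (hg0 : ∀ x, 0 ≤ g x) (hg1 : ∀ x, g x ≤ 1) (hcount : {x | ¬ ContinuousAt g x}.Countable)
    (hφ : IsRiccatiSolution g φ) {Φ : ChainData → ℝ}
    (hΦ : ∀ᵐ ζ ∂μ, ∀ᶠ n in atTop, birthDeathWeight g ζ n = Φ ζ) :
    ∫⁻ ζ, ENNReal.ofReal (Φ ζ) ∂μ = ENNReal.ofReal (1 / 2 + φ 0 / 2) := by
  have hφm := hφ.continuous.measurable
  have hlim := tendsto_lintegral_of_dominated_convergence (μ := μ) (fun _ => 1)
    (F := fun n ζ => ENNReal.ofReal (birthDeathWeight g ζ n * φ (2 * arrival ζ n) ^ ζ.1 n))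
    (f := fun ζ => ENNReal.ofReal (Φ ζ))
    (fun n => by
      have h1 := measurable_birthDeathWeight hg hg0 hg1 n
      have h2 := measurable_arrival n
      have h3 := measurable_state n
      exact (h1.mul ((hφm.comp (h2.const_mul 2)).pow h3)).ennreal_ofReal)
    (fun n => Eventually.of_forall fun ζ => ENNReal.ofReal_le_one.2 (by
      have hb := birthDeathWeight_mem_Icc hg hg0 hg1 ζ n
      have ht : 0 ≤ 2 * arrival ζ n := by linarith [arrival_nonneg ζ n]
      exact mul_le_one₀ hb.2 (pow_nonneg (hφ.nonneg _ ht) _)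
        (pow_le_one₀ (hφ.nonneg _ ht) (hφ.le_one _ ht))))
    (by simp) (by
      filter_upwards [hΦ, hμ.ae_extinct, hμ.ae_critical] with ζ h1 ⟨m, hm⟩ h3
      have hzero : ∀ n, m ≤ n → ζ.1 n = 0 := by
        intro n hn
        induction n, hn using Nat.le_induction with
        | base => exact hm
        | succ n _ ih =>
          rcases h3 n with h | h
          · exact h.2.2
          · exact absurd ih h.1
      refine tendsto_const_nhds.congr' ?_
      filter_upwards [h1, eventually_ge_atTop m] with n hn1 hn2
      rw [hzero n hn2, pow_zero, mul_one, hn1])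
  simp only [hμ.lintegral_birthDeath_eq hg hg0 hg1 hcount hφ] at hlim
  exact tendsto_nhds_unique hlim tendsto_const_nhds

end Critical

/-! ### The births, deaths and marks along fixed paths -/

lemma leftLim_eq_of_eqOn {f : ℝ≥0 → ℤ} {u s : ℝ≥0} {v : ℤ} (hus : u < s)
    (h : ∀ r, u < r → r < s → f r = v) : Function.leftLim f s = v := by
  have : (𝓝[<] s).NeBot := nhdsLT_neBot_of_exists_lt ⟨u, hus⟩
  refine leftLim_eq_of_tendsto (tendsto_const_nhds.congr' ?_)
  filter_upwards [Ioo_mem_nhdsLT hus] with r hr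
  exact (h r hr.1 hr.2).symm

/-- The data of a path. -/
abbrev dataOf (x : ℝ≥0 → ℕ) : ChainData := (jumpChain x, holdTime x)

/-- The path `z` is absorbed at `0` by its `m`-th jump, and its jumps before are `±1`. -/
structure IsExtinctPath (z : ℝ≥0 → ℕ) (m : ℕ) : Prop where
  rightCont : IsRightCont z
  ne_zero : ∀ k < m, jumpChain z k ≠ 0
  hold_ne_top : ∀ k < m, holdTime z k ≠ ⊤
  step : ∀ k < m, jumpChain z (k + 1) = jumpChain z k + 1 ∨ jumpChain z (k + 1) + 1 = jumpChain z k
  eq_zero : jumpChain z m = 0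
  hold_eq_top : holdTime z m = ⊤

lemma jumpTime_eq_ofReal {x : ℝ≥0 → ℕ} {m : ℕ} (h : ∀ k < m, holdTime x k ≠ ⊤) :
    ∀ k ≤ m, jumpTime x k = ENNReal.ofReal (arrival (dataOf x) k) := by
  intro k hk
  rw [jumpTime_eq_sum_holdTime, arrival, ENNReal.ofReal_sum_of_nonneg
    fun _ _ => ENNReal.toReal_nonneg]
  refine Finset.sum_congr rfl fun i hi => ?_
  rw [ENNReal.ofReal_toReal (h i ((Finset.mem_range.1 hi).trans_le hk))]

lemma arrival_lt_succ {x : ℝ≥0 → ℕ} (hx : IsRightCont x) {k : ℕ} (h : holdTime x k ≠ ⊤) :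
    arrival (dataOf x) k < arrival (dataOf x) (k + 1) := by
  rw [arrival_succ]
  have := ENNReal.toReal_pos (holdTime_pos hx k).ne' h
  simpa using this

lemma exists_arrival_le_lt {a : ℕ → ℝ} (h0 : a 0 = 0) {s : ℝ} (hs : 0 ≤ s) {m : ℕ} (hm : s < a m) :
    ∃ k < m, a k ≤ s ∧ s < a (k + 1) := by
  classical
  have hex : ∃ k, s < a k := ⟨m, hm⟩
  have hf := Nat.find_spec hex
  have hle : Nat.find hex ≤ m := Nat.find_min' hex hm
  obtain ⟨k, hk⟩ := Nat.exists_eq_succ_of_ne_zero (n := Nat.find hex) (fun h => by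
    rw [h, h0] at hf; linarith)
  refine ⟨k, by omega, not_lt.1 (Nat.find_min hex (by omega)), ?_⟩
  rw [hk] at hf
  exact hf

namespace IsExtinctPath

variable {z : ℝ≥0 → ℕ} {m : ℕ}

lemma jumpTime_eq (hz : IsExtinctPath z m) {k : ℕ} (hk : k ≤ m) :
    jumpTime z k = ENNReal.ofReal (arrival (dataOf z) k) :=
  jumpTime_eq_ofReal hz.hold_ne_top k hk

lemma path_eq (hz : IsExtinctPath z m) {k : ℕ} (hk : k < m) {s : ℝ≥0} (h1 : arrival (dataOf z) k ≤ s)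
    (h2 : s < arrival (dataOf z) (k + 1)) : z s = jumpChain z k := by
  refine path_eq_jumpChain ?_ ?_
  · rw [hz.jumpTime_eq hk.le, ← ENNReal.ofReal_coe_nnreal]
    exact ENNReal.ofReal_le_ofReal h1
  · rw [hz.jumpTime_eq hk, ← ENNReal.ofReal_coe_nnreal]
    exact (ENNReal.ofReal_lt_ofReal_iff (s.coe_nonneg.trans_lt h2)).2 h2

lemma path_eq_zero (hz : IsExtinctPath z m) {s : ℝ≥0} (h1 : arrival (dataOf z) m ≤ s) : z s = 0 := by
  rw [← hz.eq_zero]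
  refine path_eq_jumpChain ?_ ?_
  · rw [hz.jumpTime_eq le_rfl, ← ENNReal.ofReal_coe_nnreal]
    exact ENNReal.ofReal_le_ofReal h1
  · rw [jumpTime_eq_sum_holdTime, Finset.sum_range_succ, hz.hold_eq_top, add_top]
    exact ENNReal.coe_lt_top

lemma path_cases (s : ℝ≥0) : (∃ k < m, arrival (dataOf z) k ≤ s ∧ s < arrival (dataOf z) (k + 1)) ∨
    arrival (dataOf z) m ≤ s := by
  rcases lt_or_ge (s : ℝ) (arrival (dataOf z) m) with h | h
  · exact Or.inl (exists_arrival_le_lt (by simp [arrival]) s.coe_nonneg h)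
  · exact Or.inr h

lemma strictMono_arrival (hz : IsExtinctPath z m) {j k : ℕ} (hjk : j < k) (hk : k ≤ m) :
    arrival (dataOf z) j < arrival (dataOf z) k :=
  (arrival_lt_succ hz.rightCont (hz.hold_ne_top j (by omega))).trans_le (monotone_arrival _ hjk)

/-- The left limit at a jump is the previous state of the chain and the steps are ±1; elsewhere the
path is constant near s on the left. -/
lemma jump_iff (hz : IsExtinctPath z m) {s : ℝ≥0} (hs : 0 < s) :
    ((z s : ℤ) - Function.leftLim (fun s => (z s : ℤ)) s = 1 ∨
      (z s : ℤ) - Function.leftLim (fun s => (z s : ℤ)) s = -1) ↔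
      ∃ k < m, (s : ℝ) = arrival (dataOf z) (k + 1) := by
  have hs' : (0 : ℝ) < s := hs
  have ha0 : arrival (dataOf z) 0 = 0 := by simp [arrival]
  have hinner : ∀ u : ℝ, 0 ≤ u → u < s → ∀ v : ℕ, (∀ r : ℝ≥0, u < r → r < s → z r = v) →
      Function.leftLim (fun s => (z s : ℤ)) s = v := by
    intro u hu hus v hv
    lift u to ℝ≥0 using hu
    refine leftLim_eq_of_eqOn (u := u) (by exact_mod_cast hus) fun r h1 h2 => ?_
    rw [hv r (by exact_mod_cast h1) h2]
  by_cases hex : ∃ k < m, (s : ℝ) = arrival (dataOf z) (k + 1)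
  · refine iff_of_true ?_ hex
    obtain ⟨k, hk, hsk⟩ := hex
    have hleft := hinner (arrival (dataOf z) k) (arrival_nonneg _ _)
      (by rw [hsk]; exact hz.strictMono_arrival (Nat.lt_succ_self k) hk) (jumpChain z k)
      fun r h1 h2 => hz.path_eq hk h1.le (by rw [← hsk]; exact_mod_cast h2)
    have hval : z s = jumpChain z (k + 1) := by
      rcases Nat.lt_or_ge (k + 1) m with h | h
      · exact hz.path_eq h hsk.ge (by rw [hsk]; exact hz.strictMono_arrival (Nat.lt_succ_self _) h)
      · obtain rfl : k + 1 = m := by omega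
        rw [hz.eq_zero]; exact hz.path_eq_zero hsk.ge
    rw [hleft, hval]
    rcases hz.step k hk with h | h
    · left; rw [h]; push_cast; ring
    · right; rw [← h]; push_cast; ring
  · refine iff_of_false ?_ hex
    push Not at hex
    have h0 : (z s : ℤ) - Function.leftLim (fun s => (z s : ℤ)) s = 0 := by
      rcases path_cases (z := z) (m := m) s with ⟨k, hk, h1, h2⟩ | h1
      · have hlt : arrival (dataOf z) k < s := by
          rcases k with - | k
          · rw [ha0]; exact hs'
          · exact lt_of_le_of_ne h1 fun h => hex k (by omega) h.symm
        rw [hinner _ (arrival_nonneg _ _) hlt (jumpChain z k) fun r h3 h4 =>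
          hz.path_eq hk h3.le (lt_trans (by exact_mod_cast h4) h2), hz.path_eq hk h1 h2, sub_self]
      · have hlt : arrival (dataOf z) m < s := by
          rcases m with - | m
          · rw [ha0]; exact hs'
          · exact lt_of_le_of_ne h1 fun h => hex m (by omega) h.symm
        rw [hinner _ (arrival_nonneg _ _) hlt 0 fun r h3 h4 => hz.path_eq_zero h3.le,
          hz.path_eq_zero h1]
        simp
    rw [h0]
    simp

end IsExtinctPath

/-! ### The clock of the marks along a fixed path -/

/-- The truncation of `x` at the level `o`. -/
def cut (o : ℝ≥0∞) (x : ℝ) : ℝ := (min o (ENNReal.ofReal x)).toReal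

/-- The integral `∫₀ᵒ Z(v/2) dv`, computed from the first `n` holding times. -/
def markClock (ζ : ChainData) (n : ℕ) (o : ℝ≥0∞) : ℝ :=
  ∑ k ∈ Finset.range n, ζ.1 k * (cut o (2 * arrival ζ (k + 1)) - cut o (2 * arrival ζ k))

lemma cut_coe (t : ℝ≥0) {x : ℝ} (hx : 0 ≤ x) : cut t x = min (t : ℝ) x := by
  rw [cut, ENNReal.toReal_min ENNReal.coe_ne_top ENNReal.ofReal_ne_top, ENNReal.toReal_ofReal hx,
    ENNReal.coe_toReal]

lemma cut_top {x : ℝ} (hx : 0 ≤ x) : cut ⊤ x = x := by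
  rw [cut, min_eq_right le_top, ENNReal.toReal_ofReal hx]

lemma cut_mono (o : ℝ≥0∞) {x y : ℝ} (hxy : x ≤ y) : cut o x ≤ cut o y :=
  ENNReal.toReal_mono (ne_top_of_le_ne_top ENNReal.ofReal_ne_top (min_le_right _ _))
    (min_le_min_left _ (ENNReal.ofReal_le_ofReal hxy))

lemma markClock_congr {ζ : ChainData} {n : ℕ} {o o' : ℝ≥0∞}
    (h : ∀ k ≤ n, cut o (2 * arrival ζ k) = cut o' (2 * arrival ζ k)) :
    markClock ζ n o = markClock ζ n o' := by
  refine Finset.sum_congr rfl fun k hk => ?_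
  have := Finset.mem_range.1 hk
  rw [h k (by omega), h (k + 1) (by omega)]

/-- The difference is the length of [x, y] ∩ [0, o]. -/
lemma cut_sub_mono {o o' : ℝ≥0∞} (hoo : o ≤ o') {x y : ℝ} (hx : 0 ≤ x) (hxy : x ≤ y) :
    cut o y - cut o x ≤ cut o' y - cut o' x := by
  have hy := hx.trans hxy
  induction o' with
  | top =>
    rw [cut_top hx, cut_top hy]
    induction o with
    | top => rw [cut_top hx, cut_top hy]
    | coe o =>
      rw [cut_coe o hx, cut_coe o hy]
      rcases le_total (o : ℝ) x with h | h
      · rw [min_eq_left h, min_eq_left (h.trans hxy)]; linarith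
      · rw [min_eq_right h]; linarith [min_le_right (o : ℝ) y]
  | coe o' =>
    induction o with
    | top => simp at hoo
    | coe o =>
      have hoo' : (o : ℝ) ≤ o' := by exact_mod_cast hoo
      rw [cut_coe o hx, cut_coe o hy, cut_coe o' hx, cut_coe o' hy]
      rcases le_total (o : ℝ) x with h | h
      · rw [min_eq_left h, min_eq_left (h.trans hxy)]
        linarith [min_le_min_left (o' : ℝ) hxy]
      · rw [min_eq_right h, min_eq_right (h.trans hoo')]
        linarith [min_le_min_right y hoo']

lemma markClock_mono (ζ : ChainData) (n : ℕ) : Monotone (markClock ζ n) := fun o o' hoo => by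
  refine Finset.sum_le_sum fun k _ => mul_le_mul_of_nonneg_left ?_ (Nat.cast_nonneg _)
  exact cut_sub_mono hoo (by linarith [arrival_nonneg ζ k])
    (by linarith [monotone_arrival ζ (Nat.le_succ k)])

/-- Before extinction the clock runs at speed at least 1, so it advances at least as much as time
itself. -/
lemma markClock_sub_ge {ζ : ChainData} {n : ℕ} (h1 : ∀ k < n, ζ.1 k ≠ 0) {o o' : ℝ≥0∞}
    (hoo : o ≤ o') : cut o' (2 * arrival ζ n) - cut o (2 * arrival ζ n) ≤
      markClock ζ n o' - markClock ζ n o := by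
  have e : ∀ p : ℝ≥0∞, cut p (2 * arrival ζ n) = ∑ k ∈ Finset.range n,
      (cut p (2 * arrival ζ (k + 1)) - cut p (2 * arrival ζ k)) := fun p => by
    rw [Finset.sum_range_sub (fun k => cut p (2 * arrival ζ k))]
    simp [cut, arrival]
  rw [e, e, markClock, markClock, ← Finset.sum_sub_distrib, ← Finset.sum_sub_distrib]
  refine Finset.sum_le_sum fun k hk => ?_
  rw [← mul_sub]
  refine le_mul_of_one_le_left ?_ ?_
  · exact sub_nonneg.2 (cut_sub_mono hoo (by linarith [arrival_nonneg ζ k])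
      (by linarith [monotone_arrival ζ (Nat.le_succ k)]))
  · exact_mod_cast Nat.one_le_iff_ne_zero.2 (h1 k (Finset.mem_range.1 hk))

lemma markClock_lt {ζ : ChainData} {n : ℕ} (h1 : ∀ k < n, ζ.1 k ≠ 0) {s : ℝ≥0} {o : ℝ≥0∞}
    (hs : (s : ℝ) < 2 * arrival ζ n) (hso : s < o) : markClock ζ n s < markClock ζ n o := by
  have h := markClock_sub_ge h1 hso.le
  have ha : 0 ≤ 2 * arrival ζ n := by linarith [arrival_nonneg ζ n]
  have : cut s (2 * arrival ζ n) < cut o (2 * arrival ζ n) := by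
    rw [cut_coe s ha, min_eq_left hs.le]
    induction o with
    | top => rwa [cut_top ha]
    | coe o => rw [cut_coe o ha]; exact lt_min (by exact_mod_cast hso) hs
  linarith

lemma markClock_nonneg (ζ : ChainData) (n : ℕ) (o : ℝ≥0∞) : 0 ≤ markClock ζ n o :=
  Finset.sum_nonneg fun k _ => mul_nonneg (Nat.cast_nonneg _) (sub_nonneg.2
    (cut_mono o (by linarith [monotone_arrival ζ (Nat.le_succ k)])))

lemma continuous_markClock (ζ : ChainData) (n : ℕ) :
    Continuous fun t : ℝ≥0 => markClock ζ n t := by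
  have : (fun t : ℝ≥0 => markClock ζ n t) = fun t : ℝ≥0 => ∑ k ∈ Finset.range n,
      (ζ.1 k : ℝ) * (min (t : ℝ) (2 * arrival ζ (k + 1)) - min (t : ℝ) (2 * arrival ζ k)) := by
    ext t
    refine Finset.sum_congr rfl fun k _ => ?_
    rw [cut_coe t (by linarith [arrival_nonneg ζ (k + 1)]), cut_coe t (by linarith [arrival_nonneg ζ k])]
  rw [this]
  fun_prop

lemma markClock_of_ge {ζ : ChainData} {n : ℕ} {t : ℝ≥0} (ht : 2 * arrival ζ n ≤ t) :
    markClock ζ n t = markClock ζ n ⊤ := by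
  refine markClock_congr fun k hk => ?_
  have hk0 := arrival_nonneg ζ k
  rw [cut_top (by linarith), cut_coe t (by linarith), min_eq_right]
  linarith [monotone_arrival ζ hk]

/-- On (0, t] the integrand is the sum of the states times the indicators of the doubled holding
intervals. -/
lemma IsExtinctPath.integral_eq {z : ℝ≥0 → ℕ} {m : ℕ} (hz : IsExtinctPath z m) (t : ℝ≥0) :
    ∫ v in (0 : ℝ)..t, (z (v.toNNReal / 2) : ℝ) = markClock (dataOf z) m t := by
  have ha := arrival_nonneg (dataOf z)
  have hmono := monotone_arrival (dataOf z)
  have hpt : ∀ v ∈ Ioc (0 : ℝ) t, (z (v.toNNReal / 2) : ℝ) = ∑ k ∈ Finset.range m,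
      (Ico (2 * arrival (dataOf z) k) (2 * arrival (dataOf z) (k + 1))).indicator
        (fun _ => (jumpChain z k : ℝ)) v := by
    intro v hv
    have hv2 : ((v.toNNReal / 2 : ℝ≥0) : ℝ) = v / 2 := by
      push_cast; rw [Real.coe_toNNReal _ hv.1.le]
    rcases IsExtinctPath.path_cases (z := z) (m := m) (v.toNNReal / 2) with ⟨k, hk, h1, h2⟩ | h1
    · rw [hz.path_eq hk h1 h2]
      rw [hv2] at h1 h2
      rw [Finset.sum_eq_single k, indicator_of_mem (show v ∈ Ico _ _ from ⟨by linarith, by linarith⟩)]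
      · intro j _ hjk
        refine indicator_of_notMem (fun hj => ?_) _
        rcases lt_or_gt_of_ne hjk with h | h
        · have := hmono (Nat.succ_le_of_lt h)
          simp only [Nat.succ_eq_add_one] at this
          linarith [hj.2]
        · have := hmono (Nat.succ_le_of_lt h)
          simp only [Nat.succ_eq_add_one] at this
          linarith [hj.1]
      · intro h; exact absurd (Finset.mem_range.2 hk) h
    · rw [hz.path_eq_zero h1, Finset.sum_eq_zero]
      · simp
      · intro j hj
        refine indicator_of_notMem (fun hj' => ?_) _
        rw [hv2] at h1
        have := hmono (Nat.succ_le_of_lt (Finset.mem_range.1 hj))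
        simp only [Nat.succ_eq_add_one] at this
        linarith [hj'.2]
  rw [intervalIntegral.integral_of_le t.coe_nonneg, setIntegral_congr_fun measurableSet_Ioc hpt,
    integral_finsetSum]
  · refine Finset.sum_congr rfl fun k _ => ?_
    rw [setIntegral_indicator measurableSet_Ico, setIntegral_const, smul_eq_mul, mul_comm]
    congr 1
    have hae : (Ioc (0 : ℝ) t ∩ Ico (2 * arrival (dataOf z) k) (2 * arrival (dataOf z) (k + 1)) :
        Set ℝ) =ᵐ[volume] (Ico (0 : ℝ) t ∩
          Ico (2 * arrival (dataOf z) k) (2 * arrival (dataOf z) (k + 1)) : Set ℝ) :=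
      Ico_ae_eq_Ioc.symm.inter (ae_eq_refl _)
    rw [cut_coe t (by linarith [ha (k + 1)]), cut_coe t (by linarith [ha k]), measureReal_def,
      measure_congr hae, Ico_inter_Ico,
      Real.volume_Ico, max_eq_right (by linarith [ha k])]
    have h1 := hmono (Nat.le_succ k)
    simp only [Nat.succ_eq_add_one] at h1
    rcases le_total (t : ℝ) (2 * arrival (dataOf z) k) with h | h
    · rw [min_eq_left h, min_eq_left (by linarith), ENNReal.ofReal_of_nonpos (by linarith)]
      simp
    · rw [min_eq_right h, ENNReal.toReal_ofReal]
      have := le_min h (show 2 * arrival (dataOf z) k ≤ 2 * arrival (dataOf z) (k + 1) by linarith)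
      linarith
  · intro k _
    exact (integrable_const _).indicator measurableSet_Ico

/-- The path `p` jumps by `+1`, infinitely often, and its jump times tend to `∞`. -/
structure IsCountingPath (p : ℝ≥0 → ℕ) : Prop where
  rightCont : IsRightCont p
  state : ∀ n, jumpChain p n = n
  hold_ne_top : ∀ n, holdTime p n ≠ ⊤
  tendsto : Tendsto (arrival (dataOf p)) atTop atTop

namespace IsCountingPath

variable {p : ℝ≥0 → ℕ}

lemma path_eq (hp : IsCountingPath p) {k : ℕ} {s : ℝ} (h1 : arrival (dataOf p) k ≤ s)
    (h2 : s < arrival (dataOf p) (k + 1)) : p s.toNNReal = k := by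
  have h0 := (arrival_nonneg (dataOf p) k).trans h1
  have hj : ∀ n, jumpTime p n = ENNReal.ofReal (arrival (dataOf p) n) := fun n =>
    jumpTime_eq_ofReal (m := n) (fun k _ => hp.hold_ne_top k) n le_rfl
  rw [← hp.state k]
  refine path_eq_jumpChain ?_ ?_
  · rw [hj]
    exact ENNReal.ofReal_le_ofReal h1
  · rw [hj]
    exact (ENNReal.ofReal_lt_ofReal_iff (h0.trans_lt h2)).2 h2

lemma strictMono_arrival (hp : IsCountingPath p) : StrictMono (arrival (dataOf p)) :=
  strictMono_nat_of_lt_succ fun k => arrival_lt_succ hp.rightCont (hp.hold_ne_top k)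

lemma exists_between (hp : IsCountingPath p) {s : ℝ} (hs : 0 ≤ s) :
    ∃ k, arrival (dataOf p) k ≤ s ∧ s < arrival (dataOf p) (k + 1) := by
  obtain ⟨m, hm⟩ := (hp.tendsto.eventually_gt_atTop s).exists
  obtain ⟨k, -, hk⟩ := exists_arrival_le_lt (by simp [arrival]) hs hm
  exact ⟨k, hk⟩

end IsCountingPath

lemma leftLim_eq_of_eventually {f : ℝ≥0 → ℤ} {s : ℝ≥0} {v : ℤ} (hs : 0 < s)
    (h : ∀ᶠ r in 𝓝[<] s, f r = v) : Function.leftLim f s = v := by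
  have : (𝓝[<] s).NeBot := nhdsLT_neBot_of_exists_lt ⟨0, hs⟩
  exact leftLim_eq_of_tendsto (tendsto_const_nhds.congr' (h.mono fun _ h => h.symm))

variable {z p : ℝ≥0 → ℕ} {m : ℕ}

lemma markClock_zero (ζ : ChainData) (n : ℕ) : markClock ζ n 0 = 0 := by
  simp [markClock, cut]

lemma markClock_arrival (ζ : ChainData) (n : ℕ) :
    markClock ζ n (ENNReal.ofReal (2 * arrival ζ n)) = markClock ζ n ⊤ := by
  have h : 0 ≤ 2 * arrival ζ n := by linarith [arrival_nonneg ζ n]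
  refine markClock_of_ge (t := (2 * arrival ζ n).toNNReal) ?_
  rw [Real.coe_toNNReal _ h]

lemma marks_eq (hz : IsExtinctPath z m) (hp : IsCountingPath p) {t : ℝ≥0} {k : ℕ}
    (h1 : arrival (dataOf p) k ≤ markClock (dataOf z) m t)
    (h2 : markClock (dataOf z) m t < arrival (dataOf p) (k + 1)) : marks z p t = k := by
  rw [marks, hz.integral_eq]
  exact hp.path_eq h1 h2

/-- A clock value below the terminal one occurs only before extinction, where the clock is strictly
increasing. -/
lemma markClock_lt_of_lt_top (hz : IsExtinctPath z m) {r : ℝ≥0} {o : ℝ≥0∞}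
    (h : markClock (dataOf z) m r < markClock (dataOf z) m ⊤) (hro : r < o) :
    markClock (dataOf z) m r < markClock (dataOf z) m o := by
  refine markClock_lt hz.ne_zero ?_ hro
  by_contra hc
  exact h.ne (markClock_of_ge (not_lt.1 hc))

/-- The clock is continuous and increases strictly up to extinction, so marks are the times when it
reaches an arrival. An arrival at the terminal clock value must be excluded: the clock rests there,
and the right-hand side would hold on a half-line of times. -/
lemma mark_iff (hz : IsExtinctPath z m) (hp : IsCountingPath p)
    (hne : ∀ k, arrival (dataOf p) (k + 1) ≠ markClock (dataOf z) m ⊤) {t : ℝ≥0} (ht : 0 < t) :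
    (marks z p t : ℤ) - Function.leftLim (fun s => (marks z p s : ℤ)) t = 1 ↔
      ∃ k, markClock (dataOf z) m t = arrival (dataOf p) (k + 1) := by
  have hc := (continuous_markClock (dataOf z) m).continuousAt (x := t)
  have hmono : ∀ r < t, markClock (dataOf z) m r ≤ markClock (dataOf z) m t := fun r hr =>
    markClock_mono _ _ (by exact_mod_cast hr.le)
  obtain ⟨k, hk1, hk2⟩ := hp.exists_between (markClock_nonneg (dataOf z) m t)
  by_cases hex : ∃ k, markClock (dataOf z) m t = arrival (dataOf p) (k + 1)
  · refine iff_of_true ?_ hex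
    obtain ⟨j, hj⟩ := hex
    have hlt := hp.strictMono_arrival
    rw [marks_eq hz hp (k := j + 1) hj.ge (by rw [hj]; exact hlt (Nat.lt_succ_self _)),
      leftLim_eq_of_eventually ht (v := j)]
    · push_cast; ring
    have h1 : ∀ᶠ r : ℝ≥0 in 𝓝[<] t, arrival (dataOf p) j < markClock (dataOf z) m r :=
      (hc.mono_left nhdsWithin_le_nhds).eventually
        (lt_mem_nhds ((hlt (Nat.lt_succ_self j)).trans_eq hj.symm))
    filter_upwards [h1, self_mem_nhdsWithin] with r hr hrt
    rw [marks_eq hz hp hr.le]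
    rw [← hj]
    have hrt' : (r : ℝ≥0∞) < t := by exact_mod_cast hrt
    refine markClock_lt_of_lt_top hz ?_ hrt'
    refine (hmono r hrt).trans_lt (lt_of_le_of_ne (markClock_mono _ _ le_top) ?_)
    rw [hj]
    exact hne j
  · refine iff_of_false ?_ hex
    rw [marks_eq hz hp hk1 hk2, leftLim_eq_of_eventually ht (v := k)]
    · simp
    have h1 : ∀ᶠ r : ℝ≥0 in 𝓝[<] t, arrival (dataOf p) k ≤ markClock (dataOf z) m r := by
      rcases k with - | k
      · refine Eventually.of_forall fun r => ?_
        simpa [arrival] using markClock_nonneg (dataOf z) m r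
      · push Not at hex
        exact ((hc.mono_left nhdsWithin_le_nhds).eventually
          (lt_mem_nhds (lt_of_le_of_ne hk1 (hex k).symm))).mono fun _ h => h.le
    filter_upwards [h1, self_mem_nhdsWithin] with r hr hrt
    rw [marks_eq hz hp hr ((hmono r hrt).trans_lt hk2)]

lemma mem_eventTimes_iff (hz : IsExtinctPath z m) (hp : IsCountingPath p)
    (hne : ∀ k, arrival (dataOf p) (k + 1) ≠ markClock (dataOf z) m ⊤) {t : ℝ≥0} :
    t ∈ eventTimes z p ↔ (∃ k < m, (t : ℝ) = 2 * arrival (dataOf z) (k + 1)) ∨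
      ∃ k, markClock (dataOf z) m t = arrival (dataOf p) (k + 1) := by
  have hpos : (∃ k < m, (t : ℝ) = 2 * arrival (dataOf z) (k + 1)) ∨
      (∃ k, markClock (dataOf z) m t = arrival (dataOf p) (k + 1)) → 0 < t := by
    rintro (⟨k, hk, h⟩ | ⟨k, h⟩)
    · have := (arrival_nonneg (dataOf z) k).trans_lt (hz.strictMono_arrival (Nat.lt_succ_self k) hk)
      have h2 : (0 : ℝ) < t := by rw [h]; simp only [Nat.succ_eq_add_one] at this; linarith
      exact_mod_cast h2
    · rw [pos_iff_ne_zero]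
      rintro rfl
      rw [ENNReal.coe_zero, markClock_zero] at h
      have := (arrival_nonneg (dataOf p) k).trans_lt (hp.strictMono_arrival (Nat.lt_succ_self k))
      simp only [Nat.succ_eq_add_one] at this
      linarith
  rw [eventTimes, mem_ofPred_eq, ← or_assoc]
  constructor
  · rintro ⟨ht, h⟩
    rw [hz.jump_iff (by positivity), mark_iff hz hp hne ht] at h
    refine h.imp_left fun ⟨k, hk, h⟩ => ⟨k, hk, ?_⟩
    push_cast at h
    linarith
  · intro h
    have ht := hpos h
    refine ⟨ht, ?_⟩
    rw [hz.jump_iff (by positivity), mark_iff hz hp hne ht]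
    refine h.imp_left fun ⟨k, hk, h⟩ => ⟨k, hk, ?_⟩
    push_cast
    linarith

/-- The number of births, deaths and marks up to time `o`, computed from the jump chains and the
holding times, if the birth and death process is extinct after `m` jumps. -/
def eventCount (m : ℕ) (ζ η : ChainData) (o : ℝ≥0∞) : ℕ∞ :=
  {k : ℕ | k < m ∧ ENNReal.ofReal (2 * arrival ζ (k + 1)) ≤ o}.encard +
    {k : ℕ | arrival η (k + 1) < markClock ζ m ⊤ ∧ arrival η (k + 1) ≤ markClock ζ m o}.encard

/-- Births and deaths are indexed by the jumps, marks by the arrivals below the terminal clock value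
through the inverse τ of the clock. By `hne` no arrival falls on the clock value of a jump, so the
two sets are disjoint; its case j = m excludes the terminal value. -/
theorem encard_eventTimes (hz : IsExtinctPath z m) (hp : IsCountingPath p)
    (hne : ∀ j ≤ m, ∀ k, arrival (dataOf p) (k + 1) ≠
      markClock (dataOf z) m (ENNReal.ofReal (2 * arrival (dataOf z) j))) (o : ℝ≥0∞) :
    (eventTimes z p ∩ {t | (t : ℝ≥0∞) ≤ o}).encard = eventCount m (dataOf z) (dataOf p) o := by
  have hne' : ∀ k, arrival (dataOf p) (k + 1) ≠ markClock (dataOf z) m ⊤ := fun k => by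
    rw [← markClock_arrival]
    exact hne m le_rfl k
  have ha2 : ∀ k, 0 ≤ 2 * arrival (dataOf z) k := fun k => by linarith [arrival_nonneg (dataOf z) k]
  have hex : ∀ k, arrival (dataOf p) (k + 1) < markClock (dataOf z) m ⊤ →
      ∃ t : ℝ≥0, markClock (dataOf z) m t = arrival (dataOf p) (k + 1) := by
    intro k hk
    have h := intermediate_value_Icc (zero_le (a := (2 * arrival (dataOf z) m).toNNReal))
      (continuous_markClock (dataOf z) m).continuousOn
    rw [ENNReal.coe_zero, markClock_zero] at h
    obtain ⟨t, -, ht⟩ := h ⟨arrival_nonneg _ (k + 1), by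
      have := markClock_arrival (dataOf z) m
      rw [ENNReal.ofReal] at this
      rw [this]; exact hk.le⟩
    exact ⟨t, ht⟩
  choose! τ hτ using hex
  have hset : eventTimes z p ∩ {t | (t : ℝ≥0∞) ≤ o} =
      (fun k => (2 * arrival (dataOf z) (k + 1)).toNNReal) ''
        {k : ℕ | k < m ∧ ENNReal.ofReal (2 * arrival (dataOf z) (k + 1)) ≤ o} ∪
      τ '' {k : ℕ | arrival (dataOf p) (k + 1) < markClock (dataOf z) m ⊤ ∧
        arrival (dataOf p) (k + 1) ≤ markClock (dataOf z) m o} := by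
    ext t
    rw [Set.mem_inter_iff, mem_eventTimes_iff hz hp hne', Set.mem_union, Set.mem_ofPred_eq, or_and_right]
    refine or_congr ⟨?_, ?_⟩ ⟨?_, ?_⟩
    · rintro ⟨⟨k, hk, h⟩, ho⟩
      have h' : (2 * arrival (dataOf z) (k + 1)).toNNReal = t := by rw [← h, Real.toNNReal_coe]
      exact ⟨k, ⟨hk, by rwa [ENNReal.ofReal, h']⟩, h'⟩
    · rintro ⟨k, ⟨hk, ho⟩, rfl⟩
      exact ⟨⟨k, hk, Real.coe_toNNReal _ (ha2 _)⟩, ho⟩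
    · rintro ⟨⟨k, h⟩, ho⟩
      have hlt : arrival (dataOf p) (k + 1) < markClock (dataOf z) m ⊤ :=
        lt_of_le_of_ne (h ▸ markClock_mono _ _ le_top) (hne' k)
      refine ⟨k, ⟨hlt, h ▸ markClock_mono _ _ ho⟩, ?_⟩
      rcases lt_trichotomy (τ k) t with h1 | h1 | h1
      · have := markClock_lt_of_lt_top hz (r := τ k) (o := t) (by rw [hτ k hlt]; exact hlt)
          (by exact_mod_cast h1)
        rw [hτ k hlt, h] at this
        exact absurd this (lt_irrefl _)
      · exact h1
      · have := markClock_lt_of_lt_top hz (r := t) (o := τ k) (by rw [h]; exact hlt)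
          (by exact_mod_cast h1)
        rw [hτ k hlt, h] at this
        exact absurd this (lt_irrefl _)
    · rintro ⟨k, ⟨hlt, ho⟩, rfl⟩
      refine ⟨⟨k, hτ k hlt⟩, ?_⟩
      by_contra hc
      push Not at hc
      lift o to ℝ≥0 using ne_top_of_lt hc
      have h1 : markClock (dataOf z) m o < markClock (dataOf z) m ⊤ :=
        ((markClock_mono _ _ hc.le).trans (hτ k hlt).le).trans_lt hlt
      have := markClock_lt_of_lt_top hz h1 hc
      rw [hτ k hlt] at this
      exact absurd ho (not_le.2 this)
  rw [hset, eventCount, encard_union_eq, InjOn.encard_image, InjOn.encard_image]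
  · intro k hk j hj hkj
    have := (hτ k hk.1).symm.trans ((congrArg (fun t : ℝ≥0 => markClock (dataOf z) m t) hkj).trans
      (hτ j hj.1))
    simpa using hp.strictMono_arrival.injective this
  · intro k hk j hj hkj
    have h := (Real.toNNReal_eq_toNNReal_iff (ha2 _) (ha2 _)).1 hkj
    by_contra hne
    rcases lt_or_gt_of_ne hne with h1 | h1
    · have := hz.strictMono_arrival (Nat.succ_lt_succ h1) hj.1
      simp only [Nat.succ_eq_add_one] at this
      linarith
    · have := hz.strictMono_arrival (Nat.succ_lt_succ h1) hk.1
      simp only [Nat.succ_eq_add_one] at this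
      linarith
  · rw [Set.disjoint_left]
    rintro t ⟨k, ⟨hk, -⟩, rfl⟩ ⟨j, ⟨hj, -⟩, h⟩
    have h1 := hτ j hj
    rw [h] at h1
    exact hne (k + 1) hk j h1.symm

/-! ### Joint generating functionals of the counts below finitely many levels -/

/-- The product over the levels `o` in `l` of `1/4` or `1/2`, according to whether `t ≤ o`. -/
def lev (l : List ℝ≥0∞) (t : ℝ) : ℝ :=
  (l.map fun o => if ENNReal.ofReal t ≤ o then (1 / 4 : ℝ) else 1 / 2).prod

/-- The monomial of the counts `C` which belongs to the levels `l`. -/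
def levelWeight (l : List ℝ≥0∞) (C : ℝ≥0∞ → ℕ∞) : ℝ :=
  (l.map fun o => (1 / 2 : ℝ) ^ ((C ⊤).toNat + (C o).toNat)).prod

@[simp] lemma lev_nil (t : ℝ) : lev [] t = 1 := by simp [lev]

lemma lev_cons (o : ℝ≥0∞) (l : List ℝ≥0∞) (t : ℝ) :
    lev (o :: l) t = (if ENNReal.ofReal t ≤ o then (1 / 4 : ℝ) else 1 / 2) * lev l t := by
  simp [lev]

lemma lev_pos (l : List ℝ≥0∞) (t : ℝ) : 0 < lev l t := by
  induction l with
  | nil => simp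
  | cons o l ih => rw [lev_cons]; split_ifs <;> positivity

lemma lev_nonneg (l : List ℝ≥0∞) (t : ℝ) : 0 ≤ lev l t := (lev_pos l t).le

lemma lev_le_one (l : List ℝ≥0∞) (t : ℝ) : lev l t ≤ 1 := by
  induction l with
  | nil => simp
  | cons o l ih => have := lev_nonneg l t; rw [lev_cons]; split_ifs <;> linarith

/-- Each level gives a factor 1/2 to every point, even above the level, precisely to keep g below 1
uniformly, as the walk argument requires. -/
lemma lev_le_half {l : List ℝ≥0∞} (hl : l ≠ []) (t : ℝ) : lev l t ≤ 1 / 2 := by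
  cases l with
  | nil => simp at hl
  | cons o l =>
    have := lev_nonneg l t
    have := lev_le_one l t
    rw [lev_cons]; split_ifs <;> linarith

lemma measurable_lev (l : List ℝ≥0∞) : Measurable (lev l) := by
  induction l with
  | nil => simp only [funext lev_nil]; exact measurable_const
  | cons o l ih =>
    simp only [funext (lev_cons o l)]
    exact (Measurable.ite (measurableSet_le ENNReal.measurable_ofReal measurable_const)
      measurable_const measurable_const).mul ih

lemma countable_not_continuousAt_lev (l : List ℝ≥0∞) :
    {x | ¬ ContinuousAt (lev l) x}.Countable := by
  induction l with
  | nil => simp only [funext lev_nil]; simp [continuousAt_const]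
  | cons o l ih =>
    refine (ih.insert o.toReal).mono fun x hx => ?_
    by_contra hc
    rw [Set.mem_insert_iff, not_or, Set.mem_ofPred_eq, not_not] at hc
    refine hx ?_
    rw [funext (lev_cons o l)]
    refine ContinuousAt.mul ?_ hc.2
    induction o with
    | top => simp [continuousAt_const]
    | coe o =>
      have hc1 : x ≠ o := hc.1
      rcases lt_or_gt_of_ne hc1 with h | h
      · refine ContinuousAt.congr (f := fun _ => (1 / 4 : ℝ)) continuousAt_const ?_
        filter_upwards [gt_mem_nhds h] with y hy
        rw [if_pos (by rw [ENNReal.ofReal_le_iff_le_toReal (by simp)]; simpa using hy.le)]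
      · refine ContinuousAt.congr (f := fun _ => (1 / 2 : ℝ)) continuousAt_const ?_
        filter_upwards [lt_mem_nhds h] with y hy
        rw [if_neg (by rw [ENNReal.ofReal_le_iff_le_toReal (by simp)]; simpa using hy)]

lemma prod_lev {ι : Type*} (l : List ℝ≥0∞) (s : Finset ι) (f : ι → ℝ) :
    ∏ i ∈ s, lev l (f i) = (l.map fun o => (1 / 2 : ℝ) ^
      (s.card + (s.filter fun i => ENNReal.ofReal (f i) ≤ o).card)).prod := by
  induction l with
  | nil => simp
  | cons o l ih =>
    simp only [lev_cons, Finset.prod_mul_distrib, List.map_cons, List.prod_cons, ih]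
    congr 1
    have : ∀ i, (if ENNReal.ofReal (f i) ≤ o then (1 / 4 : ℝ) else 1 / 2) =
        1 / 2 * if ENNReal.ofReal (f i) ≤ o then 1 / 2 else 1 := fun i => by
      split_ifs <;> norm_num
    simp only [this, Finset.prod_mul_distrib, Finset.prod_const, Finset.prod_ite, one_pow,
      mul_one, pow_add]

/-- The weight of a mark at the value `u` of the clock. -/
def clockLev (m : ℕ) (ζ : ChainData) (l : List ℝ≥0∞) (u : ℝ) : ℝ :=
  if u < markClock ζ m ⊤ then lev (l.map fun o => ENNReal.ofReal (markClock ζ m o)) u else 1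

lemma eventCount_eq {m n : ℕ} {ζ η : ChainData}
    (hn : ∀ k, n ≤ k → markClock ζ m ⊤ ≤ arrival η (k + 1)) (o : ℝ≥0∞) :
    eventCount m ζ η o =
      (((Finset.range m).filter fun k => ENNReal.ofReal (2 * arrival ζ (k + 1)) ≤ o).card +
        (((Finset.range n).filter fun k => arrival η (k + 1) < markClock ζ m ⊤).filter
          fun k => arrival η (k + 1) ≤ markClock ζ m o).card : ℕ) := by
  rw [eventCount, Nat.cast_add, ← encard_coe_eq_coe_finsetCard, ← encard_coe_eq_coe_finsetCard]
  congr 2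
  · ext k; simp
  · ext k
    simp only [mem_ofPred_eq, Finset.coe_filter, Finset.mem_filter, Finset.mem_range, and_assoc]
    refine ⟨fun h => ⟨?_, h⟩, fun h => h.2⟩
    by_contra hk
    exact absurd h.1 (not_lt.2 (hn k (not_lt.1 hk)))

lemma list_prod_map_mul (l : List ℝ≥0∞) (f g : ℝ≥0∞ → ℝ) :
    (l.map f).prod * (l.map g).prod = (l.map fun o => f o * g o).prod := by
  induction l with
  | nil => simp
  | cons o l ih => simp only [List.map_cons, List.prod_cons, ← ih]; ring

/-- Only finitely many arrivals precede the terminal clock value, and all others have weight 1, so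
the partial products become constant. -/
lemma levelWeight_eventCount {m : ℕ} {ζ η : ChainData} (hη : Tendsto (arrival η) atTop atTop)
    (l : List ℝ≥0∞) : ∀ᶠ n in atTop, (∏ k ∈ Finset.range m, lev l (2 * arrival ζ (k + 1))) *
      ∏ k ∈ Finset.range n, clockLev m ζ l (arrival η (k + 1)) =
        levelWeight l (eventCount m ζ η) := by
  have h := hη.eventually_ge_atTop (markClock ζ m ⊤)
  obtain ⟨N, hN⟩ := eventually_atTop.1 h
  filter_upwards [eventually_ge_atTop N] with n hn
  have hn' : ∀ k, n ≤ k → markClock ζ m ⊤ ≤ arrival η (k + 1) := fun k hk => hN _ (by omega)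
  have h1 : ∏ k ∈ Finset.range n, clockLev m ζ l (arrival η (k + 1)) =
      ∏ k ∈ (Finset.range n).filter fun k => arrival η (k + 1) < markClock ζ m ⊤,
        lev (l.map fun o => ENNReal.ofReal (markClock ζ m o)) (arrival η (k + 1)) := by
    simp only [clockLev, Finset.prod_filter]
  rw [h1, prod_lev, prod_lev, List.map_map, list_prod_map_mul, levelWeight]
  congr 1
  refine List.map_congr_left fun o _ => ?_
  rw [eventCount_eq hn' ⊤, eventCount_eq hn' o, ENat.toNat_natCast, ENat.toNat_natCast,
    Function.comp_apply, ← pow_add]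
  congr 1
  simp only [le_top, Finset.filter_true, Finset.card_range]
  have h2 : (((Finset.range n).filter fun k => arrival η (k + 1) < markClock ζ m ⊤).filter
      fun k => arrival η (k + 1) ≤ markClock ζ m ⊤) =
      (Finset.range n).filter fun k => arrival η (k + 1) < markClock ζ m ⊤ :=
    Finset.filter_true_of_mem fun k hk => (Finset.mem_filter.1 hk).2.le
  rw [h2]
  simp only [ENNReal.ofReal_le_ofReal_iff (markClock_nonneg ζ m o)]
  ring

lemma measurable_clockLev (m : ℕ) (ζ : ChainData) (l : List ℝ≥0∞) : Measurable (clockLev m ζ l) :=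
  Measurable.ite measurableSet_Iio (measurable_lev _) measurable_const

lemma clockLev_nonneg (m : ℕ) (ζ : ChainData) (l : List ℝ≥0∞) (u : ℝ) : 0 ≤ clockLev m ζ l u := by
  rw [clockLev]
  split_ifs
  exacts [lev_nonneg _ _, zero_le_one]

lemma clockLev_le_one (m : ℕ) (ζ : ChainData) (l : List ℝ≥0∞) (u : ℝ) : clockLev m ζ l u ≤ 1 := by
  rw [clockLev]
  split_ifs
  exacts [lev_le_one _ _, le_rfl]

lemma countable_not_continuousAt_clockLev (m : ℕ) (ζ : ChainData) (l : List ℝ≥0∞) :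
    {x | ¬ ContinuousAt (clockLev m ζ l) x}.Countable := by
  refine ((countable_not_continuousAt_lev
    (l.map fun o => ENNReal.ofReal (markClock ζ m o))).insert (markClock ζ m ⊤)).mono fun x hx => ?_
  by_contra hc
  rw [Set.mem_insert_iff, not_or, Set.mem_ofPred_eq, not_not] at hc
  refine hx ?_
  rcases lt_or_gt_of_ne hc.1 with h | h
  · refine hc.2.congr ?_
    filter_upwards [gt_mem_nhds h] with y hy
    rw [clockLev, if_pos hy]
  · refine ContinuousAt.congr (f := fun _ => (1 : ℝ)) continuousAt_const ?_
    filter_upwards [lt_mem_nhds h] with y hy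
    rw [clockLev, if_neg (not_lt.2 (le_of_lt hy))]

lemma markClock_between {ζ : ChainData} {m k : ℕ} (hk : k < m) {t : ℝ}
    (h1 : 2 * arrival ζ k ≤ t) (h2 : t ≤ 2 * arrival ζ (k + 1)) :
    markClock ζ m (ENNReal.ofReal t) = ζ.1 k * (t - 2 * arrival ζ k) +
      ∑ j ∈ Finset.range k, ζ.1 j * (2 * arrival ζ (j + 1) - 2 * arrival ζ j) := by
  have ha : ∀ k, 0 ≤ 2 * arrival ζ k := fun k => by linarith [arrival_nonneg ζ k]
  have hm : ∀ {i j}, i ≤ j → 2 * arrival ζ i ≤ 2 * arrival ζ j := fun h => by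
    linarith [monotone_arrival ζ h]
  have ht := (ha k).trans h1
  have hcut : ∀ j, cut (ENNReal.ofReal t) (2 * arrival ζ j) = min t (2 * arrival ζ j) := fun j => by
    have := cut_coe t.toNNReal (ha j)
    rwa [Real.coe_toNNReal _ ht] at this
  rw [markClock, ← Finset.sum_subset (Finset.range_subset_range.2 (Nat.succ_le_of_lt hk)),
    Nat.succ_eq_add_one, Finset.sum_range_succ, add_comm]
  · simp only [hcut]
    rw [min_eq_left h2, min_eq_right h1]
    congr 1
    refine Finset.sum_congr rfl fun j hj => ?_
    have hj' := Finset.mem_range.1 hj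
    rw [min_eq_right ((hm hj'.le).trans h1), min_eq_right ((hm (Nat.succ_le_of_lt hj')).trans h1)]
  · intro j _ hj
    have hj' : k + 1 ≤ j := by simpa using hj
    rw [hcut, hcut, min_eq_left (h2.trans (hm hj')), min_eq_left (h2.trans (hm (by omega))), sub_self,
      mul_zero]

/-- Before extinction the clock is strictly increasing, so comparing clock values amounts to
comparing times. -/
lemma clockLev_markClock {ζ : ChainData} {m : ℕ} (h0 : ∀ k < m, ζ.1 k ≠ 0) (l : List ℝ≥0∞) {t : ℝ}
    (ht0 : 0 ≤ t) (ht : t < 2 * arrival ζ m) :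
    clockLev m ζ l (markClock ζ m (ENNReal.ofReal t)) = lev l t := by
  have hlt : ∀ o : ℝ≥0∞, ENNReal.ofReal t < o →
      markClock ζ m (ENNReal.ofReal t) < markClock ζ m o := fun o ho =>
    markClock_lt h0 (s := t.toNNReal) (by rwa [Real.coe_toNNReal _ ht0]) ho
  rw [clockLev, if_pos (hlt ⊤ ENNReal.ofReal_lt_top), lev, lev, List.map_map]
  congr 1
  refine List.map_congr_left fun o _ => ?_
  rw [Function.comp_apply]
  refine if_congr ?_ rfl rfl
  rw [ENNReal.ofReal_le_ofReal_iff (markClock_nonneg ζ m o)]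
  refine ⟨fun h => ?_, fun h => markClock_mono _ _ h⟩
  by_contra hc
  push Not at hc
  lift o to ℝ≥0 using ne_top_of_lt hc
  have ho : (o : ℝ) < t := by
    rw [← ENNReal.ofReal_coe_nnreal] at hc
    exact (ENNReal.ofReal_lt_ofReal_iff_of_nonneg o.coe_nonneg).1 hc
  exact absurd h (not_le.2 (markClock_lt h0 (ho.trans ht) hc))

lemma markClock_top (ζ : ChainData) (m : ℕ) : markClock ζ m ⊤ =
    ∑ j ∈ Finset.range m, ζ.1 j * (2 * arrival ζ (j + 1) - 2 * arrival ζ j) := by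
  refine Finset.sum_congr rfl fun j _ => ?_
  rw [cut_top (by linarith [arrival_nonneg ζ (j + 1)]), cut_top (by linarith [arrival_nonneg ζ j])]

/-- Substitution u = clock(t): on the k-th doubled holding interval the clock is affine with slope
`ζ.1 k`, and `clockLev` at clock(t) is `lev` at t. The Poisson exponent thus becomes the one in
`birthDeathWeight`. -/
theorem missRate_clockLev {ζ : ChainData} {m : ℕ} (h0 : ∀ k < m, ζ.1 k ≠ 0) (l : List ℝ≥0∞) :
    missRate (clockLev m ζ l) (markClock ζ m ⊤) = ∑ k ∈ Finset.range m, ζ.1 k *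
      (missRate (lev l) (2 * arrival ζ (k + 1)) - missRate (lev l) (2 * arrival ζ k)) := by
  have hγ := missRate_sub (measurable_clockLev m ζ l) (clockLev_nonneg m ζ l) (clockLev_le_one m ζ l)
  have hg := missRate_sub (measurable_lev l) (lev_nonneg l) (lev_le_one l)
  have key : ∀ n ≤ m, missRate (clockLev m ζ l)
      (∑ j ∈ Finset.range n, ζ.1 j * (2 * arrival ζ (j + 1) - 2 * arrival ζ j)) =
      ∑ k ∈ Finset.range n, ζ.1 k *
        (missRate (lev l) (2 * arrival ζ (k + 1)) - missRate (lev l) (2 * arrival ζ k)) := by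
    intro n
    induction n with
    | zero => simp [missRate]
    | succ k ih =>
      intro hk
      rw [Finset.sum_range_succ (fun k => (ζ.1 k : ℝ) * (missRate (lev l) (2 * arrival ζ (k + 1)) -
        missRate (lev l) (2 * arrival ζ k))) k, ← ih (by omega), ← sub_eq_iff_eq_add', hγ, hg]
      have h := intervalIntegral.mul_integral_comp_mul_add (a := 2 * arrival ζ k)
        (b := 2 * arrival ζ (k + 1)) (f := fun u => 1 - clockLev m ζ l u) (c := ζ.1 k)
        (d := ∑ j ∈ Finset.range k, ζ.1 j * (2 * arrival ζ (j + 1) - 2 * arrival ζ j) -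
          ζ.1 k * (2 * arrival ζ k))
      rw [Finset.sum_range_succ]
      have hab : 2 * arrival ζ k ≤ 2 * arrival ζ (k + 1) := by
        linarith [monotone_arrival ζ (Nat.le_succ k)]
      have e1 : ∀ S : ℝ, S + ζ.1 k * (2 * arrival ζ (k + 1) - 2 * arrival ζ k) =
        ζ.1 k * (2 * arrival ζ (k + 1)) + (S - ζ.1 k * (2 * arrival ζ k)) := fun S => by ring
      rw [e1]
      have e2 : ∀ S : ℝ, ζ.1 k * (2 * arrival ζ k) + (S - ζ.1 k * (2 * arrival ζ k)) = S :=
        fun S => by ring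
      rw [e2] at h
      rw [← h]
      congr 1
      refine intervalIntegral.integral_congr_Ioo_of_le hab fun t ht => ?_
      have ha : 0 ≤ arrival ζ k := arrival_nonneg ζ k
      have e3 : ζ.1 k * t + (∑ j ∈ Finset.range k,
          ζ.1 j * (2 * arrival ζ (j + 1) - 2 * arrival ζ j) - ζ.1 k * (2 * arrival ζ k)) =
          markClock ζ m (ENNReal.ofReal t) := by
        rw [markClock_between hk ht.1.le ht.2.le]
        ring
      rw [e3, clockLev_markClock h0 l (by linarith [ht.1])
        (ht.2.trans_le (by linarith [monotone_arrival ζ hk]))]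
  rw [markClock_top]
  exact key m le_rfl

lemma birthDeathWeight_lev {ζ : ChainData} {m : ℕ} (h0 : ∀ k < m, ζ.1 k ≠ 0)
    (h1 : ∀ k, m ≤ k → ζ.1 k = 0) (l : List ℝ≥0∞) {n : ℕ} (hn : m ≤ n) :
    birthDeathWeight (lev l) ζ n = (∏ k ∈ Finset.range m, lev l (2 * arrival ζ (k + 1))) *
      Real.exp (-missRate (clockLev m ζ l) (markClock ζ m ⊤)) := by
  rw [missRate_clockLev h0, ← Finset.sum_neg_distrib, Real.exp_sum, ← Finset.prod_mul_distrib,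
    birthDeathWeight, ← Finset.prod_subset (Finset.range_subset_range.2 hn)]
  · refine Finset.prod_congr rfl fun k hk => ?_
    rw [if_neg (h0 k (Finset.mem_range.1 hk))]
  · intro k _ hk
    rw [if_pos (h1 k (by simpa using hk))]

/-- With ζ fixed, the births and deaths contribute a positive constant c; after division by c, only
the product over the arrivals remains for `IsChainLaw.lintegral_poisson`. -/
lemma IsChainLaw.lintegral_levelWeight {ν : Measure ChainData} [IsProbabilityMeasure ν]
    (hν : IsPoissonChainLaw ν) (m : ℕ) (ζ : ChainData) (l : List ℝ≥0∞) :
    ∫⁻ η, ENNReal.ofReal (levelWeight l (eventCount m ζ η)) ∂ν =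
      ENNReal.ofReal ((∏ k ∈ Finset.range m, lev l (2 * arrival ζ (k + 1))) *
        Real.exp (-missRate (clockLev m ζ l) (markClock ζ m ⊤))) := by
  have hc : 0 < ∏ k ∈ Finset.range m, lev l (2 * arrival ζ (k + 1)) :=
    Finset.prod_pos fun k _ => lev_pos l _
  set c := ∏ k ∈ Finset.range m, lev l (2 * arrival ζ (k + 1)) with hcdef
  have h := IsChainLaw.lintegral_poisson hν (measurable_clockLev m ζ l) (clockLev_nonneg m ζ l)
    (clockLev_le_one m ζ l) (countable_not_continuousAt_clockLev m ζ l) (L := markClock ζ m ⊤)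
    (fun x hx => by rw [clockLev, if_neg (not_lt.2 hx)])
    (Φ := fun η => levelWeight l (eventCount m ζ η) / c) (by
      filter_upwards [IsChainLaw.ae_tendsto_arrival hν] with η hη
      filter_upwards [levelWeight_eventCount (m := m) (ζ := ζ) hη l] with n hn
      rw [← hn, mul_div_cancel_left₀ _ hc.ne'])
  rw [ENNReal.ofReal_mul hc.le, ← h, ← lintegral_const_mul' _ _ ENNReal.ofReal_ne_top]
  refine lintegral_congr fun η => ?_
  rw [← ENNReal.ofReal_mul hc.le, mul_div_cancel₀ _ hc.ne']

/-! ### The extinction index and the joint generating functional -/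

/-- The number of jumps until the chain is at `0`. -/
def extinctIndex (ζ : ChainData) : ℕ := sInf {n | ζ.1 n = 0}

lemma ne_zero_of_lt_extinctIndex {ζ : ChainData} {k : ℕ} (hk : k < extinctIndex ζ) : ζ.1 k ≠ 0 :=
  Nat.notMem_of_lt_sInf (s := {n | ζ.1 n = 0}) hk

lemma IsChainLaw.ae_extinctIndex {μ : Measure ChainData} [IsProbabilityMeasure μ]
    (hμ : IsCriticalChainLaw μ) : ∀ᵐ ζ ∂μ, ∀ k, extinctIndex ζ ≤ k → ζ.1 k = 0 := by
  filter_upwards [hμ.ae_critical, hμ.ae_extinct] with ζ h1 h2 k hk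
  induction k, hk using Nat.le_induction with
  | base => exact Nat.sInf_mem (s := {n | ζ.1 n = 0}) h2
  | succ k hk ih =>
    rcases h1 k with h | h
    · exact h.2.2
    · exact absurd ih h.1

/-- The number of births, deaths and marks up to time `o`, computed from the jump chains and the
holding times. -/
def jointCount (q : ChainData × ChainData) (o : ℝ≥0∞) : ℕ∞ :=
  eventCount (extinctIndex q.1) q.1 q.2 o

/-- A set of indices has at least n elements if and only if it contains one of the countably many
finite sets of size n. -/
lemma measurable_encard {α : Type*} [MeasurableSpace α] {p : ℕ → α → Prop}
    (h : ∀ k, MeasurableSet {a | p k a}) : Measurable fun a => {k | p k a}.encard := by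
  refine measurable_enat_of_le fun n => ?_
  have : {a | (n : ℕ∞) ≤ {k | p k a}.encard} =
      ⋃ s ∈ {s : Finset ℕ | s.card = n}, ⋂ k ∈ s, {a | p k a} := by
    ext a
    simp only [mem_ofPred_eq, mem_iUnion, mem_iInter, exists_prop]
    constructor
    · intro hn
      obtain ⟨t, ht, htn⟩ := exists_subset_encard_eq hn
      have hf : t.Finite := finite_of_encard_eq_coe htn
      refine ⟨hf.toFinset, ?_, fun k hk => ht (by simpa using hk)⟩
      rw [hf.encard_eq_coe_toFinset_card] at htn
      exact_mod_cast htn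
    · rintro ⟨s, hs, hsub⟩
      rw [← hs, ← encard_coe_eq_coe_finsetCard]
      exact encard_le_encard fun k hk => hsub k hk
  rw [this]
  exact MeasurableSet.biUnion (to_countable _) fun s _ =>
    MeasurableSet.biInter (to_countable _) fun k _ => h k

lemma measurable_extinctIndex : Measurable extinctIndex := by
  refine measurable_of_Ioi fun n => ?_
  have : extinctIndex ⁻¹' Ioi n = (⋃ k, {ζ : ChainData | ζ.1 k = 0}) ∩
      ⋂ k ∈ Iic n, {ζ : ChainData | ζ.1 k ≠ 0} := by
    ext ζ
    simp only [mem_preimage, mem_Ioi, Set.mem_inter_iff, mem_iUnion, mem_iInter, mem_ofPred_eq,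
      mem_Iic]
    refine ⟨fun h => ⟨?_, fun k hk => ne_zero_of_lt_extinctIndex (hk.trans_lt h)⟩, fun h => ?_⟩
    · exact Nat.nonempty_of_pos_sInf (s := {n | ζ.1 n = 0}) ((Nat.zero_le n).trans_lt h)
    · by_contra hc
      exact h.2 _ (not_lt.1 hc) (Nat.sInf_mem (s := {n | ζ.1 n = 0}) h.1)
  rw [this]
  exact (MeasurableSet.iUnion fun k => measurable_state k (measurableSet_singleton 0)).inter
    (MeasurableSet.biInter (to_countable _) fun k _ =>
      (measurable_state k (measurableSet_singleton 0)).compl)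

lemma measurable_markClock (n : ℕ) (o : ℝ≥0∞) : Measurable fun ζ => markClock ζ n o := by
  unfold markClock cut
  refine Finset.measurable_fun_sum _ fun k _ => ?_
  have h := measurable_state k
  have h1 := measurable_arrival k
  have h2 := measurable_arrival (k + 1)
  fun_prop

lemma measurable_markClock_extinctIndex (o : ℝ≥0∞) :
    Measurable fun ζ => markClock ζ (extinctIndex ζ) o := by
  have h : Measurable fun p : ChainData × ℕ => markClock p.1 p.2 o :=
    measurable_from_prod_countable_left fun n => measurable_markClock n o
  exact h.comp (measurable_id.prodMk measurable_extinctIndex)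

lemma measurable_jointCount (o : ℝ≥0∞) : Measurable fun q => jointCount q o := by
  unfold jointCount eventCount
  have hadd : Measurable fun p : ℕ∞ × ℕ∞ => p.1 + p.2 := measurable_of_countable _
  have hc := fun o : ℝ≥0∞ => (measurable_markClock_extinctIndex o).comp
    (measurable_fst : Measurable (Prod.fst : ChainData × ChainData → ChainData))
  have ha := fun k : ℕ => (measurable_arrival k).comp (measurable_snd : Measurable (Prod.snd : ChainData × ChainData → ChainData))
  have ha' := fun k : ℕ => (measurable_arrival k).comp (measurable_fst : Measurable (Prod.fst : ChainData × ChainData → ChainData))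
  have hi := measurable_extinctIndex.comp (measurable_fst : Measurable (Prod.fst : ChainData × ChainData → ChainData))
  refine hadd.comp ((measurable_encard fun k => ?_).prodMk (measurable_encard fun k => ?_))
  · exact (measurableSet_lt measurable_const hi).inter
      (measurableSet_le ((ha' (k + 1)).const_mul 2).ennreal_ofReal measurable_const)
  · exact (measurableSet_lt (ha (k + 1)) (hc ⊤)).inter (measurableSet_le (ha (k + 1)) (hc o))

lemma measurable_levelWeight {α : Type*} [MeasurableSpace α] {C : α → ℝ≥0∞ → ℕ∞}
    (hC : ∀ o, Measurable fun a => C a o) (l : List ℝ≥0∞) :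
    Measurable fun a => levelWeight l (C a) := by
  induction l with
  | nil => simp only [levelWeight, List.map_nil, List.prod_nil]; exact measurable_const
  | cons o l ih =>
    simp only [levelWeight, List.map_cons, List.prod_cons]
    have hf : Measurable fun p : ℕ∞ × ℕ∞ => (1 / 2 : ℝ) ^ (p.1.toNat + p.2.toNat) :=
      measurable_of_countable _
    exact (hf.comp ((hC ⊤).prodMk (hC o))).mul ih

/-- By Fubini the Poisson chain is integrated first; what remains is the value at which
`birthDeathWeight` stabilises after extinction. -/
theorem lintegral_levelWeight_jointCount {μ ν : Measure ChainData} [IsProbabilityMeasure μ]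
    [IsProbabilityMeasure ν] (hμ : IsCriticalChainLaw μ) (hν : IsPoissonChainLaw ν)
    (l : List ℝ≥0∞) {φ : ℝ → ℝ} (hφ : IsRiccatiSolution (lev l) φ) :
    ∫⁻ q, ENNReal.ofReal (levelWeight l (jointCount q)) ∂(μ.prod ν) =
      ENNReal.ofReal (1 / 2 + φ 0 / 2) := by
  rw [lintegral_prod _ (measurable_levelWeight measurable_jointCount l).ennreal_ofReal.aemeasurable]
  refine (lintegral_congr fun ζ =>
    IsChainLaw.lintegral_levelWeight hν (extinctIndex ζ) ζ l).trans ?_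
  refine IsChainLaw.lintegral_birthDeath hμ (measurable_lev l) (lev_nonneg l) (lev_le_one l)
    (countable_not_continuousAt_lev l) hφ ?_
  filter_upwards [IsChainLaw.ae_extinctIndex hμ] with ζ hζ
  filter_upwards [eventually_ge_atTop (extinctIndex ζ)] with n hn
  exact birthDeathWeight_lev (fun k => ne_zero_of_lt_extinctIndex) hζ l hn

/-! ### The counts on the two sides -/

/-- The number of births, deaths and marks up to time `o`. -/
def eventsUpTo (z p : ℝ≥0 → ℕ) (o : ℝ≥0∞) : ℕ∞ :=
  (eventTimes z p ∩ {t | (t : ℝ≥0∞) ≤ o}).encard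

lemma isExtinctPath_extinctIndex {z : ℝ≥0 → ℕ} (hz : IsRightCont z)
    (h : ∀ n, (jumpChain z n = 0 ∧ holdTime z n = ⊤ ∧ jumpChain z (n + 1) = 0) ∨
      (jumpChain z n ≠ 0 ∧ holdTime z n ≠ ⊤ ∧
        (jumpChain z (n + 1) = jumpChain z n + 1 ∨ jumpChain z (n + 1) + 1 = jumpChain z n)))
    (h0 : ∀ k, extinctIndex (dataOf z) ≤ k → jumpChain z k = 0) :
    IsExtinctPath z (extinctIndex (dataOf z)) := by
  have hlt : ∀ k < extinctIndex (dataOf z), jumpChain z k ≠ 0 := fun k hk =>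
    ne_zero_of_lt_extinctIndex hk
  refine ⟨hz, hlt, fun k hk => ?_, fun k hk => ?_, h0 _ le_rfl, ?_⟩
  · exact ((h k).resolve_left fun h => hlt k hk h.1).2.1
  · exact ((h k).resolve_left fun h => hlt k hk h.1).2.2
  · exact ((h _).resolve_right fun h => h.1 (h0 _ le_rfl)).2.1

section EventCounts

variable {Ω : Type*} [MeasurableSpace Ω] {Q : Measure Ω} {Z N : ℝ≥0 → Ω → ℕ}

lemma measurable_pathData_process {b d : ℕ → ℝ≥0} {μ₀ : Measure ℕ}
    (hZ : IsBirthDeathProcess b d μ₀ Z Q) : Measurable fun ω => pathData fun t => Z t ω :=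
  measurable_pathData.comp (measurable_pi_lambda _ hZ.measurable)

variable [IsProbabilityMeasure Q]

lemma map_pathData_prod (hZ : IsCriticalBirthDeath bernoulliHalf Z Q) (hN : IsStandardPoisson N Q)
    (hind : IndepFun (fun ω t => Z t ω) (fun ω t => N t ω) Q) :
    Q.map (fun ω => (pathData fun t => Z t ω, pathData fun t => N t ω)) =
      (Q.map fun ω => pathData fun t => Z t ω).prod (Q.map fun ω => pathData fun t => N t ω) :=
  (indepFun_iff_map_prod_eq_prod_map_map (measurable_pathData_process hZ).aemeasurable
    (measurable_pathData_process hN).aemeasurable).1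
    (hind.comp measurable_pathData measurable_pathData)

/-- By independence the clock value can be held fixed, and the arrivals of a Poisson process have no
atoms. This supplies the hypothesis of `encard_eventTimes`. -/
lemma ae_arrival_ne_markClock (hZ : IsCriticalBirthDeath bernoulliHalf Z Q)
    (hN : IsStandardPoisson N Q) (hind : IndepFun (fun ω t => Z t ω) (fun ω t => N t ω) Q) :
    ∀ᵐ ω ∂Q, ∀ j k, arrival (pathData fun t => N t ω) (k + 1) ≠
      markClock (pathData fun t => Z t ω) (extinctIndex (pathData fun t => Z t ω))
        (ENNReal.ofReal (2 * arrival (pathData fun t => Z t ω) j)) := by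
  have hZm := measurable_pathData_process hZ
  have hNm := measurable_pathData_process hN
  have := Measure.isProbabilityMeasure_map (μ := Q) hZm.aemeasurable
  have := Measure.isProbabilityMeasure_map (μ := Q) hNm.aemeasurable
  have h : ∀ j k, ∀ᵐ q ∂((Q.map fun ω => pathData fun t => Z t ω).prod
      (Q.map fun ω => pathData fun t => N t ω)), arrival q.2 (k + 1) ≠
        markClock q.1 (extinctIndex q.1) (ENNReal.ofReal (2 * arrival q.1 j)) := by
    intro j k
    have hc : Measurable fun ζ : ChainData =>
        markClock ζ (extinctIndex ζ) (ENNReal.ofReal (2 * arrival ζ j)) := by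
      have hn : ∀ n, Measurable fun ζ : ChainData => markClock ζ n (ENNReal.ofReal (2 * arrival ζ j)) := by
        intro n
        unfold markClock cut
        refine Finset.measurable_fun_sum _ fun k _ => ?_
        have h := measurable_state k
        have h0 := measurable_arrival j
        have h1 := measurable_arrival k
        have h2 := measurable_arrival (k + 1)
        fun_prop
      have h : Measurable fun p : ChainData × ℕ =>
          markClock p.1 p.2 (ENNReal.ofReal (2 * arrival p.1 j)) :=
        measurable_from_prod_countable_left hn
      exact h.comp (measurable_id.prodMk measurable_extinctIndex)
    rw [Measure.ae_prod_iff_ae_ae]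
    · refine Eventually.of_forall fun ζ => ?_
      filter_upwards [IsChainLaw.ae_arrival_ne (isChainLaw_map hN) (markClock ζ (extinctIndex ζ)
        (ENNReal.ofReal (2 * arrival ζ j)))] with η hη
      exact hη k
    · exact (measurableSet_eq_fun ((measurable_arrival (k + 1)).comp measurable_snd)
        (hc.comp measurable_fst)).compl
  have h' := ae_all_iff.2 fun j => ae_all_iff.2 (h j)
  rw [← map_pathData_prod hZ hN hind] at h'
  exact ae_of_ae_map (hZm.prodMk hNm).aemeasurable h'

/-- Almost every pair of paths satisfies the hypotheses of `encard_eventTimes`. The total is finite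
since there are finitely many jumps and the arrivals eventually pass the terminal clock value. -/
theorem ae_eventsUpTo (hZ : IsCriticalBirthDeath bernoulliHalf Z Q) (hN : IsStandardPoisson N Q)
    (hind : IndepFun (fun ω t => Z t ω) (fun ω t => N t ω) Q) :
    ∀ᵐ ω ∂Q, eventsUpTo (fun t => Z t ω) (fun t => N t ω) =
        jointCount (pathData fun t => Z t ω, pathData fun t => N t ω) ∧
      eventsUpTo (fun t => Z t ω) (fun t => N t ω) ⊤ ≠ ⊤ := by
  have hZm := (measurable_pathData_process hZ).aemeasurable (μ := Q)
  have hNm := (measurable_pathData_process hN).aemeasurable (μ := Q)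
  have := Measure.isProbabilityMeasure_map hZm
  have := Measure.isProbabilityMeasure_map hNm
  filter_upwards [ae_arrival_ne_markClock hZ hN hind, hZ.rightContinuous, hN.rightContinuous,
    ae_of_ae_map hZm (IsChainLaw.ae_critical (isChainLaw_map hZ)),
    ae_of_ae_map hZm (IsChainLaw.ae_extinctIndex (isChainLaw_map hZ)),
    ae_of_ae_map hNm (IsChainLaw.ae_poisson_hold_ne_top (isChainLaw_map hN)),
    ae_of_ae_map hNm (IsChainLaw.ae_poisson_state (isChainLaw_map hN)),
    ae_of_ae_map hNm (IsChainLaw.ae_tendsto_arrival (isChainLaw_map hN))]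
    with ω h1 hzc hpc h2 h3 h4 h5 h6
  rw [pathData_eq hzc] at h1 h2 h3 ⊢
  rw [pathData_eq hpc] at h1 h4 h5 h6 ⊢
  have hz := isExtinctPath_extinctIndex hzc h2 h3
  have hp : IsCountingPath fun t => N t ω := ⟨hpc, h5, h4, h6⟩
  have heq : eventsUpTo (fun t => Z t ω) (fun t => N t ω) =
      jointCount (dataOf fun t => Z t ω, dataOf fun t => N t ω) :=
    funext fun o => encard_eventTimes hz hp (fun j _ k => h1 j k) o
  refine ⟨heq, ?_⟩
  obtain ⟨n, hn⟩ := eventually_atTop.1 (h6.eventually_ge_atTop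
    (markClock (dataOf fun t => Z t ω) (extinctIndex (dataOf fun t => Z t ω)) ⊤))
  rw [heq, jointCount, eventCount_eq (n := n) fun k hk => hn _ (by omega)]
  exact ENat.natCast_ne_top _

theorem integral_levelWeight_eventsUpTo (hZ : IsCriticalBirthDeath bernoulliHalf Z Q)
    (hN : IsStandardPoisson N Q) (hind : IndepFun (fun ω t => Z t ω) (fun ω t => N t ω) Q)
    (l : List ℝ≥0∞) {φ : ℝ → ℝ} (hφ : IsRiccatiSolution (lev l) φ) (hφ0 : 0 ≤ 1 / 2 + φ 0 / 2) :
    ∫ ω, levelWeight l (eventsUpTo (fun t => Z t ω) (fun t => N t ω)) ∂Q = 1 / 2 + φ 0 / 2 := by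
  have hZm := measurable_pathData_process hZ
  have hNm := measurable_pathData_process hN
  have := Measure.isProbabilityMeasure_map (μ := Q) hZm.aemeasurable
  have := Measure.isProbabilityMeasure_map (μ := Q) hNm.aemeasurable
  have hm := measurable_levelWeight measurable_jointCount l
  have hnn : ∀ C, 0 ≤ levelWeight l C := fun C =>
    List.prod_nonneg fun x hx => by
      obtain ⟨o, -, rfl⟩ := List.mem_map.1 hx
      positivity
  rw [integral_congr_ae (g := fun ω => levelWeight l
    (jointCount (pathData fun t => Z t ω, pathData fun t => N t ω)))
    ((ae_eventsUpTo hZ hN hind).mono fun ω h => by simp only [h.1]),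
    integral_eq_lintegral_of_nonneg_ae (Eventually.of_forall fun ω => hnn _)
      (hm.comp (hZm.prodMk hNm)).aestronglyMeasurable]
  have h := lintegral_levelWeight_jointCount (isChainLaw_map hZ) (isChainLaw_map hN) l hφ
  rw [← map_pathData_prod hZ hN hind, lintegral_map hm.ennreal_ofReal (hZm.prodMk hNm)] at h
  rw [h, ENNReal.toReal_ofReal hφ0]

lemma aemeasurable_eventsUpTo (hZ : IsCriticalBirthDeath bernoulliHalf Z Q)
    (hN : IsStandardPoisson N Q) (hind : IndepFun (fun ω t => Z t ω) (fun ω t => N t ω) Q)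
    (o : ℝ≥0∞) : AEMeasurable (fun ω => eventsUpTo (fun t => Z t ω) (fun t => N t ω) o) Q :=
  ⟨_, (measurable_jointCount o).comp
    ((measurable_pathData_process hZ).prodMk (measurable_pathData_process hN)),
    (ae_eventsUpTo hZ hN hind).mono fun _ h => congrFun h.1 o⟩

end EventCounts

/-! ### Counts of the walk -/

/-- The number of indices `1 ≤ i ≤ ν` with `s_i ≤ o`. -/
def valuesUpTo (s : ℕ → ℝ) (o : ℝ≥0∞) : ℕ∞ :=
  {i : ℕ | ((i + 1 : ℕ) : ℕ∞) ≤ nu s ∧ ENNReal.ofReal (s (i + 1)) ≤ o}.encard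

lemma valuesUpTo_eq {s : ℕ → ℝ} (h : nu s ≠ ⊤) (o : ℝ≥0∞) : valuesUpTo s o =
    ((Finset.range (nu s).toNat).filter fun i => ENNReal.ofReal (s (i + 1)) ≤ o).card := by
  rw [← encard_coe_eq_coe_finsetCard, valuesUpTo]
  congr 1
  ext i
  obtain ⟨n, hn⟩ := ENat.ne_top_iff_exists.1 h
  simp only [← hn, mem_ofPred_eq, Finset.coe_filter, Finset.mem_range, ENat.toNat_natCast,
    Nat.cast_le, Nat.succ_le_iff]

lemma valuesUpTo_top {s : ℕ → ℝ} (h : nu s ≠ ⊤) : valuesUpTo s ⊤ = nu s := by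
  rw [valuesUpTo_eq h]
  simp [ENat.natCast_toNat h]

lemma levelWeight_valuesUpTo {s : ℕ → ℝ} (h : nu s ≠ ⊤) (l : List ℝ≥0∞) :
    levelWeight l (valuesUpTo s) = walkProd (lev l) s := by
  rw [walkProd, if_neg h, prod_lev, levelWeight]
  congr 1
  refine List.map_congr_left fun o _ => ?_
  rw [valuesUpTo_top h, valuesUpTo_eq h, ENat.toNat_natCast, Finset.card_range]

lemma measurable_valuesUpTo (o : ℝ≥0∞) : Measurable fun s => valuesUpTo s o := by
  refine measurable_encard fun i => MeasurableSet.inter ?_ ?_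
  · exact measurable_nu (MeasurableSet.of_discrete (s := Ici ((i + 1 : ℕ) : ℕ∞)))
  · exact measurableSet_le (measurable_pi_apply (i + 1)).ennreal_ofReal measurable_const

open scoped BoundedContinuousFunction

/-! ### Identification of the laws -/

/-- The levels: `∞` and the rational ones. -/
def level : Option ℚ → ℝ≥0∞
  | none => ⊤
  | some q => ((q : ℝ).toNNReal : ℝ≥0∞)

/-- The function `x ↦ 2 ^ (-(x none + x i))`. -/
def halfPow (i : Option ℚ) : (Option ℚ → ℕ) →ᵇ ℝ :=
  BoundedContinuousFunction.ofNormedAddCommGroup (fun x => (1 / 2 : ℝ) ^ (x none + x i))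
    (by fun_prop) 1 fun x => by
      rw [Real.norm_of_nonneg (by positivity)]
      exact pow_le_one₀ (by norm_num) (by norm_num)

lemma halfPow_apply (i : Option ℚ) (x : Option ℚ → ℕ) :
    halfPow i x = (1 / 2 : ℝ) ^ (x none + x i) := rfl

/-- The algebra generated by the functions `halfPow`. -/
def halfPowAlgebra : StarSubalgebra ℝ ((Option ℚ → ℕ) →ᵇ ℝ) :=
  { Algebra.adjoin ℝ (range halfPow) with
    star_mem' := fun {a} ha => by
      have : star a = a := by ext; simp
      rwa [this] }

lemma list_prod_halfPow_apply (l : List (Option ℚ)) (x : Option ℚ → ℕ) :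
    (l.map halfPow).prod x = (l.map fun i => (1 / 2 : ℝ) ^ (x none + x i)).prod := by
  induction l with
  | nil => simp
  | cons i l ih => simp [ih, halfPow_apply]

/-- Stone–Weierstrass for measures. The monomials span an algebra of bounded continuous functions
that separates points: `halfPow none` determines `x none`, after which `halfPow i` determines `x i`.
The empty monomial integrates to 1 on both sides. -/
lemma map_eq_of_integral_eq {P Q : Measure (Option ℚ → ℕ)} [IsProbabilityMeasure P]
    [IsProbabilityMeasure Q] (h : ∀ l : List (Option ℚ), l ≠ [] →
      ∫ x, (l.map fun i => (1 / 2 : ℝ) ^ (x none + x i)).prod ∂P =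
        ∫ x, (l.map fun i => (1 / 2 : ℝ) ^ (x none + x i)).prod ∂Q) : P = Q := by
  refine ext_of_forall_mem_subalgebra_integral_eq_of_polish (𝕜 := ℝ) (A := halfPowAlgebra) ?_ ?_
  · intro x y hxy
    have hinj : Function.Injective fun n : ℕ => (1 / 2 : ℝ) ^ n :=
      pow_right_injective₀ (by norm_num) (by norm_num)
    have hmem : ∀ i, halfPow i ∈ halfPowAlgebra := fun i => Algebra.subset_adjoin ⟨i, rfl⟩
    have key : ∀ i, halfPow i x ≠ halfPow i y → ∃ f ∈ (fun f : C(Option ℚ → ℕ, ℝ) => (f : _ → ℝ)) ''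
        ((halfPowAlgebra.map (BoundedContinuousFunction.toContinuousMapStarₐ ℝ) :
          StarSubalgebra ℝ C(Option ℚ → ℕ, ℝ)) : Set C(Option ℚ → ℕ, ℝ)), f x ≠ f y := fun i hi =>
      ⟨_, ⟨_, ⟨_, hmem i, rfl⟩, rfl⟩, hi⟩
    by_cases h0 : x none = y none
    · obtain ⟨i, hi⟩ := Function.ne_iff.1 hxy
      refine key i fun he => hi ?_
      have := hinj he
      omega
    · refine key none fun he => h0 ?_
      have := hinj he
      omega
  · intro g hg
    have hg' : g ∈ Submodule.span ℝ (Submonoid.closure (range halfPow) : Set ((Option ℚ → ℕ) →ᵇ ℝ)) := by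
      rw [← Algebra.adjoin_eq_span]
      exact hg
    clear hg
    induction hg' using Submodule.span_induction with
    | mem f hf =>
      have hl : ∃ l : List (Option ℚ), f = (l.map halfPow).prod := by
        induction hf using Submonoid.closure_induction with
        | mem f hf => obtain ⟨i, rfl⟩ := hf; exact ⟨[i], by simp⟩
        | one => exact ⟨[], by simp⟩
        | mul f g _ _ hf hg =>
          obtain ⟨l, rfl⟩ := hf
          obtain ⟨l', rfl⟩ := hg
          exact ⟨l ++ l', by simp⟩
      obtain ⟨l, rfl⟩ := hl
      simp only [list_prod_halfPow_apply]
      by_cases hl : l = []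
      · simp [hl]
      · exact h l hl
    | zero => simp
    | add f g _ _ hf hg =>
      simp only [BoundedContinuousFunction.coe_add, Pi.add_apply]
      rw [integral_add (f.integrable P) (g.integrable P),
        integral_add (f.integrable Q) (g.integrable Q), hf, hg]
    | smul c f _ hf =>
      simp only [BoundedContinuousFunction.coe_smul]
      rw [integral_smul, integral_smul, hf]

/-- The least `t ≥ 0` with `k ≤ C t`. -/
lemma sInf_level_eq {C : ℝ≥0 → ℕ∞} (hC : Monotone C) (k : ℕ∞) :
    sInf ((fun t : ℝ≥0 => (t : ℝ≥0∞)) '' {t : ℝ≥0 | k ≤ C t}) =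
      ⨅ q : ℚ, if k ≤ C (q : ℝ).toNNReal then ((q : ℝ).toNNReal : ℝ≥0∞) else ⊤ := by
  apply le_antisymm
  · refine le_iInf fun q => ?_
    split_ifs with h
    · exact sInf_le ⟨_, h, rfl⟩
    · exact le_top
  · refine le_sInf ?_
    rintro _ ⟨t, ht, rfl⟩
    refine le_of_forall_gt fun b hb => ?_
    obtain ⟨q, -, h1, h2⟩ := ENNReal.lt_iff_exists_rat_btwn.1 hb
    refine (iInf_le _ q).trans_lt ?_
    rw [if_pos (le_trans ht (hC (ENNReal.coe_le_coe.1 h1.le)))]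
    exact h2

/-- The total count and the order statistics, from the counts below the levels. -/
def countStat (x : Option ℚ → ℕ) : ℕ∞ × (ℕ → ℝ≥0∞) :=
  (x none, fun k => ⨅ q : ℚ, if k ≤ x (some q) then ((q : ℝ).toNNReal : ℝ≥0∞) else ⊤)

lemma measurable_countStat : Measurable countStat := by
  refine Measurable.prodMk ?_ (measurable_pi_lambda _ fun k => Measurable.iInf fun q => ?_)
  · exact (measurable_of_countable fun n : ℕ => (n : ℕ∞)).comp (measurable_pi_apply none)
  · exact Measurable.ite (measurable_pi_apply (some q) (MeasurableSet.of_discrete (s := Ici k)))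
      measurable_const measurable_const

/-- The counts below the levels. -/
def levelCounts (C : ℝ≥0∞ → ℕ∞) (i : Option ℚ) : ℕ := (C (level i)).toNat

lemma countStat_levelCounts {C : ℝ≥0∞ → ℕ∞} (hC : Monotone C) (h : C ⊤ ≠ ⊤) :
    countStat (levelCounts C) = (C ⊤, fun k : ℕ =>
      sInf ((fun t : ℝ≥0 => (t : ℝ≥0∞)) '' {t : ℝ≥0 | (k : ℕ∞) ≤ C t})) := by
  have hfin : ∀ o, C o ≠ ⊤ := fun o => ne_top_of_le_ne_top h (hC le_top)
  refine Prod.ext (ENat.natCast_toNat h) (funext fun k => ?_)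
  have hC' : Monotone fun t : ℝ≥0 => C t := fun s t hst => hC (by exact_mod_cast hst)
  change _ = sInf ((fun t : ℝ≥0 => (t : ℝ≥0∞)) '' {t : ℝ≥0 | (k : ℕ∞) ≤ (fun t : ℝ≥0 => C t) t})
  rw [sInf_level_eq hC']
  refine iInf_congr fun q => if_congr ?_ rfl rfl
  obtain ⟨n, hn⟩ := ENat.ne_top_iff_exists.1 (hfin (level (some q)))
  change k ≤ (C (level (some q))).toNat ↔ (k : ℕ∞) ≤ C (level (some q))
  rw [← hn]
  simp

lemma integral_levelWeight_eq {α : Type*} [MeasurableSpace α] {P : Measure α}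
    {C : α → ℝ≥0∞ → ℕ∞} (hC : ∀ o, AEMeasurable (fun a => C a o) P) (l : List (Option ℚ)) :
    ∫ x, (l.map fun i => (1 / 2 : ℝ) ^ (x none + x i)).prod ∂(P.map fun a => levelCounts (C a)) =
      ∫ a, levelWeight (l.map level) (C a) ∂P := by
  have hm : AEMeasurable (fun a => levelCounts (C a)) P :=
    aemeasurable_pi_lambda _ fun i => (measurable_of_countable ENat.toNat).comp_aemeasurable
      (hC (level i))
  simp only [← list_prod_halfPow_apply]
  rw [integral_map hm (BoundedContinuousFunction.continuous _).aestronglyMeasurable]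
  refine integral_congr_ae (Eventually.of_forall fun a => ?_)
  simp only [list_prod_halfPow_apply, levelWeight, List.map_map]
  rfl

/-- Locally finite configurations with the same mixed generating functionals have the same total
count and order statistics in law. -/
theorem identDistrib_countStat {α β : Type*} [MeasurableSpace α] [MeasurableSpace β]
    {P : Measure α} {Q : Measure β} [IsProbabilityMeasure P] [IsProbabilityMeasure Q]
    {C : α → ℝ≥0∞ → ℕ∞} {D : β → ℝ≥0∞ → ℕ∞} (hC : ∀ o, AEMeasurable (fun a => C a o) P)
    (hD : ∀ o, AEMeasurable (fun b => D b o) Q)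
    (h : ∀ l : List ℝ≥0∞, l ≠ [] → ∫ a, levelWeight l (C a) ∂P = ∫ b, levelWeight l (D b) ∂Q) :
    IdentDistrib (fun a => countStat (levelCounts (C a))) (fun b => countStat (levelCounts (D b)))
      P Q := by
  have hCm : AEMeasurable (fun a => levelCounts (C a)) P :=
    aemeasurable_pi_lambda _ fun i => (measurable_of_countable ENat.toNat).comp_aemeasurable
      (hC (level i))
  have hDm : AEMeasurable (fun b => levelCounts (D b)) Q :=
    aemeasurable_pi_lambda _ fun i => (measurable_of_countable ENat.toNat).comp_aemeasurable
      (hD (level i))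
  have := Measure.isProbabilityMeasure_map hCm
  have := Measure.isProbabilityMeasure_map hDm
  refine IdentDistrib.comp ⟨hCm, hDm, map_eq_of_integral_eq fun l hl => ?_⟩ measurable_countStat
  rw [integral_levelWeight_eq hC, integral_levelWeight_eq hD]
  exact h _ (by simpa using hl)

lemma monotone_valuesUpTo (s : ℕ → ℝ) : Monotone (valuesUpTo s) := fun _ _ ho =>
  encard_le_encard fun _ hi => ⟨hi.1, hi.2.trans ho⟩

lemma monotone_eventsUpTo (z p : ℝ≥0 → ℕ) : Monotone (eventsUpTo z p) := fun _ _ ho =>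
  encard_le_encard fun _ ht => ⟨ht.1, le_trans ht.2 ho⟩

/-- The index 0 is always counted because s_0 = 0 ≤ t; removing it turns the threshold k + 1 into k.
-/
lemma orderStat_eq {s : ℕ → ℝ} (h0 : s 0 = 0) (k : ℕ) : orderStat s k =
    sInf ((fun t : ℝ≥0 => (t : ℝ≥0∞)) '' {t : ℝ≥0 | (k : ℕ∞) ≤ valuesUpTo s t}) := by
  rw [orderStat]
  congr 2
  ext t
  have hset : {i : ℕ | (i : ℕ∞) ≤ nu s ∧ s i ≤ t} = insert 0 ((· + 1) ''
      {i : ℕ | ((i + 1 : ℕ) : ℕ∞) ≤ nu s ∧ ENNReal.ofReal (s (i + 1)) ≤ t}) := by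
    have hle : ∀ x : ℝ, ENNReal.ofReal x ≤ t ↔ x ≤ t := fun x => by
      rw [ENNReal.ofReal_le_iff_le_toReal ENNReal.coe_ne_top, ENNReal.coe_toReal]
    ext i
    rcases i with - | i
    · simp [h0]
    · simp [hle]
  rw [Set.mem_ofPred_eq, Set.mem_ofPred_eq, hset, encard_insert_of_notMem (by simp),
    (add_left_injective 1).encard_image, valuesUpTo, Nat.cast_add, Nat.cast_one]
  exact ENat.add_le_add_iff_right ENat.one_ne_top

lemma kthTime_eq (z p : ℝ≥0 → ℕ) (k : ℕ) : kthTime (eventTimes z p) k =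
    sInf ((fun t : ℝ≥0 => (t : ℝ≥0∞)) '' {t : ℝ≥0 | (k : ℕ∞) ≤ eventsUpTo z p t}) := by
  simp only [kthTime, eventsUpTo, ENNReal.coe_le_coe]
  rfl

lemma eventsUpTo_top (z p : ℝ≥0 → ℕ) : eventsUpTo z p ⊤ = (eventTimes z p).encard := by
  simp [eventsUpTo]

/-- For l ≠ [] both functionals equal w(0) = 1/2 + φ(0)/2, where w solves the walk equation for g =
`lev l` and φ is the Riccati solution built from it. Where the totals are finite, hence almost
surely, `countStat` returns the total and the ordered points. -/
theorem identDistrib_orderStat_kthTime {Ω Ω' : Type*} [MeasurableSpace Ω] [MeasurableSpace Ω']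
    {P : Measure Ω} {Q : Measure Ω'} [IsProbabilityMeasure P] [IsProbabilityMeasure Q]
    {X : ℕ → Ω → ℝ} (hlaw : ∀ i, HasLaw (X i) laplaceMeasure P) (hindep : iIndepFun X P)
    {Z N : ℝ≥0 → Ω' → ℕ} (hZ : IsCriticalBirthDeath bernoulliHalf Z Q) (hN : IsStandardPoisson N Q)
    (hind : IndepFun (fun ω t => Z t ω) (fun ω t => N t ω) Q) :
    IdentDistrib (fun ω => (nu (fun n => walk X n ω), fun k : ℕ => orderStat (fun n => walk X n ω) k))
      (fun ω => ((eventTimes (fun t => Z t ω) (fun t => N t ω)).encard,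
        fun k : ℕ => kthTime (eventTimes (fun t => Z t ω) (fun t => N t ω)) k)) P Q := by
  have hW := aemeasurable_walk fun i => (hlaw i).aemeasurable
  have hC : ∀ o, AEMeasurable (fun ω => valuesUpTo (fun n => walk X n ω) o) P := fun o =>
    (measurable_valuesUpTo o).comp_aemeasurable hW
  have hD := aemeasurable_eventsUpTo hZ hN hind
  have hnu := ae_nu_ne_top hlaw hindep
  have key := identDistrib_countStat hC hD (by
    intro l hl
    obtain ⟨w, hw, hw0, ⟨M, hM⟩, hsol⟩ := exists_isWalkSolution (measurable_lev l) (lev_nonneg l)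
      one_half_lt_one (lev_le_half hl)
    obtain ⟨φ, hφ, hφw⟩ := exists_isRiccatiSolution (measurable_lev l) (lev_nonneg l) (lev_le_one l)
      (countable_not_continuousAt_lev l) hw hw0 hM hsol
    rw [integral_levelWeight_eventsUpTo hZ hN hind l hφ (hφw ▸ hw0 0), ← hφw,
      ← integral_walkProd hlaw hindep (measurable_lev l) one_half_lt_one
        (fun x => by rw [abs_of_nonneg (lev_nonneg l x)]; exact lev_le_half hl x) hw
        (fun x => by rw [abs_of_nonneg (hw0 x)]; exact hM x) hsol]
    exact integral_congr_ae (hnu.mono fun ω h => levelWeight_valuesUpTo h l))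
  have hleft : (fun ω => countStat (levelCounts (valuesUpTo fun n => walk X n ω))) =ᵐ[P]
      fun ω => (nu (fun n => walk X n ω), fun k : ℕ => orderStat (fun n => walk X n ω) k) := by
    filter_upwards [hnu] with ω h
    have h0 : walk X 0 ω = 0 := by simp [walk]
    rw [countStat_levelCounts (monotone_valuesUpTo _) (by rwa [valuesUpTo_top h]),
      valuesUpTo_top h]
    simp only [orderStat_eq (s := fun n => walk X n ω) h0]
  have hright : (fun ω => countStat (levelCounts (eventsUpTo (fun t => Z t ω) fun t => N t ω))) =ᵐ[Q]
      fun ω => ((eventTimes (fun t => Z t ω) (fun t => N t ω)).encard,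
        fun k : ℕ => kthTime (eventTimes (fun t => Z t ω) (fun t => N t ω)) k) := by
    filter_upwards [ae_eventsUpTo hZ hN hind] with ω h
    rw [countStat_levelCounts (monotone_eventsUpTo _ _) h.2, eventsUpTo_top]
    simp only [kthTime_eq]
  exact ((IdentDistrib.of_ae_eq key.aemeasurable_fst hleft).symm.trans key).trans
    (IdentDistrib.of_ae_eq key.aemeasurable_snd hright)

end LaplaceWalk

end

theorem mainTheorem7 {Ω : Type*} [MeasurableSpace Ω] (P : Measure Ω) [IsProbabilityMeasure P]
    (X : ℕ → Ω → ℝ) (hlaw : ∀ i, HasLaw (X i) LaplaceWalk.laplaceMeasure P)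
    (hindep : iIndepFun X P) :
    (∀ (Ω' : Type*) [MeasurableSpace Ω'] (Q : Measure Ω') [IsProbabilityMeasure Q]
        (Z N : ℝ≥0 → Ω' → ℕ),
        LaplaceWalk.IsCriticalBirthDeath LaplaceWalk.bernoulliHalf Z Q →
        LaplaceWalk.IsStandardPoisson N Q →
        IndepFun (fun ω' t => Z t ω') (fun ω' t => N t ω') Q →
        IdentDistrib
          (fun ω => (LaplaceWalk.nu (fun n => LaplaceWalk.walk X n ω),
            fun k : ℕ => LaplaceWalk.orderStat (fun n => LaplaceWalk.walk X n ω) k))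
          (fun ω' => ((LaplaceWalk.eventTimes (fun t => Z t ω') (fun t => N t ω')).encard,
            fun k : ℕ => LaplaceWalk.kthTime
              (LaplaceWalk.eventTimes (fun t => Z t ω') (fun t => N t ω')) k))
          P Q) ∧
    (∀ᵐ ω ∂P, LaplaceWalk.nu (fun n => LaplaceWalk.walk X n ω) ≠ ⊤) ∧
    (∀ z : ℝ, z ≠ 0 → |z| ≤ 1 →
      Integrable (fun ω => z ^ (LaplaceWalk.nu (fun n => LaplaceWalk.walk X n ω)).toNat) P ∧
      ∫ ω, z ^ (LaplaceWalk.nu (fun n => LaplaceWalk.walk X n ω)).toNat ∂P =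
        z⁻¹ * (1 - Real.sqrt (1 - z))) :=
  ⟨fun _ _ _ _ _ _ hZ hN hind => LaplaceWalk.identDistrib_orderStat_kthTime hlaw hindep hZ hN hind,
    LaplaceWalk.ae_nu_ne_top hlaw hindep,
    fun _ hz0 hz1 => LaplaceWalk.integral_pow_nu hlaw hindep hz0 hz1⟩
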